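/- Let $U$ be a finite set of $n$ items with weights $w:U\to[0,\infty)$ and total weight $W=\sum_{a\in U}w(a)>0$. An algorithm may draw independent proportional samples (each returns $(a,w(a))$ with probability $w(a)/W$), test two items for equality, and use independent private uniform random numbers in $[0,1]$; its cost is the number of proportional samples drawn. Write $B_b=\{a\in U: 2^b\le w(a)<2^{b+1}\}$ for $b\in\mathbb Z$. The algorithm $\mathrm{NoAdvicePropEstimator}(\varepsilon)$, which gets only $\varepsilon$ as input (it knows neither $n$ nor $w$), is the following. 1. Draw two samples $a_1,a_2$ and let $b=\max(\lfloor\log_2 w(a_1)\rfloor,\lfloor\log_2 w(a_2)\rfloor)$. 2. $\tilde n_b$ is the median of 15 independent runs of: draw uniform samples from $B_b$ until the first repeated item, and return $4s^2$, where $s$ is the number of distinct items seen. A proportional sample of $B_b$ is obtained by drawing until an item of $B_b$ appears; a uniform sample of $B_b$ is obtained by drawing proportional samples $a$ of $B_b$ and accepting $a$ with probability $2^b/w(a)$, until one is accepted. 3. $\hat W_b$ is the median of 15 independent runs of $\mathrm{PropEstimator}(\tilde n_b,\varepsilon/3)$ on proportional samples of $B_b$, where $\mathrm{PropEstimator}(\tilde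 n,\delta)$ takes $m=\lceil\sqrt{24\tilde n}/\delta\rceil+1$ samples and returns $\binom m2\big(\sum_{s\in S}\binom{c_s}{2}/w(s)\big)^{-1}$; here $S$ is the set of sampled items, $c_s$ is the multiplicity of $s$, and the value is $\infty$ if no item is repeated. 4. $\hat P_b$ is the median of 15 independent runs of: draw proportional samples from $U$ until $k=\lceil 12/(\varepsilon/3)^2\rceil$ of them lie in $B_b$, and return $k$ divided by the number of samples drawn. 5. Return $\hat W=\hat W_b/\hat P_b$. **Theorem.** There is an absolute constant $C>0$ such that for all $U$, $w$ as above with $W>0$ and all $0<\varepsilon<1$: (i) with probability at least $2/3$ the algorithm halts and its output satisfies $(1-\varepsilon)W\le\hat W\le(1+\varepsilon)W$; (ii) if $n\ge 2$, the expected number of proportional samples it draws (counted as $\infty$ on runs that do not halt) is at most $C\left(\dfrac{\sqrt n}{\varepsilon}+\dfrac{\log n}{\varepsilon^2}\right)$. -/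

import Mathlib

open MeasureTheory
open scoped NNReal ENNReal

noncomputable section

namespace PropSampling

/-! ### Randomized programs with proportional-sampling access -/

/-- The randomness available to a program: the answers to its successive proportional-sampling
queries (an item together with its weight) and its private uniform random numbers. -/
structure Tape (U : Type) where
  sample : ℕ → U × ℝ
  coin : ℕ → unitInterval

/-- A randomized program returning a value in `α`. Run on a tape it either diverges (`none`) or
returns a value, the number of proportional samples it has drawn, and the unread part of the tape.
All programs below are assembled from `pure`, `bind`, `draw`, `uniform` and `loop` only; they see
items through equality tests and see nothing of the universe besides the drawn samples. -/
def Prog (U α : Type) : Type := Tape U → Option (α × ℕ × Tape U)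

instance (U : Type) : Monad (Prog U) where
  pure a := fun t => some (a, 0, t)
  bind m f := fun t =>
    (m t).bind fun r => (f r.1 r.2.2).map fun q => (q.1, r.2.1 + q.2.1, q.2.2)

variable {U α σ : Type}

/-- Draw one proportional sample `(a, w a)`; this is the only operation of cost one. -/
def draw : Prog U (U × ℝ) := fun t =>
  some (t.sample 0, 1, ⟨fun i => t.sample (i + 1), t.coin⟩)

/-- Draw a real number uniformly from `[0, 1]`. -/
def uniform : Prog U ℝ := fun t =>
  some ((t.coin 0 : ℝ), 0, ⟨t.sample, fun i => t.coin (i + 1)⟩)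

/-- At most `k` rounds of a loop; a round returns a new loop state (`inl`) or the result (`inr`). -/
def loopFuel (body : σ → Prog U (σ ⊕ α)) : ℕ → σ → Prog U α
  | 0, _ => fun _ => none
  | k + 1, s => do
    match ← body s with
    | .inl s' => loopFuel body k s'
    | .inr a => pure a

open Classical in
/-- The unbounded loop: repeat `body` until it returns a result; diverge if it never does. -/
def loop (body : σ → Prog U (σ ⊕ α)) (s : σ) : Prog U α := fun t =>
  if h : ∃ k, (loopFuel body k s t).isSome then loopFuel body (Nat.find h) s t else none

/-- Run a program `k` times with fresh randomness and list the returned values. -/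
def replicate : ℕ → Prog U α → Prog U (List α)
  | 0, _ => pure []
  | k + 1, m => do
    let a ← m
    let l ← replicate k m
    pure (a :: l)

/-- The median of a list of odd length. -/
def median [LinearOrder α] [Inhabited α] (l : List α) : α :=
  (l.insertionSort (· ≤ ·)).getD (l.length / 2) default

/-- Probability amplification by the median trick. Fifteen runs raise a success probability of
`2 / 3` to at least `9 / 10`, since `P(Bin(15, 1/3) ≥ 8) < 1 / 10`. -/
def amplify [LinearOrder α] [Inhabited α] (m : Prog U α) : Prog U α := do
  let l ← replicate 15 m
  pure (median l)

/-! ### The algorithm -/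

/-- Sample proportionally until the weight lies in `[2^b, 2^(b+1))`. -/
def propBucketSampler (b : ℤ) : Prog U (U × ℝ) :=
  loop (fun _ : Unit => do
    let x ← draw
    if x.2 ∈ Set.Ico ((2 : ℝ) ^ b) ((2 : ℝ) ^ (b + 1)) then pure (.inr x) else pure (.inl ())) ()

/-- Rejection sampling: a sample of weight `v` from the bucket is rejected if a uniform number
exceeds `2^b / v`. -/
def unifBucketSampler (b : ℤ) : Prog U (U × ℝ) :=
  loop (fun _ : Unit => do
    let x ← propBucketSampler b
    let u ← uniform
    if u > (2 : ℝ) ^ b / x.2 then pure (.inl ()) else pure (.inr x)) ()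

/-- Sample until the first repeated item; return `4 s ^ 2`, where `s` is the number of distinct
items seen. -/
def setSizeEstimator [DecidableEq U] (sampler : Prog U (U × ℝ)) : Prog U ℕ :=
  loop (fun S : Finset U => do
    let x ← sampler
    if x.1 ∈ S then pure (.inr (4 * S.card ^ 2)) else pure (.inl (insert x.1 S))) ∅

/-- The estimate `(m choose 2) / ∑ₛ (cₛ choose 2) / w(s)` from a list of `m` samples, where `s`
ranges over the distinct sampled items and `cₛ` is the multiplicity of `s`; it is `∞` if no item
is repeated (and `m ≥ 2`). -/
def pairEstimate [DecidableEq U] (l : List (U × ℝ)) : ℝ≥0∞ :=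
  (l.length.choose 2 : ℝ≥0∞) *
    (∑ s ∈ l.toFinset,
      ((l.countP fun x => x.1 = s.1).choose 2 : ℝ≥0∞) / ENNReal.ofReal s.2)⁻¹

/-- The estimator with advice `n'`: take `m = ⌈√(24 n') / ε⌉ + 1` samples. -/
def propEstimator [DecidableEq U] (sampler : Prog U (U × ℝ)) (n' ε : ℝ) : Prog U ℝ≥0∞ := do
  let l ← replicate (⌈√(24 * n') / ε⌉₊ + 1) sampler
  pure (pairEstimate l)

/-- Estimate the success probability of a repeatable trial: repeat the trial until
`k = ⌈12 / ε ^ 2⌉` successes have occurred and return `k` divided by the number of trials.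
The loop state is (successes, trials). -/
def bernoulliEstimator (trial : Prog U Bool) (ε : ℝ) : Prog U ℝ :=
  loop (fun s : ℕ × ℕ => do
    let x ← trial
    let successes := if x then s.1 + 1 else s.1
    if successes = ⌈12 / ε ^ 2⌉₊ then pure (.inr ((successes : ℝ) / ((s.2 + 1 : ℕ) : ℝ)))
    else pure (.inl (successes, s.2 + 1))) (0, 0)

/-- One proportional sample, reporting whether it falls in the bucket `b`. -/
def bucketTrial (b : ℤ) : Prog U Bool := do
  let x ← draw
  pure (decide (x.2 ∈ Set.Ico ((2 : ℝ) ^ b) ((2 : ℝ) ^ (b + 1))))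

/-- The estimator of the total weight without advice. -/
def noAdvicePropEstimator [DecidableEq U] (ε : ℝ) : Prog U ℝ≥0∞ := do
  let x₁ ← draw
  let x₂ ← draw
  let b := max ⌊Real.logb 2 x₁.2⌋ ⌊Real.logb 2 x₂.2⌋
  let nb ← amplify (setSizeEstimator (unifBucketSampler b))
  let Wb ← amplify (propEstimator (propBucketSampler b) nb (ε / 3))
  let Pb ← amplify (bernoulliEstimator (bucketTrial b) (ε / 3))
  pure (Wb / ENNReal.ofReal Pb)

/-! ### Executing a program on a weighted universe -/

/-- The tape on which the drawn items are `ω.1 0, ω.1 1, …`, each reported with its weight. -/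
def tapeOf (w : U → ℝ≥0) (ω : (ℕ → U) × (ℕ → unitInterval)) : Tape U :=
  ⟨fun i => (ω.1 i, (w (ω.1 i) : ℝ)), ω.2⟩

/-- The proportional distribution on `U`: item `a` has probability `w a / ∑ x, w x`. -/
def propPMF [Fintype U] (w : U → ℝ≥0) (hw : 0 < ∑ a, w a) : PMF U :=
  PMF.ofFintype (fun a => ((w a / ∑ x, w x : ℝ≥0) : ℝ≥0∞)) (by
    rw [← ENNReal.ofNNReal_finsetSum, ← Finset.sum_div, div_self hw.ne', ENNReal.coe_one])

/-- The law of the randomness: independent proportional samples and, independently of them,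
independent uniform numbers in `[0, 1]`. -/
def randomness [Fintype U] [MeasurableSpace U] (w : U → ℝ≥0) (hw : 0 < ∑ a, w a) :
    Measure ((ℕ → U) × (ℕ → unitInterval)) :=
  (Measure.infinitePi fun _ : ℕ => (propPMF w hw).toMeasure).prod
    (Measure.infinitePi fun _ : ℕ => (volume : Measure unitInterval))

/-- The number of proportional samples drawn by a run, `∞` if the run diverges. -/
def sampleCount (m : Prog U α) (t : Tape U) : ℝ≥0∞ :=
  match m t with
  | none => ⊤
  | some r => (r.2.1 : ℝ≥0∞)

/-- The run halts and its output is a `(1 ± ε)`-approximation of `W`. -/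
def Approximates (m : Prog U ℝ≥0∞) (t : Tape U) (ε W : ℝ) : Prop :=
  ∃ r, m t = some r ∧ ENNReal.ofReal ((1 - ε) * W) ≤ r.1 ∧ r.1 ≤ ENNReal.ofReal ((1 + ε) * W)

end PropSampling

end

/-! Write `N_b` for the size of a bucket, `V_b` for its weight, `P_b = V_b / W`, and `L_b` for the
probability that a sample has level at most `b`.

Correctness. Almost surely both first samples have positive weight, so the chosen bucket is
nonempty. For any nonempty bucket each single run of the three stages fails with probability at most
1/3. A repetition among so few uniform samples that `4 s ^ 2 < N_b` has probability at most the sum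
of `i / N_b` over `4 i ^ 2 < N_b` (`mean_setSizeEstimator_small_le`). If the advice is at least
`N_b`, Chebyshev's inequality applies to the weighted number of repeated pairs among `m` samples,
whose mean is `(m choose 2) / V_b` and whose variance is `(m choose 2) (N_b - 1) / V_b ^ 2`
(`listMean_pairDeviation_sq`, `mean_propEstimator_le`). Chebyshev's inequality also controls the
number of trials needed for `k` successes (`mean_bernoulliEstimator_le`). Medians lower each failure
probability to 1/10 (`mean_amplify_le`), and 3/10 is less than 1/3.

Cost. A sample of the bucket costs `1 / P_b` on average and the mean of the square root of the size
estimate is `O(√N_b)`, so the bucket `b` costs `O((√N_b / ε + 1 / ε ^ 2) / P_b)`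
(`cost_bucketEstimator_le`). It is chosen with probability at most `2 P_b L_b` (`sum_max_level_le`).
The factor `P_b` cancels, and sums of `√N_b L_b` and of `L_b` remain. Below the level of the mean
weight `W / n`, `L_b` decays geometrically, because `n` light items weigh little. Above it `N_b ≤ W
/ 2 ^ b` decays geometrically, and only about `log₂ n` levels are nonempty. Hence the sums are
`O(√n)` and `O(log n)` (`sum_sqrt_mul_lowProb_le`, `sum_lowProb_le`).

Programs are functions of a random tape. `Fresh` is their strong Markov property: it makes `mean`
and `cost` compositional, and loops are then handled by potentials (`mean_loop_le`, `cost_loop_le`,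
`proper_loop`). Only upper bounds on means are proved. A lower bound on the success probability
follows from an upper bound on failure together with almost sure termination, which is `Proper`. -/

noncomputable section

namespace PropSampling

/-! ### The first coordinate of an i.i.d. sequence -/

/-- Prepend an entry to a sequence. -/
def consSeq {X : Type} (x : X) (f : ℕ → X) : ℕ → X := fun n => Nat.casesOn n x f

lemma measurable_consSeq {X : Type} [MeasurableSpace X] :
    Measurable fun p : X × (ℕ → X) => consSeq p.1 p.2 := by
  refine measurable_pi_lambda _ fun n => ?_
  cases n with
  | zero => exact measurable_fst
  | succ n => exact (measurable_pi_apply n).comp measurable_snd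

/-- An infinite product measure is determined by its finite cylinders, and the preimage of a
cylinder is a condition on the prepended entry times a shifted cylinder. -/
lemma measurePreserving_consSeq {X : Type} [MeasurableSpace X] (μ : Measure X)
    [IsProbabilityMeasure μ] :
    MeasurePreserving (fun p : X × (ℕ → X) => consSeq p.1 p.2)
      (μ.prod (Measure.infinitePi fun _ : ℕ => μ)) (Measure.infinitePi fun _ : ℕ => μ) := by
  refine ⟨measurable_consSeq, Measure.eq_infinitePi _ fun s t ht => ?_⟩
  rw [Measure.map_apply measurable_consSeq (MeasurableSet.pi s.countable_toSet fun i _ => ht i)]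
  -- Enlarging the index set to an initial segment lets the factor of index 0 be split off, whether
  -- or not 0 belongs to `s`.
  obtain ⟨n, hn⟩ : ∃ n, s ⊆ Finset.range (n + 1) :=
    ⟨s.sup id, fun i hi => Finset.mem_range.2 (Nat.lt_succ_of_le (Finset.le_sup (f := id) hi))⟩
  let s' := (Finset.range n).filter fun i => i + 1 ∈ s
  have hpre : (fun p : X × (ℕ → X) => consSeq p.1 p.2) ⁻¹' (Set.pi s t) =
      (if 0 ∈ s then t 0 else Set.univ) ×ˢ (Set.pi s' fun i => t (i + 1)) := by
    ext ⟨x, f⟩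
    simp only [Set.mem_preimage, Set.mem_pi, Set.mem_prod, s', Finset.coe_filter,
      Finset.mem_range, Set.mem_ofPred_eq, Finset.mem_coe]
    constructor
    · intro h
      refine ⟨?_, fun i hi => h (i + 1) hi.2⟩
      split_ifs with h0
      · exact h 0 h0
      · trivial
    · rintro ⟨h0, h1⟩ i hi
      cases i with
      | zero =>
        rw [if_pos hi] at h0
        exact h0
      | succ i =>
        have := Finset.mem_range.1 (hn hi)
        exact h1 i ⟨by omega, hi⟩
  rw [hpre, Measure.prod_prod, Measure.infinitePi_pi _ fun i _ => ht (i + 1)]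
  have hs : ∏ i ∈ s, μ (t i) = ∏ i ∈ Finset.range (n + 1), if i ∈ s then μ (t i) else 1 := by
    rw [Finset.prod_ite_mem, Finset.inter_eq_right.2 hn]
  rw [hs, Finset.prod_range_succ', mul_comm, Finset.prod_filter]
  congr 1
  split_ifs <;> simp

/-! ### Expectations over runs -/

section Semantics

variable {U α β σ : Type}

/-- Evaluate a functional on the outcome of a run, with value `0` on diverging runs. -/
def fold (H : α → ℕ → Tape U → ℝ≥0∞) : Option (α × ℕ × Tape U) → ℝ≥0∞
  | none => 0
  | some r => H r.1 r.2.1 r.2.2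

@[simp] lemma fold_none (H : α → ℕ → Tape U → ℝ≥0∞) : fold H none = 0 := rfl

@[simp] lemma fold_some (H : α → ℕ → Tape U → ℝ≥0∞) (r : α × ℕ × Tape U) :
    fold H (some r) = H r.1 r.2.1 r.2.2 := rfl

lemma fold_pure (H : α → ℕ → Tape U → ℝ≥0∞) (a : α) (t : Tape U) :
    fold H ((pure a : Prog U α) t) = H a 0 t := rfl

lemma fold_bind (H : β → ℕ → Tape U → ℝ≥0∞) (m : Prog U α) (f : α → Prog U β) (t : Tape U) :
    fold H ((m >>= f) t) =
      fold (fun a c t' => fold (fun b d => H b (c + d)) (f a t')) (m t) := by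
  change fold H ((m t).bind fun r => (f r.1 r.2.2).map fun q => (q.1, r.2.1 + q.2.1, q.2.2)) = _
  rcases m t with _ | ⟨a, c, t'⟩
  · rfl
  · simp only [Option.bind_some, fold_some]
    rcases f a t' with _ | ⟨b, d, t''⟩ <;> rfl

variable [Fintype U] [MeasurableSpace U] (w : U → ℝ≥0) (hw : 0 < ∑ a, w a)

instance : IsProbabilityMeasure (randomness w hw) := by
  unfold randomness; infer_instance

/-- The expected value of a functional of the output and the cost of a run, where diverging runs
contribute `0`. -/
def expect (m : Prog U α) (G : α → ℕ → ℝ≥0∞) : ℝ≥0∞ :=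
  ∫⁻ ω, fold (fun a c _ => G a c) (m (tapeOf w ω)) ∂randomness w hw

/-- The tape left over by a terminating run is distributed as a new tape, independently of the
output and the cost of the run. -/
structure Fresh (m : Prog U α) : Prop where
  measurable : ∀ H : α → ℕ → Tape U → ℝ≥0∞, (∀ a c, Measurable fun ω => H a c (tapeOf w ω)) →
    Measurable fun ω => fold H (m (tapeOf w ω))
  lintegral : ∀ H : α → ℕ → Tape U → ℝ≥0∞, (∀ a c, Measurable fun ω => H a c (tapeOf w ω)) →
    ∫⁻ ω, fold H (m (tapeOf w ω)) ∂randomness w hw =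
      expect w hw m fun a c => ∫⁻ ω, H a c (tapeOf w ω) ∂randomness w hw

variable {w hw}

lemma Fresh.measurable_expect {m : Prog U α} (h : Fresh w hw m) (G : α → ℕ → ℝ≥0∞) :
    Measurable fun ω => fold (fun a c _ => G a c) (m (tapeOf w ω)) :=
  h.measurable _ fun _ _ => measurable_const

omit [Fintype U] [MeasurableSpace U] in
lemma fold_mono {H K : α → ℕ → Tape U → ℝ≥0∞} (h : ∀ a c t, H a c t ≤ K a c t)
    (r : Option (α × ℕ × Tape U)) : fold H r ≤ fold K r := by
  rcases r with _ | r
  · rfl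
  · exact h _ _ _

lemma expect_mono {m : Prog U α} {G K : α → ℕ → ℝ≥0∞} (h : ∀ a c, G a c ≤ K a c) :
    expect w hw m G ≤ expect w hw m K :=
  lintegral_mono fun _ => fold_mono (fun a c _ => h a c) _

lemma Fresh.expect_add {m : Prog U α} (h : Fresh w hw m) (G K : α → ℕ → ℝ≥0∞) :
    expect w hw m (fun a c => G a c + K a c) = expect w hw m G + expect w hw m K := by
  unfold expect
  rw [← lintegral_add_left (h.measurable_expect G)]
  refine lintegral_congr fun ω => ?_
  rcases m (tapeOf w ω) with _ | r <;> simp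

lemma Fresh.expect_mul_const {m : Prog U α} (h : Fresh w hw m) (G : α → ℕ → ℝ≥0∞) (r : ℝ≥0∞) :
    expect w hw m (fun a c => G a c * r) = expect w hw m G * r := by
  unfold expect
  rw [← lintegral_mul_const _ (h.measurable_expect G)]
  refine lintegral_congr fun ω => ?_
  rcases m (tapeOf w ω) with _ | r <;> simp

lemma expect_one_le (m : Prog U α) : expect w hw m (fun _ _ => 1) ≤ 1 := by
  calc expect w hw m (fun _ _ => 1) ≤ ∫⁻ _, 1 ∂randomness w hw :=
        lintegral_mono fun ω => by rcases m (tapeOf w ω) with _ | r <;> simp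
    _ = 1 := by simp

lemma Fresh.expect_const_le {m : Prog U α} (h : Fresh w hw m) (r : ℝ≥0∞) :
    expect w hw m (fun _ _ => r) ≤ r := by
  have := h.expect_mul_const (fun _ _ => 1) r
  simp only [one_mul] at this
  rw [this]
  exact mul_le_of_le_one_left zero_le (expect_one_le m)

lemma expect_pure (a : α) (G : α → ℕ → ℝ≥0∞) :
    expect w hw (pure a) G = G a 0 := by
  simp [expect, fold_pure]

lemma fresh_pure (a : α) : Fresh w hw (pure a) where
  measurable H hH := by simpa only [fold_pure] using hH a 0
  lintegral H hH := by simp only [fold_pure, expect_pure]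

/-- The strong Markov property: the continuation reads the left-over tape, which can be averaged
separately once the output and the cost of `m` are fixed. -/
lemma Fresh.expect_bind {m : Prog U α} {f : α → Prog U β} (hm : Fresh w hw m)
    (hf : ∀ a, Fresh w hw (f a)) (G : β → ℕ → ℝ≥0∞) :
    expect w hw (m >>= f) G =
      expect w hw m fun a c => expect w hw (f a) fun b d => G b (c + d) := by
  unfold expect
  simp only [fold_bind]
  exact hm.lintegral (fun a c t' => fold (fun b d _ => G b (c + d)) (f a t'))
    fun a c => (hf a).measurable_expect _

lemma Fresh.bind {m : Prog U α} {f : α → Prog U β} (hm : Fresh w hw m)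
    (hf : ∀ a, Fresh w hw (f a)) : Fresh w hw (m >>= f) where
  measurable H hH := by
    simp only [fold_bind]
    exact hm.measurable _ fun a c => (hf a).measurable _ fun b d => hH b (c + d)
  lintegral H hH := by
    simp only [fold_bind]
    rw [hm.lintegral _ fun a c => (hf a).measurable _ fun b d => hH b (c + d),
      hm.expect_bind hf]
    congr 1
    funext a c
    exact (hf a).lintegral _ fun b d => hH b (c + d)

/-! ### Primitive programs -/

instance : IsProbabilityMeasure (propPMF w hw).toMeasure := PMF.toMeasure.isProbabilityMeasure _

lemma lintegral_randomness_sample (F : (ℕ → U) × (ℕ → unitInterval) → ℝ≥0∞) (hF : Measurable F) :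
    ∫⁻ ω, F ω ∂randomness w hw =
      ∫⁻ x, ∫⁻ ω, F (consSeq x ω.1, ω.2) ∂randomness w hw ∂(propPMF w hw).toMeasure := by
  have h1 := (measurePreserving_consSeq (propPMF w hw).toMeasure).prod
    (MeasurePreserving.id (Measure.infinitePi fun _ : ℕ => (volume : Measure unitInterval)))
  have h2 := h1.comp (measurePreserving_prodAssoc (propPMF w hw).toMeasure
    (Measure.infinitePi fun _ : ℕ => (propPMF w hw).toMeasure)
    (Measure.infinitePi fun _ : ℕ => (volume : Measure unitInterval))).symm
  unfold randomness
  rw [← h2.lintegral_comp hF, lintegral_prod]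
  · rfl
  · exact (hF.comp h2.measurable).aemeasurable

lemma lintegral_randomness_coin (F : (ℕ → U) × (ℕ → unitInterval) → ℝ≥0∞) (hF : Measurable F) :
    ∫⁻ ω, F ω ∂randomness w hw =
      ∫⁻ u : unitInterval, ∫⁻ ω, F (ω.1, consSeq u ω.2) ∂randomness w hw := by
  have h1 := (MeasurePreserving.id (Measure.infinitePi fun _ : ℕ => (propPMF w hw).toMeasure)).prod
    (measurePreserving_consSeq (volume : Measure unitInterval))
  have h2 := h1.comp (measurePreserving_prodAssoc
    (Measure.infinitePi fun _ : ℕ => (propPMF w hw).toMeasure) (volume : Measure unitInterval)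
    (Measure.infinitePi fun _ : ℕ => (volume : Measure unitInterval)))
  -- The coins form the second factor of the randomness, so the split-off coin has to be moved past
  -- the samples.
  have h3 := h2.comp ((Measure.measurePreserving_swap (μ := (volume : Measure unitInterval))
    (ν := Measure.infinitePi fun _ : ℕ => (propPMF w hw).toMeasure)).prod
    (MeasurePreserving.id (Measure.infinitePi fun _ : ℕ => (volume : Measure unitInterval))))
  have h4 := h3.comp (measurePreserving_prodAssoc (volume : Measure unitInterval)
    (Measure.infinitePi fun _ : ℕ => (propPMF w hw).toMeasure)
    (Measure.infinitePi fun _ : ℕ => (volume : Measure unitInterval))).symm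
  unfold randomness
  rw [← h4.lintegral_comp hF, lintegral_prod]
  · rfl
  · exact (hF.comp h4.measurable).aemeasurable

section

variable [MeasurableSingletonClass U]

lemma measurable_draw (H : U × ℝ → ℕ → Tape U → ℝ≥0∞)
    (hH : ∀ a c, Measurable fun ω => H a c (tapeOf w ω)) :
    Measurable fun ω => fold H ((draw : Prog U (U × ℝ)) (tapeOf w ω)) := by
  have h1 : Measurable fun p : U × ((ℕ → U) × (ℕ → unitInterval)) =>
      H (p.1, (w p.1 : ℝ)) 1 (tapeOf w p.2) :=
    -- The universe is finite, so measurability in the rest of the tape for each drawn item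
    -- separately is enough.
    measurable_from_prod_countable_right fun a => hH (a, (w a : ℝ)) 1
  have h2 : Measurable fun ω : (ℕ → U) × (ℕ → unitInterval) =>
      (ω.1 0, ((fun i => ω.1 (i + 1)), ω.2)) := by
    fun_prop
  exact h1.comp h2

lemma lintegral_draw (H : U × ℝ → ℕ → Tape U → ℝ≥0∞)
    (hH : ∀ a c, Measurable fun ω => H a c (tapeOf w ω)) :
    ∫⁻ ω, fold H ((draw : Prog U (U × ℝ)) (tapeOf w ω)) ∂randomness w hw =
      ∑ a, ((w a / ∑ x, w x : ℝ≥0) : ℝ≥0∞) *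
        ∫⁻ ω, H (a, (w a : ℝ)) 1 (tapeOf w ω) ∂randomness w hw := by
  rw [lintegral_randomness_sample _ (measurable_draw H hH), lintegral_fintype]
  refine Finset.sum_congr rfl fun a _ => ?_
  rw [PMF.toMeasure_apply_singleton _ _ (measurableSet_singleton a), mul_comm]
  rfl

lemma expect_draw (G : U × ℝ → ℕ → ℝ≥0∞) :
    expect w hw draw G = ∑ a, ((w a / ∑ x, w x : ℝ≥0) : ℝ≥0∞) * G (a, (w a : ℝ)) 1 := by
  unfold expect
  rw [lintegral_draw _ fun _ _ => measurable_const]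
  simp

lemma fresh_draw : Fresh w hw (draw : Prog U (U × ℝ)) where
  measurable := measurable_draw
  lintegral H hH := by rw [lintegral_draw H hH, expect_draw]

end

/-- Branch on a private random number exceeding a threshold. -/
def coinBranch (q : ℝ) (x y : α) : Prog U α := do
  let u ← uniform
  if u > q then pure x else pure y

omit [Fintype U] [MeasurableSpace U] in
lemma fold_coinBranch (H : α → ℕ → Tape U → ℝ≥0∞) (q : ℝ) (x y : α)
    (ω : (ℕ → U) × (ℕ → unitInterval)) :
    fold H (coinBranch q x y (tapeOf w ω)) =
      if (ω.2 0 : ℝ) > q then H x 0 (tapeOf w (ω.1, fun i => ω.2 (i + 1)))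
      else H y 0 (tapeOf w (ω.1, fun i => ω.2 (i + 1))) := by
  unfold coinBranch
  rw [fold_bind]
  change fold (fun b d => H b (0 + d)) ((if (ω.2 0 : ℝ) > q then pure x else pure y : Prog U α)
    (tapeOf w (ω.1, fun i => ω.2 (i + 1)))) = _
  split_ifs <;> rw [fold_pure]

omit [Fintype U] in
lemma measurable_coinBranch (H : α → ℕ → Tape U → ℝ≥0∞)
    (hH : ∀ a c, Measurable fun ω => H a c (tapeOf w ω)) (q : ℝ) (x y : α) :
    Measurable fun ω => fold H (coinBranch q x y (tapeOf w ω)) := by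
  simp only [fold_coinBranch]
  have h2 : Measurable fun ω : (ℕ → U) × (ℕ → unitInterval) =>
      (ω.1, fun i => ω.2 (i + 1)) := by
    fun_prop
  refine Measurable.ite ?_ ((hH x 0).comp h2) ((hH y 0).comp h2)
  exact measurableSet_lt measurable_const
    (measurable_subtype_coe.comp ((measurable_pi_apply 0).comp measurable_snd))

lemma volume_unitInterval_gt {q : ℝ} (h0 : 0 ≤ q) (h1 : q ≤ 1) :
    (volume : Measure unitInterval) {u | (u : ℝ) > q} = ENNReal.ofReal (1 - q) := by
  have : {u : unitInterval | (u : ℝ) > q} = Set.Ioi ⟨q, h0, h1⟩ := by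
    ext u; simp [← Subtype.coe_lt_coe]
  rw [this, unitInterval.volume_Ioi]

lemma volume_unitInterval_le {q : ℝ} (h0 : 0 ≤ q) (h1 : q ≤ 1) :
    (volume : Measure unitInterval) {u | ¬ (u : ℝ) > q} = ENNReal.ofReal q := by
  have : {u : unitInterval | ¬ (u : ℝ) > q} = Set.Iic ⟨q, h0, h1⟩ := by
    ext u; simp [← Subtype.coe_le_coe]
  rw [this, unitInterval.volume_Iic]

lemma measurableSet_unitInterval_gt (q : ℝ) : MeasurableSet {u : unitInterval | (u : ℝ) > q} :=
  measurableSet_lt measurable_const measurable_subtype_coe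

lemma lintegral_coinBranch (H : α → ℕ → Tape U → ℝ≥0∞)
    (hH : ∀ a c, Measurable fun ω => H a c (tapeOf w ω)) (q : ℝ) (x y : α) :
    ∫⁻ ω, fold H (coinBranch q x y (tapeOf w ω)) ∂randomness w hw =
      volume {u : unitInterval | (u : ℝ) > q} * ∫⁻ ω, H x 0 (tapeOf w ω) ∂randomness w hw +
      volume {u : unitInterval | ¬ (u : ℝ) > q} *
        ∫⁻ ω, H y 0 (tapeOf w ω) ∂randomness w hw := by
  rw [lintegral_randomness_coin _ (measurable_coinBranch H hH q x y)]
  have hm := measurableSet_unitInterval_gt q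
  have h : ∀ u : unitInterval,
      ∫⁻ ω, fold H (coinBranch q x y (tapeOf w (ω.1, consSeq u ω.2))) ∂randomness w hw =
      {u : unitInterval | (u : ℝ) > q}.indicator
        (fun _ => ∫⁻ ω, H x 0 (tapeOf w ω) ∂randomness w hw) u +
      {u : unitInterval | (u : ℝ) > q}ᶜ.indicator
        (fun _ => ∫⁻ ω, H y 0 (tapeOf w ω) ∂randomness w hw) u := by
    intro u
    simp only [fold_coinBranch]
    by_cases hu : (u : ℝ) > q
    · simp [Set.indicator, hu, consSeq]
    · simp [Set.indicator, hu, consSeq]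
  simp only [h]
  rw [lintegral_add_left (measurable_const.indicator hm), lintegral_indicator_const hm,
    lintegral_indicator_const hm.compl, mul_comm,
    mul_comm (volume {u : unitInterval | ¬ (u : ℝ) > q})]
  rfl

lemma expect_coinBranch (G : α → ℕ → ℝ≥0∞) (q : ℝ) (x y : α) :
    expect w hw (coinBranch q x y) G =
      volume {u : unitInterval | (u : ℝ) > q} * G x 0 +
      volume {u : unitInterval | ¬ (u : ℝ) > q} * G y 0 := by
  unfold expect
  rw [lintegral_coinBranch _ fun _ _ => measurable_const]
  simp

/-- The program `uniform` alone is not `Fresh`: the functionals tested there are measurable only for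
each output separately, which is too weak for a continuum of outputs. After the comparison only two
outputs remain. -/
lemma fresh_coinBranch (q : ℝ) (x y : α) : Fresh w hw (coinBranch q x y) where
  measurable H hH := measurable_coinBranch H hH q x y
  lintegral H hH := by rw [lintegral_coinBranch H hH, expect_coinBranch]

end Semantics

/-! ### Loops -/

section Loop

variable {U α β σ : Type}

lemma bind_apply (m : Prog U α) (f : α → Prog U β) (t : Tape U) :
    (m >>= f) t = (m t).bind fun r => (f r.1 r.2.2).map fun q => (q.1, r.2.1 + q.2.1, q.2.2) :=
  rfl

/-- The continuation of a loop after one round. -/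
def afterRound (k : σ → Prog U α) : σ ⊕ α → Prog U α
  | .inl s => k s
  | .inr a => pure a

lemma loopFuel_succ (body : σ → Prog U (σ ⊕ α)) (k : ℕ) (s : σ) :
    loopFuel body (k + 1) s = body s >>= afterRound (loopFuel body k) := by
  change (body s >>= _) = _
  congr 1

lemma loopFuel_mono_succ (body : σ → Prog U (σ ⊕ α)) (k : ℕ) (s : σ) (t : Tape U)
    (r : α × ℕ × Tape U) (h : loopFuel body k s t = some r) :
    loopFuel body (k + 1) s t = some r := by
  induction k generalizing s t r with
  | zero => exact absurd h (by simp [loopFuel])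
  | succ k ih =>
    rw [loopFuel_succ, bind_apply] at h ⊢
    rcases hb : body s t with _ | ⟨x, c, t'⟩
    · simp [hb] at h
    · rw [hb] at h
      simp only [Option.bind_some] at h ⊢
      rcases x with s' | a
      · simp only [afterRound, Option.map_eq_some_iff] at h ⊢
        obtain ⟨q, hq, rfl⟩ := h
        exact ⟨q, ih s' t' q hq, rfl⟩
      · exact h

lemma loopFuel_mono (body : σ → Prog U (σ ⊕ α)) {k l : ℕ} (hkl : k ≤ l) (s : σ) (t : Tape U)
    (r : α × ℕ × Tape U) (h : loopFuel body k s t = some r) : loopFuel body l s t = some r := by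
  induction l, hkl using Nat.le_induction with
  | base => exact h
  | succ l _ ih => exact loopFuel_mono_succ body l s t r ih

lemma fold_loopFuel_mono (H : α → ℕ → Tape U → ℝ≥0∞) (body : σ → Prog U (σ ⊕ α)) (s : σ)
    (t : Tape U) : Monotone fun k => fold H (loopFuel body k s t) := by
  intro k l hkl
  rcases h : loopFuel body k s t with _ | r
  · simp [h]
  · simp [h, loopFuel_mono body hkl s t r h]

/-- Truncated runs agree as soon as they halt, so the supremum is attained at the first sufficient
fuel. This monotone limit is what brings monotone convergence to bear on loops. -/
lemma fold_loop (H : α → ℕ → Tape U → ℝ≥0∞) (body : σ → Prog U (σ ⊕ α)) (s : σ) (t : Tape U) :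
    fold H (loop body s t) = ⨆ k, fold H (loopFuel body k s t) := by
  classical
  by_cases h : ∃ k, (loopFuel body k s t).isSome
  · have hl : loop body s t = loopFuel body (Nat.find h) s t := by
      unfold loop; rw [dif_pos h]
    obtain ⟨r, hr⟩ := Option.isSome_iff_exists.1 (Nat.find_spec h)
    rw [hl]
    refine le_antisymm (le_iSup (fun k => fold H (loopFuel body k s t)) _) (iSup_le fun k => ?_)
    rcases hk : loopFuel body k s t with _ | r'
    · simp
    · have h1 := loopFuel_mono body (le_max_left k (Nat.find h)) s t _ hk
      have h2 := loopFuel_mono body (le_max_right k (Nat.find h)) s t _ hr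
      rw [hr, ← Option.some.inj (h1.symm.trans h2)]
  · have hl : loop body s t = none := by unfold loop; rw [dif_neg h]
    have : ∀ k, loopFuel body k s t = none := by simpa using h
    simp [hl, this]

variable [Fintype U] [MeasurableSpace U] {w : U → ℝ≥0} {hw : 0 < ∑ a, w a}

lemma fresh_loopFuel {body : σ → Prog U (σ ⊕ α)} (hb : ∀ s, Fresh w hw (body s)) (k : ℕ) (s : σ) :
    Fresh w hw (loopFuel body k s) := by
  induction k generalizing s with
  | zero => exact ⟨fun H _ => measurable_const, fun H _ => by simp [loopFuel, expect]⟩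
  | succ k ih =>
    rw [loopFuel_succ]
    refine (hb s).bind fun x => ?_
    rcases x with s' | a
    · exact ih s'
    · exact fresh_pure a

lemma expect_loop {body : σ → Prog U (σ ⊕ α)} (hb : ∀ s, Fresh w hw (body s)) (s : σ)
    (G : α → ℕ → ℝ≥0∞) :
    expect w hw (loop body s) G = ⨆ k, expect w hw (loopFuel body k s) G := by
  unfold expect
  simp only [fold_loop]
  exact lintegral_iSup (fun k => (fresh_loopFuel hb k s).measurable_expect G)
    fun k l hkl ω => fold_loopFuel_mono _ body s _ hkl

lemma fresh_loop {body : σ → Prog U (σ ⊕ α)} (hb : ∀ s, Fresh w hw (body s)) (s : σ) :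
    Fresh w hw (loop body s) where
  measurable H hH := by
    simp only [fold_loop]
    exact Measurable.iSup fun k => (fresh_loopFuel hb k s).measurable H hH
  lintegral H hH := by
    simp only [fold_loop]
    rw [lintegral_iSup (fun k => (fresh_loopFuel hb k s).measurable H hH)
      fun k l hkl ω => fold_loopFuel_mono _ body s _ hkl, expect_loop hb]
    exact iSup_congr fun k => (fresh_loopFuel hb k s).lintegral H hH

lemma expect_loopFuel_succ {body : σ → Prog U (σ ⊕ α)} (hb : ∀ s, Fresh w hw (body s)) (k : ℕ)
    (s : σ) (G : α → ℕ → ℝ≥0∞) :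
    expect w hw (loopFuel body (k + 1) s) G = expect w hw (body s) fun x c =>
      Sum.elim (fun s' => expect w hw (loopFuel body k s') fun b d => G b (c + d))
        (fun a => G a c) x := by
  rw [loopFuel_succ, (hb s).expect_bind]
  · congr 1
    funext x c
    rcases x with s' | a
    · rfl
    · simp [afterRound, expect_pure]
  · rintro (s' | a)
    · exact fresh_loopFuel hb k s'
    · exact fresh_pure a

end Loop

/-! ### Mean value, mean cost and termination -/

section Mean

variable {U α β σ : Type} [Fintype U] [MeasurableSpace U] {w : U → ℝ≥0} {hw : 0 < ∑ a, w a}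

variable (w hw) in
/-- The expected value of a function of the output, where diverging runs contribute `0`. -/
def mean (m : Prog U α) (g : α → ℝ≥0∞) : ℝ≥0∞ := expect w hw m fun a _ => g a

variable (w hw) in
/-- The expected cost of the terminating runs. -/
def cost (m : Prog U α) : ℝ≥0∞ := expect w hw m fun _ c => (c : ℝ≥0∞)

variable (w hw) in
/-- The program is built from fresh randomness and terminates almost surely. -/
structure Proper (m : Prog U α) : Prop where
  fresh : Fresh w hw m
  mean_one : mean w hw m (fun _ => 1) = 1

lemma mean_mono {m : Prog U α} {g h : α → ℝ≥0∞} (hgh : ∀ a, g a ≤ h a) :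
    mean w hw m g ≤ mean w hw m h :=
  expect_mono fun a _ => hgh a

lemma Fresh.mean_add {m : Prog U α} (h : Fresh w hw m) (g k : α → ℝ≥0∞) :
    mean w hw m (fun a => g a + k a) = mean w hw m g + mean w hw m k :=
  h.expect_add _ _

lemma Fresh.mean_mul_const {m : Prog U α} (h : Fresh w hw m) (g : α → ℝ≥0∞) (r : ℝ≥0∞) :
    mean w hw m (fun a => g a * r) = mean w hw m g * r :=
  h.expect_mul_const _ _

lemma Fresh.mean_const_le {m : Prog U α} (h : Fresh w hw m) (r : ℝ≥0∞) :
    mean w hw m (fun _ => r) ≤ r :=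
  h.expect_const_le r

lemma Proper.mean_const {m : Prog U α} (h : Proper w hw m) (r : ℝ≥0∞) :
    mean w hw m (fun _ => r) = r := by
  have := h.fresh.mean_mul_const (fun _ => 1) r
  simpa [h.mean_one] using this

lemma mean_pure (a : α) (g : α → ℝ≥0∞) : mean w hw (pure a) g = g a := expect_pure _ _

lemma cost_pure (a : α) : cost w hw (pure a) = 0 := by simp [cost, expect_pure]

lemma proper_pure (a : α) : Proper w hw (pure a) := ⟨fresh_pure a, mean_pure a _⟩

lemma Fresh.mean_bind {m : Prog U α} {f : α → Prog U β} (hm : Fresh w hw m)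
    (hf : ∀ a, Fresh w hw (f a)) (g : β → ℝ≥0∞) :
    mean w hw (m >>= f) g = mean w hw m fun a => mean w hw (f a) g :=
  hm.expect_bind hf _

lemma Fresh.cost_bind_le {m : Prog U α} {f : α → Prog U β} (hm : Fresh w hw m)
    (hf : ∀ a, Fresh w hw (f a)) :
    cost w hw (m >>= f) ≤ cost w hw m + mean w hw m fun a => cost w hw (f a) := by
  unfold cost mean
  rw [hm.expect_bind hf, ← hm.expect_add]
  refine expect_mono fun a c => ?_
  simp only [Nat.cast_add]
  rw [(hf a).expect_add]
  gcongr
  -- Only an inequality: the cost `c` of the first program is counted only on runs whose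
  -- continuation halts.
  exact (hf a).expect_const_le _

lemma Proper.bind {m : Prog U α} {f : α → Prog U β} (hm : Proper w hw m)
    (hf : ∀ a, Proper w hw (f a)) : Proper w hw (m >>= f) := by
  refine ⟨hm.fresh.bind fun a => (hf a).fresh, ?_⟩
  rw [hm.fresh.mean_bind fun a => (hf a).fresh]
  simp only [(hf _).mean_one, hm.mean_one]

/-- A potential that does not increase in expectation in a round bounds the mean of the output. -/
lemma mean_loop_le {body : σ → Prog U (σ ⊕ α)} (hb : ∀ s, Fresh w hw (body s)) {g : α → ℝ≥0∞}
    {Φ : σ → ℝ≥0∞} (hΦ : ∀ s, mean w hw (body s) (Sum.elim Φ g) ≤ Φ s) (s : σ) :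
    mean w hw (loop body s) g ≤ Φ s := by
  unfold mean
  rw [expect_loop hb]
  refine iSup_le fun k => ?_
  induction k generalizing s with
  | zero => simp [loopFuel, expect]
  | succ k ih =>
    rw [expect_loopFuel_succ hb]
    refine le_trans (expect_mono ?_) (hΦ s)
    rintro (s' | a) c
    · exact ih s'
    · exact le_rfl

/-- A potential that decreases in expectation by the cost of a round bounds the cost. -/
lemma cost_loop_le {body : σ → Prog U (σ ⊕ α)} (hb : ∀ s, Fresh w hw (body s))
    {Φ : σ → ℝ≥0∞}
    (hΦ : ∀ s, cost w hw (body s) + mean w hw (body s) (Sum.elim Φ fun _ => 0) ≤ Φ s) (s : σ) :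
    cost w hw (loop body s) ≤ Φ s := by
  unfold cost
  rw [expect_loop hb]
  refine iSup_le fun k => ?_
  induction k generalizing s with
  | zero => simp [loopFuel, expect]
  | succ k ih =>
    rw [expect_loopFuel_succ hb]
    refine le_trans ?_ (hΦ s)
    unfold cost mean
    rw [← (hb s).expect_add]
    refine expect_mono ?_
    rintro (s' | a) c
    · simp only [Sum.elim_inl, Nat.cast_add]
      rw [(fresh_loopFuel hb k s').expect_add]
      exact add_le_add ((fresh_loopFuel hb k s').expect_const_le _) (ih s')
    · simp

/-- A finite potential that decreases in expectation by one in every round forces termination. -/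
lemma proper_loop {body : σ → Prog U (σ ⊕ α)} (hb : ∀ s, Proper w hw (body s))
    {Φ : σ → ℝ≥0∞} (hΦ : ∀ s, 1 + mean w hw (body s) (Sum.elim Φ fun _ => 0) ≤ Φ s) (s : σ)
    (hs : Φ s ≠ ⊤) : Proper w hw (loop body s) := by
  have hf := fun s => (hb s).fresh
  refine ⟨fresh_loop hf s, ?_⟩
  -- The probability of halting within `k` rounds. The sum of `1 - h k s` over `k` is the expected
  -- number of rounds, which the potential bounds.
  let h : ℕ → σ → ℝ≥0∞ := fun k s => mean w hw (loopFuel body k s) fun _ => 1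
  have h1 : ∀ k s, h k s ≤ 1 := fun k s => expect_one_le _
  have hsucc : ∀ k s, h (k + 1) s = mean w hw (body s) (Sum.elim (h k) fun _ => 1) := by
    intro k s
    change expect _ _ _ _ = _
    rw [expect_loopFuel_succ hf]
    rfl
  have hdef : ∀ k s, 1 - h (k + 1) s =
      mean w hw (body s) (Sum.elim (fun s' => 1 - h k s') fun _ => 0) := by
    intro k s
    rw [hsucc]
    refine (ENNReal.eq_sub_of_add_eq ?_ ?_).symm
    · rw [← hsucc]; exact ne_top_of_le_ne_top ENNReal.one_ne_top (h1 _ _)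
    · rw [← (hf s).mean_add]
      refine Eq.trans ?_ (hb s).mean_one
      congr 1
      funext x
      rcases x with s' | a
      · exact tsub_add_cancel_of_le (h1 _ _)
      · simp
  have hsum : ∀ k s, ∑ j ∈ Finset.range k, (1 - h j s) ≤ Φ s := by
    intro k
    induction k with
    | zero => intro s; simp
    | succ k ih =>
      intro s
      refine le_trans ?_ (hΦ s)
      rw [Finset.sum_range_succ', add_comm]
      refine add_le_add tsub_le_self ?_
      simp only [hdef]
      have : ∀ k, ∑ j ∈ Finset.range k,
          mean w hw (body s) (Sum.elim (fun s' => 1 - h j s') fun _ => 0) =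
          mean w hw (body s)
            (Sum.elim (fun s' => ∑ j ∈ Finset.range k, (1 - h j s')) fun _ => 0) := by
        intro k
        induction k with
        | zero =>
          simp only [Finset.range_zero, Finset.sum_empty]
          refine le_antisymm zero_le ((mean_mono ?_).trans ((hf s).mean_const_le 0))
          rintro (_ | _) <;> simp
        | succ k ih =>
          rw [Finset.sum_range_succ, ih, ← (hf s).mean_add]
          congr 1
          funext x
          rcases x with s' | a
          · simp [Finset.sum_range_succ]
          · simp
      rw [this]
      refine mean_mono ?_
      rintro (s' | a)
      · exact ih s'
      · exact le_rfl
  have hle : ∀ k, h k s ≤ mean w hw (loop body s) fun _ => 1 := by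
    intro k
    unfold mean
    rw [expect_loop hf]
    exact le_iSup (fun k => expect w hw (loopFuel body k s) fun _ _ => 1) k
  -- Every survival probability is at least the probability of divergence, so a positive probability
  -- of divergence would make the bounded sums unbounded.
  have hk : ∀ k : ℕ, (k : ℝ≥0∞) * (1 - mean w hw (loop body s) fun _ => 1) ≤ Φ s := by
    intro k
    refine le_trans ?_ (hsum k s)
    calc (k : ℝ≥0∞) * (1 - mean w hw (loop body s) fun _ => 1)
        = ∑ j ∈ Finset.range k, (1 - mean w hw (loop body s) fun _ => 1) := by simp
      _ ≤ _ := Finset.sum_le_sum fun j _ => tsub_le_tsub_left (hle j) 1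
  refine le_antisymm (expect_one_le _) ?_
  rw [← tsub_eq_zero_iff_le]
  by_contra hne
  obtain ⟨n, hn⟩ := ENNReal.exists_nat_mul_gt hne hs
  exact absurd (hk n) (not_le.2 hn)

/-! ### Repetition and amplification -/

omit [Fintype U] [MeasurableSpace U] in
lemma replicate_succ (k : ℕ) (m : Prog U α) :
    replicate (k + 1) m = m >>= fun a => replicate k m >>= fun l => pure (a :: l) := rfl

lemma proper_replicate {m : Prog U α} (hm : Proper w hw m) (k : ℕ) :
    Proper w hw (replicate k m) := by
  induction k with
  | zero => exact proper_pure _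
  | succ k ih => exact hm.bind fun a => ih.bind fun l => proper_pure _

lemma mean_replicate_succ {m : Prog U α} (hm : Proper w hw m) (k : ℕ) (g : List α → ℝ≥0∞) :
    mean w hw (replicate (k + 1) m) g =
      mean w hw m fun a => mean w hw (replicate k m) fun l => g (a :: l) := by
  have h1 := fun a => ((proper_replicate hm k).bind fun l => proper_pure (a :: l)).fresh
  rw [replicate_succ, hm.fresh.mean_bind h1]
  congr 1
  funext a
  rw [(proper_replicate hm k).fresh.mean_bind fun l => fresh_pure _]
  simp only [mean_pure]

lemma cost_replicate_le {m : Prog U α} (hm : Proper w hw m) (k : ℕ) :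
    cost w hw (replicate k m) ≤ k * cost w hw m := by
  induction k with
  | zero => simp [replicate, cost_pure]
  | succ k ih =>
    have h1 := fun a => ((proper_replicate hm k).bind fun l => proper_pure (a :: l)).fresh
    rw [replicate_succ]
    refine (hm.fresh.cost_bind_le h1).trans ?_
    have h2 : ∀ a : α, cost w hw (replicate k m >>= fun l => pure (a :: l)) ≤
        k * cost w hw m := by
      intro a
      refine ((proper_replicate hm k).fresh.cost_bind_le fun l => fresh_pure _).trans ?_
      simp only [cost_pure, (proper_replicate hm k).mean_const, add_zero]
      exact ih
    push_cast
    rw [add_mul, one_mul, add_comm]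
    gcongr
    exact (mean_mono h2).trans (hm.fresh.mean_const_le _)

lemma mean_replicate_sum_le {m : Prog U α} (hm : Proper w hw m) (k : ℕ) (g : α → ℝ≥0∞) :
    mean w hw (replicate k m) (fun l => (l.map g).sum) ≤ k * mean w hw m g := by
  induction k with
  | zero => simp [replicate, mean_pure]
  | succ k ih =>
    rw [mean_replicate_succ hm]
    simp only [List.map_cons, List.sum_cons]
    simp only [(proper_replicate hm k).fresh.mean_add, (proper_replicate hm k).mean_const]
    rw [hm.fresh.mean_add, hm.mean_const]
    push_cast
    rw [add_mul, one_mul, add_comm]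
    gcongr

end Mean

/-! ### Medians -/

section Median

variable {α : Type} [LinearOrder α] [Inhabited α]

lemma median_eq_getElem {l : List α} (hl : l ≠ []) :
    ∃ h : l.length / 2 < (l.insertionSort (· ≤ ·)).length,
      median l = (l.insertionSort (· ≤ ·))[l.length / 2] := by
  have h0 := List.length_pos_iff.2 hl
  have h : l.length / 2 < (l.insertionSort (· ≤ ·)).length := by
    rw [List.length_insertionSort]; omega
  exact ⟨h, by unfold median; rw [List.getD_eq_getElem _ _ h]⟩

lemma median_mem {l : List α} (hl : l ≠ []) : median l ∈ l := by
  obtain ⟨h, e⟩ := median_eq_getElem hl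
  rw [e]
  exact (List.mem_insertionSort (· ≤ ·)).1 (List.getElem_mem h)

/-- If the median of an odd number of values avoids an interval, so do more than half of them. -/
lemma half_lt_countP_of_median {p : α → Prop} [DecidablePred p]
    (hp : ∀ x y z, x ≤ y → y ≤ z → ¬ p x → ¬ p z → ¬ p y) {l : List α} {n : ℕ}
    (hl : l.length = 2 * n + 1) (h : p (median l)) : n + 1 ≤ l.countP fun x => p x := by
  have hne : l ≠ [] := by rintro rfl; simp at hl
  obtain ⟨hlt, e⟩ := median_eq_getElem hne
  set s := l.insertionSort (· ≤ ·) with hs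
  have hsl : s.length = 2 * n + 1 := by rw [hs, List.length_insertionSort, hl]
  have hmid : l.length / 2 = n := by omega
  simp only [hmid] at hlt e
  have hsorted : s.Pairwise (· ≤ ·) := List.pairwise_insertionSort _ _
  have hmono : ∀ (i j : ℕ) (hij : i ≤ j) (hj : j < s.length), s[i] ≤ s[j] := by
    intro i j hij hj
    rcases hij.eq_or_lt with rfl | hij
    · exact le_rfl
    · exact List.pairwise_iff_getElem.1 hsorted i j _ hj hij
  rw [← (List.perm_insertionSort (· ≤ ·) l).countP_eq, ← hs]
  rw [e] at h
  -- Either all sorted entries up to the middle satisfy `p`, or some entry there avoids it. In the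
  -- second case no entry from the middle on can avoid `p`, since the middle entry would lie between
  -- two values avoiding it. Both halves have `n + 1` entries.
  by_cases hlow : ∀ (i : ℕ) (hi : i ≤ n), p s[i]
  · have h1 : (s.take (n + 1)).countP (fun x => p x) = (s.take (n + 1)).length := by
      rw [List.countP_eq_length]
      intro a ha
      obtain ⟨i, hi, rfl⟩ := List.mem_iff_getElem.1 ha
      rw [List.length_take] at hi
      simpa using hlow i (by omega)
    calc n + 1 = (s.take (n + 1)).length := by rw [List.length_take]; omega
      _ = (s.take (n + 1)).countP (fun x => p x) := h1.symm
      _ ≤ _ := (List.take_sublist _ _).countP_le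
  · push Not at hlow
    obtain ⟨i, hi, hpi⟩ := hlow
    have h1 : (s.drop n).countP (fun x => p x) = (s.drop n).length := by
      rw [List.countP_eq_length]
      intro a ha
      obtain ⟨j, hj, rfl⟩ := List.mem_iff_getElem.1 ha
      rw [List.length_drop] at hj
      simp only [List.getElem_drop, decide_eq_true_eq]
      by_contra hpj
      exact hp _ _ _ (hmono i n hi hlt) (hmono n (n + j) (by omega) (by omega)) hpi hpj h
    calc n + 1 = (s.drop n).length := by rw [List.length_drop]; omega
      _ = (s.drop n).countP (fun x => p x) := h1.symm
      _ ≤ _ := (List.drop_sublist _ _).countP_le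

end Median

/-- `3 ^ n` times the probability of at least `k` successes in `n` trials with success probability
`1 / 3`. -/
def binomialTail : ℕ → ℕ → ℕ
  | n, 0 => 3 ^ n
  | 0, _ + 1 => 0
  | n + 1, k + 1 => binomialTail n k + 2 * binomialTail n (k + 1)

lemma binomialTail_zero (n : ℕ) : binomialTail n 0 = 3 ^ n := by
  cases n <;> rfl

lemma binomialTail_succ_le (n k : ℕ) : binomialTail n (k + 1) ≤ binomialTail n k := by
  induction n generalizing k with
  | zero => simp [binomialTail]
  | succ n ih =>
    cases k with
    | zero =>
      have := ih 0
      rw [binomialTail_zero] at this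
      rw [binomialTail_zero, pow_succ]
      simp only [binomialTail, binomialTail_zero]
      omega
    | succ k =>
      have h1 := ih k
      have h2 := ih (k + 1)
      simp only [binomialTail]
      omega

/-! ### The median trick -/

section Amplify

variable {U α : Type} [Fintype U] [MeasurableSpace U] {w : U → ℝ≥0} {hw : 0 < ∑ a, w a}

/-- Conditioning on the first run gives the recursion of `binomialTail`; the scaling by `3 ^ n`
keeps it in the natural numbers. -/
lemma mean_replicate_countP_le {m : Prog U α} (hm : Proper w hw m) {p : α → Prop}
    [DecidablePred p] (h : mean w hw m (fun a => if p a then 1 else 0) ≤ 1 / 3) (n k : ℕ) :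
    mean w hw (replicate n m) (fun l => if k ≤ l.countP (fun x => p x) then 1 else 0) * 3 ^ n ≤
      binomialTail n k := by
  induction n generalizing k with
  | zero => cases k <;> simp [replicate, mean_pure, binomialTail]
  | succ n ih =>
    cases k with
    | zero =>
      simp only [zero_le, if_true, binomialTail_zero]
      rw [(proper_replicate hm _).mean_one]
      simp
    | succ k =>
      -- The conditional bound is `D` times the indicator of a success plus a constant. Since `D` is
      -- a genuine nonnegative difference, a success probability of at most 1/3 is enough.
      set D := binomialTail n k - binomialTail n (k + 1) with hD
      have hDk : D + binomialTail n (k + 1) = binomialTail n k :=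
        Nat.sub_add_cancel (binomialTail_succ_le n k)
      rw [mean_replicate_succ hm, pow_succ, ← mul_assoc, ← hm.fresh.mean_mul_const]
      have h1 : ∀ a, mean w hw (replicate n m) (fun l =>
          if k + 1 ≤ (a :: l).countP (fun x => p x) then 1 else 0) * 3 ^ n ≤
          (if p a then 1 else 0) * (D : ℝ≥0∞) + (binomialTail n (k + 1) : ℝ≥0∞) := by
        intro a
        by_cases ha : p a
        · simp only [List.countP_cons, ha, decide_true, if_true, add_le_add_iff_right, one_mul]
          refine (ih k).trans ?_
          rw [← hDk]; push_cast; rfl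
        · simp only [List.countP_cons, ha, decide_false, Bool.false_eq_true, if_false, add_zero,
            zero_mul, zero_add]
          exact ih (k + 1)
      have hthird : (1 / 3 : ℝ≥0∞) * 3 = 1 :=
        ENNReal.div_mul_cancel (by norm_num) (by norm_num)
      calc _ ≤ ((1 / 3 : ℝ≥0∞) * D + binomialTail n (k + 1)) * 3 := by
            gcongr
            refine (mean_mono h1).trans ?_
            rw [hm.fresh.mean_add, hm.mean_const, hm.fresh.mean_mul_const]
            gcongr
        _ = (1 / 3 : ℝ≥0∞) * 3 * D + 3 * binomialTail n (k + 1) := by ring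
        _ = _ := by
            rw [hthird, one_mul]
            simp only [binomialTail]
            rw [← hDk]
            push_cast
            ring

variable [LinearOrder α] [Inhabited α]

lemma proper_amplify {m : Prog U α} (hm : Proper w hw m) : Proper w hw (amplify m) :=
  (proper_replicate hm 15).bind fun _ => proper_pure _

lemma mean_amplify {m : Prog U α} (hm : Proper w hw m) (g : α → ℝ≥0∞) :
    mean w hw (amplify m) g = mean w hw (replicate 15 m) fun l => g (median l) := by
  unfold amplify
  rw [(proper_replicate hm 15).fresh.mean_bind fun l => fresh_pure _]
  simp only [mean_pure]

lemma cost_amplify_le {m : Prog U α} (hm : Proper w hw m) :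
    cost w hw (amplify m) ≤ 15 * cost w hw m := by
  refine ((proper_replicate hm 15).fresh.cost_bind_le fun l => fresh_pure _).trans ?_
  simp only [cost_pure, (proper_replicate hm 15).mean_const, add_zero]
  exact cost_replicate_le hm 15

omit [LinearOrder α] [Inhabited α] in
/-- Statements about the result of `replicate` may assume the right length of the list. -/
lemma mean_replicate_congr {m : Prog U α} (hm : Proper w hw m) (k : ℕ) {g h : List α → ℝ≥0∞}
    (hgh : ∀ l, l.length = k → g l ≤ h l) :
    mean w hw (replicate k m) g ≤ mean w hw (replicate k m) h := by
  induction k generalizing g h with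
  | zero => simpa [replicate, mean_pure] using hgh [] rfl
  | succ k ih =>
    rw [mean_replicate_succ hm, mean_replicate_succ hm]
    refine mean_mono fun a => ih fun l hl => hgh _ (by simp [hl])

/-- The median of fifteen runs lands in an interval with probability at least `9 / 10` if a single
run does so with probability at least `2 / 3`. -/
lemma mean_amplify_le {m : Prog U α} (hm : Proper w hw m) {p : α → Prop} [DecidablePred p]
    (hp : ∀ x y z, x ≤ y → y ≤ z → ¬ p x → ¬ p z → ¬ p y)
    (h : mean w hw m (fun a => if p a then 1 else 0) ≤ 1 / 3) :
    mean w hw (amplify m) (fun a => if p a then 1 else 0) ≤ 1 / 10 := by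
  rw [mean_amplify hm]
  have h1 : mean w hw (replicate 15 m) (fun l => if p (median l) then 1 else 0) ≤
      mean w hw (replicate 15 m) (fun l => if 8 ≤ l.countP (fun x => p x) then 1 else 0) := by
    refine mean_replicate_congr hm 15 fun l hl => ?_
    by_cases hpl : p (median l)
    · rw [if_pos hpl, if_pos (half_lt_countP_of_median hp (n := 7) hl hpl)]
    · simp [hpl]
  refine h1.trans ?_
  have h2 := mean_replicate_countP_le hm h 15 8
  have h3 : binomialTail 15 8 * 10 ≤ 3 ^ 15 := by decide +kernel
  have h4 : (binomialTail 15 8 : ℝ≥0∞) * 10 ≤ 3 ^ 15 := by exact_mod_cast h3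
  rw [ENNReal.le_div_iff_mul_le (by norm_num) (by norm_num)]
  have h5 : mean w hw (replicate 15 m) (fun l => if 8 ≤ l.countP (fun x => p x) then 1 else 0)
      * 10 * 3 ^ 15 ≤ 1 * 3 ^ 15 := by
    rw [one_mul, mul_right_comm]
    exact (mul_le_mul_left h2 10).trans h4
  exact (ENNReal.mul_le_mul_iff_left (by positivity) (by norm_num)).1 h5

/-- The median is one of the fifteen values, so its `g` is at most the sum of theirs. Thus moments
survive the median at the price of a factor 15. -/
lemma mean_amplify_le_sum {m : Prog U α} (hm : Proper w hw m) (g : α → ℝ≥0∞) :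
    mean w hw (amplify m) g ≤ 15 * mean w hw m g := by
  rw [mean_amplify hm]
  refine le_trans ?_ (mean_replicate_sum_le hm 15 g)
  refine mean_replicate_congr hm 15 fun l hl => ?_
  exact List.le_sum_of_mem (List.mem_map_of_mem (median_mem (by rintro rfl; simp at hl)))

end Amplify

/-! ### Sampling from a bucket -/

section Bucket

variable {U : Type} [Fintype U]

/-- The items with weight in `[2 ^ b, 2 ^ (b + 1))`. -/
def bucket (w : U → ℝ≥0) (b : ℤ) : Finset U :=
  Finset.univ.filter fun a => (w a : ℝ) ∈ Set.Ico ((2 : ℝ) ^ b) ((2 : ℝ) ^ (b + 1))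

/-- The total weight of a bucket. -/
def bucketWeight (w : U → ℝ≥0) (b : ℤ) : ℝ≥0 := ∑ a ∈ bucket w b, w a

/-- The probability that a proportional sample falls in a bucket. -/
def bucketProb (w : U → ℝ≥0) (b : ℤ) : ℝ≥0 := bucketWeight w b / ∑ a, w a

lemma mem_bucket {w : U → ℝ≥0} {b : ℤ} {a : U} :
    a ∈ bucket w b ↔ (w a : ℝ) ∈ Set.Ico ((2 : ℝ) ^ b) ((2 : ℝ) ^ (b + 1)) := by
  simp [bucket]

lemma weight_pos_of_mem {w : U → ℝ≥0} {b : ℤ} {a : U} (h : a ∈ bucket w b) : 0 < w a := by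
  have h1 : (0 : ℝ) < 2 ^ b := by positivity
  exact_mod_cast h1.trans_le (mem_bucket.1 h).1

lemma bucketWeight_pos {w : U → ℝ≥0} {b : ℤ} (h : (bucket w b).Nonempty) :
    0 < bucketWeight w b :=
  Finset.sum_pos (fun _ ha => weight_pos_of_mem ha) h

lemma bucketProb_pos {w : U → ℝ≥0} {b : ℤ} (h : (bucket w b).Nonempty) :
    0 < bucketProb w b := by
  refine div_pos (bucketWeight_pos h) ((bucketWeight_pos h).trans_le ?_)
  exact Finset.sum_le_univ_sum_of_nonneg fun _ => zero_le

lemma bucketProb_le_one (w : U → ℝ≥0) (b : ℤ) : bucketProb w b ≤ 1 := by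
  refine div_le_one_of_le₀ ?_ zero_le
  exact Finset.sum_le_univ_sum_of_nonneg fun _ => zero_le

open Classical in
/-- The probability that a proportional sample misses a bucket. -/
def missProb (w : U → ℝ≥0) (b : ℤ) : ℝ≥0 := ∑ a ∈ (bucket w b)ᶜ, w a / ∑ x, w x

lemma bucketProb_eq_sum (w : U → ℝ≥0) (b : ℤ) :
    bucketProb w b = ∑ a ∈ bucket w b, w a / ∑ x, w x := by
  rw [bucketProb, bucketWeight, Finset.sum_div]

lemma bucketProb_add_missProb {w : U → ℝ≥0} (hw : 0 < ∑ a, w a) (b : ℤ) :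
    bucketProb w b + missProb w b = 1 := by
  classical
  rw [bucketProb_eq_sum, missProb, ← Finset.sum_div, ← Finset.sum_div, ← add_div]
  convert div_self hw.ne'
  convert Finset.sum_add_sum_compl (bucket w b) w

variable [MeasurableSpace U] [MeasurableSingletonClass U] {w : U → ℝ≥0} {hw : 0 < ∑ a, w a}

lemma mean_draw (g : U × ℝ → ℝ≥0∞) :
    mean w hw draw g = ∑ a, ((w a / ∑ x, w x : ℝ≥0) : ℝ≥0∞) * g (a, (w a : ℝ)) :=
  expect_draw _

lemma proper_draw : Proper w hw (draw : Prog U (U × ℝ)) := by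
  refine ⟨fresh_draw, ?_⟩
  rw [mean_draw]
  simp only [mul_one]
  rw [← ENNReal.ofNNReal_finsetSum, ← Finset.sum_div, div_self hw.ne', ENNReal.coe_one]

lemma cost_draw : cost w hw (draw : Prog U (U × ℝ)) = 1 := by
  have := (proper_draw (w := w) (hw := hw)).mean_one
  rw [mean_draw] at this
  unfold cost
  rw [expect_draw]
  simpa using this

/-- One proportional sample, classified by whether it lies in the bucket. -/
lemma mean_draw_ite {b : ℤ} (g h : U × ℝ → ℝ≥0∞) (r : ℝ≥0∞)
    (hin : ∀ a ∈ bucket w b, g (a, (w a : ℝ)) = h (a, (w a : ℝ)))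
    (hout : ∀ a, a ∉ bucket w b → g (a, (w a : ℝ)) = r) :
    mean w hw draw g =
      (∑ a ∈ bucket w b, ((w a / ∑ x, w x : ℝ≥0) : ℝ≥0∞) * h (a, (w a : ℝ))) +
        missProb w b * r := by
  classical
  rw [mean_draw, ← Finset.sum_add_sum_compl (bucket w b), missProb]
  congr 1
  · exact Finset.sum_congr rfl fun a ha => by rw [hin a ha]
  · rw [ENNReal.ofNNReal_finsetSum, Finset.sum_mul]
    exact Finset.sum_congr rfl fun a ha => by rw [hout a (Finset.mem_compl.1 ha)]

/-- A round of `propBucketSampler`. -/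
def propRound (b : ℤ) : Prog U (Unit ⊕ U × ℝ) := do
  let x ← draw
  if x.2 ∈ Set.Ico ((2 : ℝ) ^ b) ((2 : ℝ) ^ (b + 1)) then pure (.inr x) else pure (.inl ())

omit [Fintype U] [MeasurableSpace U] [MeasurableSingletonClass U] in
lemma propRound_eq (b : ℤ) : (propRound b : Prog U _) = draw >>= fun x =>
    pure (if x.2 ∈ Set.Ico ((2 : ℝ) ^ b) ((2 : ℝ) ^ (b + 1)) then .inr x else .inl ()) := by
  unfold propRound
  congr 1
  funext x
  split_ifs <;> rfl

lemma proper_propRound (b : ℤ) : Proper w hw (propRound b : Prog U _) := by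
  rw [propRound_eq]; exact proper_draw.bind fun _ => proper_pure _

lemma cost_propRound_le (b : ℤ) : cost w hw (propRound b : Prog U _) ≤ 1 := by
  rw [propRound_eq]
  refine (fresh_draw.cost_bind_le fun _ => fresh_pure _).trans ?_
  simp only [cost_pure, cost_draw, proper_draw.mean_const, add_zero, le_refl]

lemma mean_propRound (b : ℤ) (g : Unit ⊕ U × ℝ → ℝ≥0∞) :
    mean w hw (propRound b) g =
      (∑ a ∈ bucket w b, ((w a / ∑ x, w x : ℝ≥0) : ℝ≥0∞) * g (.inr (a, (w a : ℝ)))) +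
        missProb w b * g (.inl ()) := by
  rw [propRound_eq, fresh_draw.mean_bind fun _ => fresh_pure _]
  simp only [mean_pure]
  refine mean_draw_ite _ (fun x => g (.inr x)) _ (fun a ha => ?_) fun a ha => ?_
  · rw [if_pos (mem_bucket.1 ha)]
  · rw [if_neg (mt mem_bucket.2 ha)]

/-- The conditional mean over the bucket, taken as a constant potential, is a fixed point of a
round: a hit contributes it with weight `bucketProb`, a miss returns it with weight `missProb`. -/
lemma mean_propBucketSampler_le {b : ℤ} (hb : (bucket w b).Nonempty) (g : U × ℝ → ℝ≥0∞) :
    mean w hw (propBucketSampler b) g ≤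
      ∑ a ∈ bucket w b, ((w a / bucketWeight w b : ℝ≥0) : ℝ≥0∞) * g (a, (w a : ℝ)) := by
  refine mean_loop_le (body := fun _ => propRound b) (fun _ => (proper_propRound b).fresh)
    (Φ := fun _ => ∑ a ∈ bucket w b, ((w a / bucketWeight w b : ℝ≥0) : ℝ≥0∞) * g (a, (w a : ℝ)))
    (fun _ => ?_) ()
  rw [mean_propRound]
  simp only [Sum.elim_inl, Sum.elim_inr]
  have h1 : ∑ a ∈ bucket w b, ((w a / ∑ x, w x : ℝ≥0) : ℝ≥0∞) * g (a, (w a : ℝ)) =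
      (bucketProb w b : ℝ≥0∞) *
        ∑ a ∈ bucket w b, ((w a / bucketWeight w b : ℝ≥0) : ℝ≥0∞) * g (a, (w a : ℝ)) := by
    rw [Finset.mul_sum]
    refine Finset.sum_congr rfl fun a _ => ?_
    rw [← mul_assoc, ← ENNReal.coe_mul, bucketProb]
    congr 2
    have := (bucketWeight_pos hb).ne'
    have := hw.ne'
    field_simp
  rw [h1, ← add_mul, ← ENNReal.coe_add, bucketProb_add_missProb hw, ENNReal.coe_one, one_mul]

-- The equation `1 + (1 - p) / p = 1 / p` of a geometric waiting time, used both for cost and for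
-- termination.
omit [MeasurableSpace U] [MeasurableSingletonClass U] in
lemma missProb_mul_le (hw : 0 < ∑ a, w a) {b : ℤ} (hb : (bucket w b).Nonempty) :
    (1 : ℝ≥0∞) + missProb w b * (((bucketProb w b)⁻¹ : ℝ≥0) : ℝ≥0∞) ≤
      (((bucketProb w b)⁻¹ : ℝ≥0) : ℝ≥0∞) := by
  have h := bucketProb_add_missProb hw b
  have hp := (bucketProb_pos hb).ne'
  have : (1 : ℝ≥0) + missProb w b * (bucketProb w b)⁻¹ = (bucketProb w b)⁻¹ := by
    conv_lhs => rw [← mul_inv_cancel₀ hp]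
    rw [← add_mul, h, one_mul]
  rw [← ENNReal.coe_mul, ← ENNReal.coe_one, ← ENNReal.coe_add, this]

lemma cost_propBucketSampler_le {b : ℤ} (hb : (bucket w b).Nonempty) :
    cost w hw (propBucketSampler b) ≤ (((bucketProb w b)⁻¹ : ℝ≥0) : ℝ≥0∞) := by
  refine cost_loop_le (body := fun _ => propRound b) (fun _ => (proper_propRound b).fresh)
    (Φ := fun _ => (((bucketProb w b)⁻¹ : ℝ≥0) : ℝ≥0∞)) (fun _ => ?_) ()
  rw [mean_propRound]
  simp only [Sum.elim_inl, Sum.elim_inr, mul_zero, Finset.sum_const_zero, zero_add]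
  exact (add_le_add_left (cost_propRound_le b) _).trans (missProb_mul_le hw hb)

lemma proper_propBucketSampler {b : ℤ} (hb : (bucket w b).Nonempty) :
    Proper w hw (propBucketSampler b) := by
  refine proper_loop (body := fun _ => propRound b) (fun _ => proper_propRound b)
    (Φ := fun _ => (((bucketProb w b)⁻¹ : ℝ≥0) : ℝ≥0∞)) (fun _ => ?_) () ENNReal.coe_ne_top
  rw [mean_propRound]
  simp only [Sum.elim_inl, Sum.elim_inr, mul_zero, Finset.sum_const_zero, zero_add]
  exact missProb_mul_le hw hb

/-! ### Rejection sampling -/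

/-- A round of `unifBucketSampler`. -/
def unifRound (b : ℤ) : Prog U (Unit ⊕ U × ℝ) :=
  propBucketSampler b >>= fun x => coinBranch ((2 : ℝ) ^ b / x.2) (.inl ()) (.inr x)

omit [MeasurableSingletonClass U] in
lemma proper_coinBranch {α : Type} (q : ℝ) (x y : α) : Proper w hw (coinBranch q x y) := by
  refine ⟨fresh_coinBranch q x y, ?_⟩
  unfold mean
  rw [expect_coinBranch, mul_one, mul_one]
  exact (measure_add_measure_compl (measurableSet_unitInterval_gt q)).trans measure_univ

omit [MeasurableSingletonClass U] in
lemma mean_coinBranch {α : Type} {q : ℝ} (h0 : 0 ≤ q) (h1 : q ≤ 1) (x y : α) (g : α → ℝ≥0∞) :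
    mean w hw (coinBranch q x y) g =
      ENNReal.ofReal (1 - q) * g x + ENNReal.ofReal q * g y := by
  unfold mean
  rw [expect_coinBranch, volume_unitInterval_gt h0 h1, volume_unitInterval_le h0 h1]

omit [MeasurableSingletonClass U] in
lemma cost_coinBranch {α : Type} (q : ℝ) (x y : α) : cost w hw (coinBranch q x y) = 0 := by
  unfold cost
  rw [expect_coinBranch]
  simp

lemma proper_unifRound {b : ℤ} (hb : (bucket w b).Nonempty) :
    Proper w hw (unifRound b : Prog U _) :=
  (proper_propBucketSampler hb).bind fun _ => proper_coinBranch _ _ _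

lemma cost_unifRound_le {b : ℤ} (hb : (bucket w b).Nonempty) :
    cost w hw (unifRound b : Prog U _) ≤ (((bucketProb w b)⁻¹ : ℝ≥0) : ℝ≥0∞) := by
  have h := proper_propBucketSampler (hw := hw) hb
  refine (h.fresh.cost_bind_le fun _ => fresh_coinBranch _ _ _).trans ?_
  simp only [cost_coinBranch, h.mean_const, add_zero]
  exact cost_propBucketSampler_le hb

-- Weights in a bucket differ by less than a factor of two, so a proposal is accepted with
-- probability at least 1/2.
omit [MeasurableSpace U] [MeasurableSingletonClass U] in
lemma threshold_mem {b : ℤ} {a : U} (ha : a ∈ bucket w b) :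
    1 / 2 ≤ (2 : ℝ) ^ b / (w a : ℝ) ∧ (2 : ℝ) ^ b / (w a : ℝ) ≤ 1 := by
  have h := mem_bucket.1 ha
  have hp : (0 : ℝ) < w a := by exact_mod_cast weight_pos_of_mem ha
  have h2 : (w a : ℝ) < 2 ^ b * 2 := by
    have := h.2
    rwa [zpow_add₀ two_ne_zero, zpow_one] at this
  constructor
  · rw [div_le_div_iff₀ two_pos hp]; linarith
  · rw [div_le_one hp]; exact h.1

lemma mean_unifRound_le {b : ℤ} (hb : (bucket w b).Nonempty) (g : Unit ⊕ U × ℝ → ℝ≥0∞) :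
    mean w hw (unifRound b) g ≤
      ∑ a ∈ bucket w b, ((w a / bucketWeight w b : ℝ≥0) : ℝ≥0∞) *
        (ENNReal.ofReal (1 - (2 : ℝ) ^ b / (w a : ℝ)) * g (.inl ()) +
          ENNReal.ofReal ((2 : ℝ) ^ b / (w a : ℝ)) * g (.inr (a, (w a : ℝ)))) := by
  have h := proper_propBucketSampler (hw := hw) hb
  unfold unifRound
  rw [h.fresh.mean_bind fun _ => fresh_coinBranch _ _ _]
  refine (mean_propBucketSampler_le hb _).trans (le_of_eq ?_)
  refine Finset.sum_congr rfl fun a ha => ?_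
  have := threshold_mem ha
  rw [mean_coinBranch (by linarith) this.2]

omit [MeasurableSpace U] [MeasurableSingletonClass U] in
lemma sum_div_bucketWeight {b : ℤ} (hb : (bucket w b).Nonempty) :
    ∑ a ∈ bucket w b, ((w a / bucketWeight w b : ℝ≥0) : ℝ≥0∞) = 1 := by
  rw [← ENNReal.ofNNReal_finsetSum, ← Finset.sum_div]
  exact_mod_cast div_self (bucketWeight_pos hb).ne'

lemma mean_unifRound_inl_le {b : ℤ} (hb : (bucket w b).Nonempty) (r : ℝ≥0∞) :
    mean w hw (unifRound b) (Sum.elim (fun _ => r) fun _ => 0) ≤ 1 / 2 * r := by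
  refine (mean_unifRound_le hb _).trans ?_
  simp only [Sum.elim_inl, Sum.elim_inr, mul_zero, add_zero]
  refine le_trans ?_ (one_mul (1 / 2 * r)).le
  rw [← sum_div_bucketWeight hb, Finset.sum_mul]
  refine Finset.sum_le_sum fun a ha => ?_
  refine mul_le_mul_right (mul_le_mul_left ?_ r) _
  -- Expanding `1` into a sum above also hit the numerator of `1 / 2`; this restores it.
  rw [sum_div_bucketWeight hb]
  refine (ENNReal.ofReal_le_ofReal (by linarith [(threshold_mem ha).1] :
    1 - (2 : ℝ) ^ b / (w a : ℝ) ≤ 1 / 2)).trans (le_of_eq ?_)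
  rw [ENNReal.ofReal_div_of_pos two_pos]
  simp

lemma half_mul_two_mul (r : ℝ≥0∞) : 1 / 2 * (2 * r) = r := by
  rw [← mul_assoc, ENNReal.div_mul_cancel (by norm_num) (by norm_num), one_mul]

lemma cost_unifBucketSampler_le {b : ℤ} (hb : (bucket w b).Nonempty) :
    cost w hw (unifBucketSampler b) ≤ 2 * (((bucketProb w b)⁻¹ : ℝ≥0) : ℝ≥0∞) := by
  refine cost_loop_le (body := fun _ => unifRound b) (fun _ => (proper_unifRound hb).fresh)
    (Φ := fun _ => 2 * (((bucketProb w b)⁻¹ : ℝ≥0) : ℝ≥0∞)) (fun _ => ?_) ()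
  refine (add_le_add (cost_unifRound_le hb) (mean_unifRound_inl_le hb _)).trans ?_
  rw [half_mul_two_mul, two_mul]

lemma proper_unifBucketSampler {b : ℤ} (hb : (bucket w b).Nonempty) :
    Proper w hw (unifBucketSampler b) := by
  refine proper_loop (body := fun _ => unifRound b) (fun _ => proper_unifRound hb)
    (Φ := fun _ => 2 * 1) (fun _ => ?_) () (by norm_num)
  refine (add_le_add_right (mean_unifRound_inl_le hb _) _).trans ?_
  rw [half_mul_two_mul, two_mul]

/-- In one round every item is proposed and accepted with the same probability `γ = 2 ^ b /
bucketWeight w b`, since its weight cancels. Hence the uniform average is a fixed point of the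
round. -/
lemma mean_unifBucketSampler_le {b : ℤ} (hb : (bucket w b).Nonempty) (g : U × ℝ → ℝ≥0∞) :
    mean w hw (unifBucketSampler b) g ≤
      ∑ a ∈ bucket w b, (((bucket w b).card : ℝ≥0)⁻¹ : ℝ≥0) * g (a, (w a : ℝ)) := by
  set N := (bucket w b).card with hN
  set Ψ := ∑ a ∈ bucket w b, (((N : ℝ≥0)⁻¹ : ℝ≥0) : ℝ≥0∞) * g (a, (w a : ℝ)) with hΨ
  refine mean_loop_le (body := fun _ => unifRound b) (fun _ => (proper_unifRound hb).fresh)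
    (Φ := fun _ => Ψ) (fun _ => ?_) ()
  refine (mean_unifRound_le hb _).trans ?_
  simp only [Sum.elim_inl, Sum.elim_inr, mul_add]
  rw [Finset.sum_add_distrib]
  set γ : ℝ≥0 := (2 : ℝ≥0) ^ b / bucketWeight w b with hγ
  have hN0 : (N : ℝ≥0) ≠ 0 := by exact_mod_cast hb.card_pos.ne'
  have hq : ∀ a ∈ bucket w b, ((w a / bucketWeight w b : ℝ≥0) : ℝ≥0∞) *
      ENNReal.ofReal ((2 : ℝ) ^ b / (w a : ℝ)) = γ := by
    intro a ha
    have hwa := (weight_pos_of_mem ha).ne'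
    have : ENNReal.ofReal ((2 : ℝ) ^ b / (w a : ℝ)) = (((2 : ℝ≥0) ^ b / w a : ℝ≥0) : ℝ≥0∞) := by
      rw [← ENNReal.ofReal_coe_nnreal]; push_cast; rfl
    rw [this, ← ENNReal.coe_mul, hγ]
    congr 1
    field_simp
  have h1 : ∑ a ∈ bucket w b, ((w a / bucketWeight w b : ℝ≥0) : ℝ≥0∞) *
      (ENNReal.ofReal ((2 : ℝ) ^ b / (w a : ℝ)) * g (a, (w a : ℝ))) = (N : ℝ≥0∞) * γ * Ψ := by
    rw [hΨ, Finset.mul_sum]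
    refine Finset.sum_congr rfl fun a ha => ?_
    rw [← mul_assoc, hq a ha, ← mul_assoc]
    congr 1
    rw [← ENNReal.coe_natCast, ← ENNReal.coe_mul, ← ENNReal.coe_mul]
    congr 1
    field_simp
  have h2 : ∑ a ∈ bucket w b, ((w a / bucketWeight w b : ℝ≥0) : ℝ≥0∞) *
      (ENNReal.ofReal (1 - (2 : ℝ) ^ b / (w a : ℝ)) * Ψ) + (N : ℝ≥0∞) * γ * Ψ = Ψ := by
    have h3 : ∑ a ∈ bucket w b, ((w a / bucketWeight w b : ℝ≥0) : ℝ≥0∞) *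
        (ENNReal.ofReal (1 - (2 : ℝ) ^ b / (w a : ℝ)) * Ψ) =
        (∑ a ∈ bucket w b, ((w a / bucketWeight w b : ℝ≥0) : ℝ≥0∞) *
          ENNReal.ofReal (1 - (2 : ℝ) ^ b / (w a : ℝ))) * Ψ := by
      rw [Finset.sum_mul]; simp only [mul_assoc]
    have h4 : (N : ℝ≥0∞) * γ = ∑ a ∈ bucket w b, ((w a / bucketWeight w b : ℝ≥0) : ℝ≥0∞) *
        ENNReal.ofReal ((2 : ℝ) ^ b / (w a : ℝ)) := by
      rw [Finset.sum_congr rfl hq, Finset.sum_const, nsmul_eq_mul]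
    rw [h3, h4, ← add_mul, ← Finset.sum_add_distrib]
    refine Eq.trans ?_ (one_mul Ψ)
    congr 1
    refine Eq.trans (Finset.sum_congr rfl fun a ha => ?_) (sum_div_bucketWeight hb)
    have := threshold_mem ha
    rw [← mul_add, ← ENNReal.ofReal_add (by linarith) (by linarith), sub_add_cancel,
      ENNReal.ofReal_one, mul_one]
  rw [h1, h2]

end Bucket

/-! ### Estimating the size of a bucket -/

/-- A bound on the expected number of uniform samples from a set of size `N` until the first
repetition, when `j` distinct items have been seen. -/
def birthdayBound (N j : ℕ) : ℝ := ((⌈√(N : ℝ)⌉₊ - j : ℕ) : ℝ) + √(N : ℝ)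

lemma birthdayBound_nonneg (N j : ℕ) : 0 ≤ birthdayBound N j := by
  unfold birthdayBound; positivity

/-- While `j` is below `√N`, the sample just drawn is paid for by the decrease of the first summand.
From then on a sample repeats with probability `j / N ≥ 1 / √N`, so `√N` further samples suffice on
average. -/
lemma birthdayBound_step {N j : ℕ} (hN : 0 < N) (hj : j ≤ N) :
    1 + (1 - (j : ℝ) / N) * birthdayBound N (j + 1) ≤ birthdayBound N j := by
  have hN' : (0 : ℝ) < N := by exact_mod_cast hN
  have hj' : (j : ℝ) / N ≤ 1 := by
    rw [div_le_one hN']; exact_mod_cast hj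
  have hj0 : 0 ≤ (j : ℝ) / N := by positivity
  have hr : 0 < √(N : ℝ) := Real.sqrt_pos.2 hN'
  have hrr : √(N : ℝ) * √(N : ℝ) = N := Real.mul_self_sqrt hN'.le
  rcases lt_or_ge j ⌈√(N : ℝ)⌉₊ with h | h
  · have h1 : birthdayBound N j = 1 + birthdayBound N (j + 1) := by
      unfold birthdayBound
      have : ⌈√(N : ℝ)⌉₊ - j = 1 + (⌈√(N : ℝ)⌉₊ - (j + 1)) := by omega
      rw [this]; push_cast; ring
    rw [h1]
    have := birthdayBound_nonneg N (j + 1)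
    nlinarith
  · have h1 : birthdayBound N j = √(N : ℝ) := by
      unfold birthdayBound; rw [Nat.sub_eq_zero_of_le h]; simp
    have h2 : birthdayBound N (j + 1) = √(N : ℝ) := by
      unfold birthdayBound; rw [Nat.sub_eq_zero_of_le (by omega)]; simp
    rw [h1, h2]
    have h3 : √(N : ℝ) ≤ j := (Nat.le_ceil _).trans (by exact_mod_cast h)
    have h4 : 1 ≤ (j : ℝ) / N * √(N : ℝ) := by
      rw [div_mul_eq_mul_div, one_le_div hN']
      exact hrr.symm.le.trans (mul_le_mul_of_nonneg_right h3 hr.le)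
    linarith

lemma birthdayBound_zero_le {N : ℕ} (hN : 0 < N) : birthdayBound N 0 ≤ 3 * √(N : ℝ) := by
  have h1 : 1 ≤ √(N : ℝ) := Real.one_le_sqrt.2 (by exact_mod_cast hN)
  have h2 := Nat.ceil_lt_add_one (Real.sqrt_nonneg (N : ℝ))
  unfold birthdayBound
  rw [Nat.sub_zero]
  linarith

/-- A bound on the probability of a repetition among so few uniform samples that the estimate
`4 s ^ 2` is too small. -/
def earlyRepeatBound (N j : ℕ) : ℝ :=
  ∑ i ∈ Finset.Ico j N, if 4 * i ^ 2 < N then (i : ℝ) / N else 0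

lemma earlyRepeatBound_nonneg (N j : ℕ) : 0 ≤ earlyRepeatBound N j :=
  Finset.sum_nonneg fun i _ => by split_ifs <;> positivity

lemma earlyRepeatBound_step {N j : ℕ} (hN : 0 < N) (hj : j ≤ N) :
    (j : ℝ) / N * (if 4 * j ^ 2 < N then 1 else 0) +
      (1 - (j : ℝ) / N) * earlyRepeatBound N (j + 1) ≤ earlyRepeatBound N j := by
  have hN' : (0 : ℝ) < N := by exact_mod_cast hN
  rcases hj.eq_or_lt with rfl | hj
  -- With all `N` items seen a repetition is certain, but then the estimate is not too small.
  · have : ¬ 4 * j ^ 2 < j := by nlinarith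
    rw [if_neg this, div_self hN'.ne']
    simpa using earlyRepeatBound_nonneg j j
  · have h1 : earlyRepeatBound N j =
        (j : ℝ) / N * (if 4 * j ^ 2 < N then 1 else 0) + earlyRepeatBound N (j + 1) := by
      unfold earlyRepeatBound
      rw [Finset.sum_eq_sum_Ico_succ_bot hj, mul_ite, mul_one, mul_zero]
    rw [h1]
    have := earlyRepeatBound_nonneg N (j + 1)
    have : 0 ≤ (j : ℝ) / N := by positivity
    nlinarith

lemma earlyRepeatBound_zero_le {N : ℕ} (hN : 0 < N) : earlyRepeatBound N 0 ≤ 1 / 3 := by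
  have hN' : (0 : ℝ) < N := by exact_mod_cast hN
  -- The largest `i` with `4 * i ^ 2 < N`. The contributing `i` add up to `K (K + 1) / 2 ≤ K ^ 2`,
  -- so the bound obtained is in fact 1/4.
  set K := Nat.sqrt ((N - 1) / 4) with hK
  have hK4 : 4 * K ^ 2 < N := by
    have := Nat.sqrt_le' ((N - 1) / 4)
    rw [← hK] at this
    omega
  have hle : ∀ i, 4 * i ^ 2 < N → i ≤ K := by
    intro i hi
    rw [hK, Nat.le_sqrt']
    omega
  unfold earlyRepeatBound
  rw [← Finset.sum_filter]
  have hsub : (Finset.Ico 0 N).filter (fun i => 4 * i ^ 2 < N) ⊆ Finset.range (K + 1) := by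
    intro i hi
    rw [Finset.mem_filter] at hi
    exact Finset.mem_range.2 (Nat.lt_succ_of_le (hle i hi.2))
  refine (Finset.sum_le_sum_of_subset_of_nonneg hsub fun i _ _ => by positivity).trans ?_
  rw [← Finset.sum_div, div_le_iff₀ hN']
  have h1 := Finset.sum_range_id_mul_two (K + 1)
  have h2 : (K + 1) * (K + 1 - 1) ≤ 2 * K ^ 2 := by
    rcases K with _ | K
    · simp
    · simp only [Nat.add_sub_cancel]; nlinarith
  have h3 : 4 * ∑ i ∈ Finset.range (K + 1), i ≤ N := by omega
  have h4 : (4 : ℝ) * ∑ i ∈ Finset.range (K + 1), (i : ℝ) ≤ N := by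
    rw [← Nat.cast_sum]; exact_mod_cast h3
  linarith

section SetSize

variable {U : Type} [Fintype U] [DecidableEq U] [MeasurableSpace U]
  {w : U → ℝ≥0} {hw : 0 < ∑ a, w a}

/-- A round of `setSizeEstimator`. -/
def setRound (m : Prog U (U × ℝ)) (S : Finset U) : Prog U (Finset U ⊕ ℕ) :=
  m >>= fun x =>
    if x.1 ∈ S then pure (.inr (4 * S.card ^ 2)) else pure (.inl (insert x.1 S))

omit [Fintype U] [MeasurableSpace U] in
lemma setRound_eq (m : Prog U (U × ℝ)) (S : Finset U) : setRound m S = m >>= fun x =>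
    pure (if x.1 ∈ S then .inr (4 * S.card ^ 2) else .inl (insert x.1 S)) := by
  unfold setRound
  congr 1
  funext x
  split_ifs <;> rfl

lemma proper_setRound {m : Prog U (U × ℝ)} (hm : Proper w hw m) (S : Finset U) :
    Proper w hw (setRound m S) := by
  rw [setRound_eq]; exact hm.bind fun _ => proper_pure _

lemma cost_setRound_le {m : Prog U (U × ℝ)} (hm : Proper w hw m) (S : Finset U) :
    cost w hw (setRound m S) ≤ cost w hw m := by
  rw [setRound_eq]
  refine (hm.fresh.cost_bind_le fun _ => fresh_pure _).trans ?_
  simp only [cost_pure, hm.mean_const, add_zero, le_refl]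

/-- A function of the number of items seen as a potential on the states of `setSizeEstimator`. -/
def cardPotential (B : Finset U) (φ : ℕ → ℝ≥0∞) (S : Finset U) : ℝ≥0∞ :=
  if S ⊆ B then φ S.card else ⊤

variable (w hw) in
/-- A program sampling (at most) uniformly from a finite set of items. -/
structure UniformOn (B : Finset U) (m : Prog U (U × ℝ)) : Prop where
  proper : Proper w hw m
  mean_le : ∀ g : U × ℝ → ℝ≥0∞,
    mean w hw m g ≤ ∑ a ∈ B, ((B.card : ℝ≥0)⁻¹ : ℝ≥0) * g (a, (w a : ℝ))

/-- Under uniform sampling the number of distinct items seen is a Markov chain by itself, which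
reduces the analysis to a recursion in one integer. -/
lemma mean_setRound_le {B : Finset U} (hB : B.Nonempty) {m : Prog U (U × ℝ)}
    (hm : UniformOn w hw B m) (φ g : ℕ → ℝ≥0∞) {S : Finset U} (hS : S ⊆ B) :
    mean w hw (setRound m S) (Sum.elim (cardPotential B φ) g) ≤
      ENNReal.ofReal ((S.card : ℝ) / B.card) * g (4 * S.card ^ 2) +
        ENNReal.ofReal (1 - (S.card : ℝ) / B.card) * φ (S.card + 1) := by
  rw [setRound_eq, hm.proper.fresh.mean_bind fun _ => fresh_pure _]
  simp only [mean_pure]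
  refine (hm.mean_le _).trans (le_of_eq ?_)
  have hB0 : (0 : ℝ) < B.card := by exact_mod_cast hB.card_pos
  have hcard : ((B \ S).card : ℝ) = B.card - S.card := by
    rw [Finset.card_sdiff_of_subset hS, Nat.cast_sub (Finset.card_le_card hS)]
  have key : ∀ k : ℕ, (k : ℝ≥0∞) * (((B.card : ℝ≥0)⁻¹ : ℝ≥0) : ℝ≥0∞) =
      ENNReal.ofReal ((k : ℝ) / B.card) := by
    intro k
    rw [← ENNReal.coe_natCast, ← ENNReal.coe_mul, ← ENNReal.ofReal_coe_nnreal]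
    congr 1
  have h1 : 1 - (S.card : ℝ) / B.card = ((B \ S).card : ℝ) / B.card := by
    rw [hcard]; field_simp
  rw [h1, ← key, ← key, ← Finset.sum_sdiff hS, add_comm]
  congr 1
  · rw [mul_assoc, ← nsmul_eq_mul, ← Finset.sum_const]
    refine Finset.sum_congr rfl fun a ha => ?_
    simp only [if_pos ha, Sum.elim_inr]
  · rw [mul_assoc, ← nsmul_eq_mul, ← Finset.sum_const]
    refine Finset.sum_congr rfl fun a ha => ?_
    obtain ⟨haB, haS⟩ := Finset.mem_sdiff.1 ha
    simp only [if_neg haS, Sum.elim_inl, cardPotential]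
    rw [if_pos (Finset.insert_subset haB hS), Finset.card_insert_of_notMem haS]

lemma mean_setSizeEstimator_le {B : Finset U} (hB : B.Nonempty) {m : Prog U (U × ℝ)}
    (hm : UniformOn w hw B m) (φ g : ℕ → ℝ≥0∞)
    (h : ∀ j ≤ B.card, ENNReal.ofReal ((j : ℝ) / B.card) * g (4 * j ^ 2) +
        ENNReal.ofReal (1 - (j : ℝ) / B.card) * φ (j + 1) ≤ φ j) :
    mean w hw (setSizeEstimator m) g ≤ φ 0 := by
  refine (mean_loop_le (body := setRound m) (fun S => (proper_setRound hm.proper S).fresh)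
    (Φ := cardPotential B φ) (fun S => ?_) ∅).trans (by simp [cardPotential])
  -- Sets not contained in `B` carry the potential `⊤`, which makes the condition on them void.
  by_cases hS : S ⊆ B
  · refine (mean_setRound_le hB hm φ g hS).trans ((h _ (Finset.card_le_card hS)).trans ?_)
    simp [cardPotential, hS]
  · simp [cardPotential, hS]

omit [Fintype U] [DecidableEq U] [MeasurableSpace U] in
lemma div_card_le_one {B : Finset U} (hB : B.Nonempty) {j : ℕ} (hj : j ≤ B.card) :
    (j : ℝ) / B.card ≤ 1 := by
  have hB0 : (0 : ℝ) < B.card := by exact_mod_cast hB.card_pos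
  rw [div_le_one hB0]; exact_mod_cast hj

/-- The size estimate is an upper bound with good probability. -/
lemma mean_setSizeEstimator_small_le {B : Finset U} (hB : B.Nonempty) {m : Prog U (U × ℝ)}
    (hm : UniformOn w hw B m) :
    mean w hw (setSizeEstimator m) (fun n => if n < B.card then 1 else 0) ≤ 1 / 3 := by
  refine (mean_setSizeEstimator_le hB hm (fun j => ENNReal.ofReal (earlyRepeatBound B.card j)) _
    fun j hj => ?_).trans ?_
  · have h1 := div_card_le_one hB hj
    have h0 : 0 ≤ (j : ℝ) / B.card := by positivity
    have h2 : (if 4 * j ^ 2 < B.card then (1 : ℝ≥0∞) else 0) =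
        ENNReal.ofReal (if 4 * j ^ 2 < B.card then 1 else 0) := by split_ifs <;> simp
    rw [h2, ← ENNReal.ofReal_mul h0, ← ENNReal.ofReal_mul (by linarith), ← ENNReal.ofReal_add]
    · exact ENNReal.ofReal_le_ofReal (earlyRepeatBound_step hB.card_pos hj)
    · split_ifs <;> simp [h0]
    · exact mul_nonneg (by linarith) (earlyRepeatBound_nonneg _ _)
  · refine (ENNReal.ofReal_le_ofReal (earlyRepeatBound_zero_le hB.card_pos)).trans (le_of_eq ?_)
    rw [ENNReal.ofReal_div_of_pos (by norm_num)]; simp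

/-- The square root of the estimate is `2 s`, and `s` is of order `√N` on average. The cost of the
next stage is affine in this square root, so no tail bound on the estimate is needed. -/
lemma mean_setSizeEstimator_sqrt_le {B : Finset U} (hB : B.Nonempty) {m : Prog U (U × ℝ)}
    (hm : UniformOn w hw B m) :
    mean w hw (setSizeEstimator m) (fun n => ENNReal.ofReal √(n : ℝ)) ≤
      ENNReal.ofReal (6 * √(B.card : ℝ)) := by
  refine (mean_setSizeEstimator_le hB hm
    (fun j => ENNReal.ofReal (2 * (j + birthdayBound B.card j))) _ fun j hj => ?_).trans ?_
  · have h1 := div_card_le_one hB hj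
    have h0 : 0 ≤ (j : ℝ) / B.card := by positivity
    have h2 : √((4 * j ^ 2 : ℕ) : ℝ) = 2 * j := by
      rw [show ((4 * j ^ 2 : ℕ) : ℝ) = (2 * j) ^ 2 by push_cast; ring,
        Real.sqrt_sq (by positivity)]
    have h3 := birthdayBound_nonneg B.card (j + 1)
    rw [h2, ← ENNReal.ofReal_mul h0, ← ENNReal.ofReal_mul (by linarith), ← ENNReal.ofReal_add]
    · refine ENNReal.ofReal_le_ofReal ?_
      have := birthdayBound_step hB.card_pos hj
      push_cast
      nlinarith
    · positivity
    · refine mul_nonneg (by linarith) (by positivity)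
  · refine ENNReal.ofReal_le_ofReal ?_
    have := birthdayBound_zero_le hB.card_pos
    push_cast
    linarith

lemma cost_setSizeEstimator_le {B : Finset U} (hB : B.Nonempty) {m : Prog U (U × ℝ)}
    (hm : UniformOn w hw B m) :
    cost w hw (setSizeEstimator m) ≤ cost w hw m * ENNReal.ofReal (3 * √(B.card : ℝ)) := by
  refine (cost_loop_le (body := setRound m) (fun S => (proper_setRound hm.proper S).fresh)
    (Φ := cardPotential B fun j => cost w hw m * ENNReal.ofReal (birthdayBound B.card j))
    (fun S => ?_) ∅).trans ?_
  · by_cases hS : S ⊆ B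
    · refine (add_le_add (cost_setRound_le hm.proper S) (mean_setRound_le hB hm _ _ hS)).trans ?_
      have hj := Finset.card_le_card hS
      have h1 := div_card_le_one hB hj
      have h3 := birthdayBound_nonneg B.card (S.card + 1)
      simp only [cardPotential, if_pos hS, mul_zero, zero_add]
      calc _ = cost w hw m * (1 + ENNReal.ofReal (1 - (S.card : ℝ) / B.card) *
              ENNReal.ofReal (birthdayBound B.card (S.card + 1))) := by ring
        _ ≤ _ := by
          gcongr
          rw [← ENNReal.ofReal_mul (by linarith), ← ENNReal.ofReal_one,
            ← ENNReal.ofReal_add zero_le_one (mul_nonneg (by linarith) h3)]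
          exact ENNReal.ofReal_le_ofReal (birthdayBound_step hB.card_pos hj)
    · simp [cardPotential, hS]
  · simp only [cardPotential, Finset.empty_subset, if_true, Finset.card_empty]
    gcongr
    exact birthdayBound_zero_le hB.card_pos

lemma proper_setSizeEstimator {B : Finset U} (hB : B.Nonempty) {m : Prog U (U × ℝ)}
    (hm : UniformOn w hw B m) : Proper w hw (setSizeEstimator m) := by
  refine proper_loop (body := setRound m) (fun S => proper_setRound hm.proper S)
    (Φ := cardPotential B fun j => ENNReal.ofReal (birthdayBound B.card j))
    (fun S => ?_) ∅ (by simp [cardPotential])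
  by_cases hS : S ⊆ B
  · refine (add_le_add_right (mean_setRound_le hB hm _ _ hS) _).trans ?_
    have hj := Finset.card_le_card hS
    have h1 := div_card_le_one hB hj
    have h3 := birthdayBound_nonneg B.card (S.card + 1)
    simp only [cardPotential, if_pos hS, mul_zero, zero_add]
    rw [← ENNReal.ofReal_mul (by linarith), ← ENNReal.ofReal_one,
      ← ENNReal.ofReal_add zero_le_one (mul_nonneg (by linarith) h3)]
    exact ENNReal.ofReal_le_ofReal (birthdayBound_step hB.card_pos hj)
  · simp [cardPotential, hS]

end SetSize

/-! ### Estimating the probability of a bucket -/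

section Bernoulli

variable {U : Type} [Fintype U] [MeasurableSpace U] {w : U → ℝ≥0} {hw : 0 < ∑ a, w a}

/-- A round of `bernoulliEstimator` aiming at `k` successes. -/
def bernoulliRound (m : Prog U Bool) (k : ℕ) (s : ℕ × ℕ) : Prog U (ℕ × ℕ ⊕ ℝ) :=
  m >>= fun x =>
    if (if x then s.1 + 1 else s.1) = k then
      pure (.inr (((if x then s.1 + 1 else s.1 : ℕ) : ℝ) / ((s.2 + 1 : ℕ) : ℝ)))
    else pure (.inl ((if x then s.1 + 1 else s.1), s.2 + 1))

omit [Fintype U] [MeasurableSpace U] in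
lemma bernoulliEstimator_eq (m : Prog U Bool) (δ : ℝ) :
    bernoulliEstimator m δ = loop (bernoulliRound m ⌈12 / δ ^ 2⌉₊) (0, 0) := rfl

omit [Fintype U] [MeasurableSpace U] in
lemma bernoulliRound_eq (m : Prog U Bool) (k : ℕ) (s : ℕ × ℕ) :
    bernoulliRound m k s = m >>= fun x =>
      pure (if (if x then s.1 + 1 else s.1) = k then
        .inr (((if x then s.1 + 1 else s.1 : ℕ) : ℝ) / ((s.2 + 1 : ℕ) : ℝ))
      else .inl ((if x then s.1 + 1 else s.1), s.2 + 1)) := by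
  unfold bernoulliRound
  congr 1
  funext x
  exact (apply_ite pure _ _ _).symm

variable (w hw) in
/-- A trial succeeding with probability `p`. -/
structure TrialWith (p : ℝ) (m : Prog U Bool) : Prop where
  proper : Proper w hw m
  pos : 0 < p
  le_one : p ≤ 1
  mean_eq : ∀ g : Bool → ℝ≥0∞,
    mean w hw m g = ENNReal.ofReal p * g true + ENNReal.ofReal (1 - p) * g false

lemma proper_bernoulliRound {m : Prog U Bool} (hm : Proper w hw m) (k : ℕ) (s : ℕ × ℕ) :
    Proper w hw (bernoulliRound m k s) := by
  rw [bernoulliRound_eq]; exact hm.bind fun _ => proper_pure _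

lemma cost_bernoulliRound_le {m : Prog U Bool} (hm : Proper w hw m) (k : ℕ) (s : ℕ × ℕ) :
    cost w hw (bernoulliRound m k s) ≤ cost w hw m := by
  rw [bernoulliRound_eq]
  refine (hm.fresh.cost_bind_le fun _ => fresh_pure _).trans ?_
  simp only [cost_pure, hm.mean_const, add_zero, le_refl]

/-- A real function of (successes, trials) as a potential on the states with less than `k`
successes. -/
def trialPotential (k : ℕ) (φ : ℕ → ℕ → ℝ) (s : ℕ × ℕ) : ℝ≥0∞ :=
  if s.1 < k then ENNReal.ofReal (φ s.1 s.2) else ⊤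

lemma mean_bernoulliRound_le {p : ℝ} {m : Prog U Bool} (hm : TrialWith w hw p m) {k : ℕ}
    {φ : ℕ → ℕ → ℝ} {g : ℝ → ℝ≥0∞} (h0 : ∀ s t, s ≤ k → 0 ≤ φ s t)
    (hg : ∀ t : ℕ, g ((k : ℝ) / ((t + 1 : ℕ) : ℝ)) ≤ ENNReal.ofReal (φ k (t + 1)))
    {s : ℕ × ℕ} (hs : s.1 < k) :
    mean w hw (bernoulliRound m k s) (Sum.elim (trialPotential k φ) g) ≤
      ENNReal.ofReal (p * φ (s.1 + 1) (s.2 + 1) + (1 - p) * φ s.1 (s.2 + 1)) := by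
  have hp0 := hm.pos
  have hp1 := hm.le_one
  rw [bernoulliRound_eq, hm.proper.fresh.mean_bind fun _ => fresh_pure _]
  simp only [mean_pure]
  rw [hm.mean_eq, ENNReal.ofReal_add (mul_nonneg hp0.le (h0 _ _ hs))
    (mul_nonneg (by linarith) (h0 _ _ hs.le)), ENNReal.ofReal_mul hp0.le,
    ENNReal.ofReal_mul (by linarith)]
  refine add_le_add (mul_le_mul_right ?_ _) (mul_le_mul_right ?_ _)
  · simp only [if_true]
    by_cases h : s.1 + 1 = k
    · subst h
      rw [if_pos rfl, Sum.elim_inr]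
      exact hg s.2
    · rw [if_neg h, Sum.elim_inl, trialPotential, if_pos (by simp only; omega)]
  · simp only [Bool.false_eq_true, if_false]
    rw [if_neg hs.ne, Sum.elim_inl, trialPotential, if_pos hs]

lemma mean_bernoulliLoop_le {p : ℝ} {m : Prog U Bool} (hm : TrialWith w hw p m) {k : ℕ}
    (hk : 0 < k) {φ : ℕ → ℕ → ℝ} {g : ℝ → ℝ≥0∞} (h0 : ∀ s t, s ≤ k → 0 ≤ φ s t)
    (hg : ∀ t : ℕ, g ((k : ℝ) / ((t + 1 : ℕ) : ℝ)) ≤ ENNReal.ofReal (φ k (t + 1)))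
    (hφ : ∀ s t, s < k → p * φ (s + 1) (t + 1) + (1 - p) * φ s (t + 1) ≤ φ s t) :
    mean w hw (loop (bernoulliRound m k) (0, 0)) g ≤ ENNReal.ofReal (φ 0 0) := by
  refine (mean_loop_le (fun s => (proper_bernoulliRound hm.proper k s).fresh)
    (Φ := trialPotential k φ) (fun s => ?_) (0, 0)).trans (by simp [trialPotential, hk])
  by_cases hs : s.1 < k
  · refine (mean_bernoulliRound_le hm h0 hg hs).trans ?_
    rw [trialPotential, if_pos hs]
    exact ENNReal.ofReal_le_ofReal (hφ _ _ hs)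
  · simp [trialPotential, hs]

/-- The expected number of trials before `k` successes, given `s` successes. -/
def trialsBound (p : ℝ) (k s : ℕ) : ℝ := ((k : ℝ) - s) / p

lemma trialsBound_step {p : ℝ} (hp : 0 < p) (k s : ℕ) :
    1 + (p * trialsBound p k (s + 1) + (1 - p) * trialsBound p k s) ≤ trialsBound p k s := by
  unfold trialsBound
  push_cast
  apply le_of_eq
  field_simp
  ring

lemma trialsBound_nonneg {p : ℝ} (hp : 0 < p) {k s : ℕ} (h : s ≤ k) : 0 ≤ trialsBound p k s :=
  div_nonneg (sub_nonneg.2 (by exact_mod_cast h)) hp.le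

/-- The expected number of remaining trials drops by one per trial; this serves termination and cost
alike. -/
lemma trialPotential_step {p : ℝ} {m : Prog U Bool} (hm : TrialWith w hw p m) {k : ℕ}
    (s : ℕ × ℕ) :
    1 + mean w hw (bernoulliRound m k s)
        (Sum.elim (trialPotential k fun s _ => trialsBound p k s) fun _ => 0) ≤
      trialPotential k (fun s _ => trialsBound p k s) s := by
  by_cases hs : s.1 < k
  · refine (add_le_add_right (mean_bernoulliRound_le hm
      (fun s _ h => trialsBound_nonneg hm.pos h) (fun _ => zero_le) hs) _).trans ?_
    rw [trialPotential, if_pos hs, ← ENNReal.ofReal_one, ← ENNReal.ofReal_add zero_le_one]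
    · exact ENNReal.ofReal_le_ofReal (trialsBound_step hm.pos k s.1)
    · exact add_nonneg (mul_nonneg hm.pos.le (trialsBound_nonneg hm.pos hs))
        (mul_nonneg (sub_nonneg.2 hm.le_one) (trialsBound_nonneg hm.pos hs.le))
  · simp [trialPotential, hs]

lemma proper_bernoulliLoop {p : ℝ} {m : Prog U Bool} (hm : TrialWith w hw p m) {k : ℕ}
    (hk : 0 < k) : Proper w hw (loop (bernoulliRound m k) (0, 0)) :=
  proper_loop (fun s => proper_bernoulliRound hm.proper k s) (trialPotential_step hm) (0, 0)
    (by simp [trialPotential, hk])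

lemma cost_bernoulliLoop_le {p : ℝ} {m : Prog U Bool} (hm : TrialWith w hw p m)
    (hc : cost w hw m ≤ 1) {k : ℕ} (hk : 0 < k) :
    cost w hw (loop (bernoulliRound m k) (0, 0)) ≤ ENNReal.ofReal ((k : ℝ) / p) := by
  refine (cost_loop_le (fun s => (proper_bernoulliRound hm.proper k s).fresh)
    (Φ := trialPotential k fun s _ => trialsBound p k s) (fun s => ?_) (0, 0)).trans ?_
  · exact (add_le_add_left ((cost_bernoulliRound_le hm.proper k s).trans hc) _).trans
      (trialPotential_step hm s)
  · simp [trialPotential, hk, trialsBound]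

/-- The relative error bound for an estimate `r` of a probability `p`. -/
def ProbGood (p δ r : ℝ) : Prop := p ≤ r * (1 + δ / 2) ∧ r * (1 - δ / 2) ≤ p

lemma ProbGood.between {p δ x y z : ℝ} (h0 : 0 < δ) (h1 : δ < 1) (hxy : x ≤ y) (hyz : y ≤ z)
    (hx : ProbGood p δ x) (hz : ProbGood p δ z) : ProbGood p δ y :=
  ⟨hx.1.trans (mul_le_mul_of_nonneg_right hxy (by linarith)),
    (mul_le_mul_of_nonneg_right hyz (by linarith)).trans hz.2⟩

open Classical in
/-- Chebyshev's inequality for the negative binomial distribution. -/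
lemma mean_bernoulliEstimator_le {p : ℝ} {m : Prog U Bool} (hm : TrialWith w hw p m) {δ : ℝ}
    (hδ : 0 < δ) :
    mean w hw (bernoulliEstimator m δ) (fun r => if ¬ ProbGood p δ r then 1 else 0) ≤ 1 / 3 := by
  have hp0 := hm.pos
  have hp1 := hm.le_one
  rw [bernoulliEstimator_eq]
  set k := ⌈12 / δ ^ 2⌉₊ with hkdef
  have hk : 0 < k := Nat.ceil_pos.2 (by positivity)
  have hk' : (0 : ℝ) < k := by exact_mod_cast hk
  have hkδ : 12 ≤ (k : ℝ) * δ ^ 2 := by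
    have := Nat.le_ceil (12 / δ ^ 2)
    rwa [div_le_iff₀ (by positivity)] at this
  -- The inverse square of the admissible deviation `k δ / (2 p)` of the number of trials from its
  -- mean `k / p`.
  let c : ℝ := 4 * p ^ 2 / ((k : ℝ) ^ 2 * δ ^ 2)
  have hc : 0 < c := by positivity
  -- Up to `c`, the conditional second moment of the final number of trials around `k / p`, given
  -- `s` successes in `t` trials: squared conditional bias plus the variance still to come. It is a
  -- martingale, and its initial value `4 (1 - p) / (k δ ^ 2)` is at most 1/3 because `k δ ^ 2 ≥
  -- 12`.
  let φ : ℕ → ℕ → ℝ := fun s t => (((t : ℝ) - s / p) ^ 2 + ((k : ℝ) - s) * (1 - p) / p ^ 2) * c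
  have h0 : ∀ s t, s ≤ k → 0 ≤ φ s t := by
    intro s t hs
    have h1 : (0 : ℝ) ≤ (k : ℝ) - s := sub_nonneg.2 (by exact_mod_cast hs)
    have h2 : 0 ≤ 1 - p := by linarith
    positivity
  refine (mean_bernoulliLoop_le hm hk h0 (fun t => ?_) fun s t _ => ?_).trans
    ((ENNReal.ofReal_le_ofReal (?_ : φ 0 0 ≤ 1 / 3)).trans ?_)
  · split_ifs with h
    · exact zero_le
    · rw [← ENNReal.ofReal_one]
      refine ENNReal.ofReal_le_ofReal ?_
      set T : ℝ := ((t + 1 : ℕ) : ℝ) with hT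
      have hT0 : 0 < T := by rw [hT]; positivity
      have hφ : φ k (t + 1) = (2 * (p * T - k)) ^ 2 / ((k : ℝ) * δ) ^ 2 := by
        simp only [φ, c, ← hT]
        field_simp
        ring
      rw [hφ, one_le_div (by positivity), sq_le_sq, abs_of_pos (by positivity : 0 < (k : ℝ) * δ)]
      by_contra hlt
      push Not at hlt
      rw [abs_lt] at hlt
      refine h ⟨?_, ?_⟩
      · rw [div_mul_eq_mul_div, le_div_iff₀ hT0]; linarith [hlt.2]
      · rw [div_mul_eq_mul_div, div_le_iff₀ hT0]; linarith [hlt.1]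
  · refine le_of_eq ?_
    simp only [φ]
    push_cast
    field_simp
    ring
  · have : φ 0 0 = 4 * (1 - p) / (k * δ ^ 2) := by
      simp only [φ, c]
      push_cast
      field_simp
      ring
    rw [this, div_le_div_iff₀ (by positivity) (by norm_num)]
    linarith
  · rw [ENNReal.ofReal_div_of_pos (by norm_num)]; simp

variable [MeasurableSingletonClass U]

lemma cost_bucketTrial_le (b : ℤ) : cost w hw (bucketTrial b : Prog U Bool) ≤ 1 := by
  refine (fresh_draw.cost_bind_le fun _ => fresh_pure _).trans ?_
  simp only [cost_pure, cost_draw, proper_draw.mean_const, add_zero, le_refl]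

lemma trialWith_bucketTrial {b : ℤ} (hb : (bucket w b).Nonempty) :
    TrialWith w hw (bucketProb w b) (bucketTrial b : Prog U Bool) where
  proper := proper_draw.bind fun _ => proper_pure _
  pos := by exact_mod_cast bucketProb_pos hb
  le_one := by exact_mod_cast bucketProb_le_one w b
  mean_eq g := by
    unfold bucketTrial
    rw [fresh_draw.mean_bind fun _ => fresh_pure _]
    simp only [mean_pure]
    rw [mean_draw_ite (b := b) _ (fun _ => g true) (g false)
      (fun a ha => by rw [decide_eq_true (mem_bucket.1 ha)])
      fun a ha => by rw [decide_eq_false (mt mem_bucket.2 ha)]]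
    have h := bucketProb_add_missProb hw b
    have h1 : (1 : ℝ) - bucketProb w b = missProb w b := by
      rw [← NNReal.coe_one, ← h]; push_cast; ring
    rw [h1, ENNReal.ofReal_coe_nnreal, ENNReal.ofReal_coe_nnreal, ← Finset.sum_mul,
      bucketProb_eq_sum, ENNReal.ofNNReal_finsetSum]

end Bernoulli

/-! ### Expectations over lists of independent samples -/

section ListMean

variable {U : Type}

/-- The expectation of a function of a list of independent samples from a finite set. -/
def listMean (B : Finset U) (p : U → ℝ) : ℕ → (List U → ℝ) → ℝ
  | 0, g => g []
  | n + 1, g => ∑ a ∈ B, p a * listMean B p n fun l => g (a :: l)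

variable {B : Finset U} {p : U → ℝ}

lemma listMean_congr {n : ℕ} {g h : List U → ℝ}
    (hgh : ∀ l, l.length = n → (∀ a ∈ l, a ∈ B) → g l = h l) :
    listMean B p n g = listMean B p n h := by
  induction n generalizing g h with
  | zero => exact hgh [] rfl (by simp)
  | succ n ih =>
    refine Finset.sum_congr rfl fun a ha => ?_
    congr 1
    refine ih fun l hl hlB => hgh _ (by simp [hl]) ?_
    rintro x (_ | _)
    · exact ha
    · exact hlB _ ‹_›

lemma listMean_nonneg {n : ℕ} (hp : ∀ a ∈ B, 0 ≤ p a) {g : List U → ℝ} (hg : ∀ l, 0 ≤ g l) :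
    0 ≤ listMean B p n g := by
  induction n generalizing g with
  | zero => exact hg []
  | succ n ih => exact Finset.sum_nonneg fun a ha => mul_nonneg (hp a ha) (ih fun l => hg _)

lemma listMean_add (n : ℕ) (g h : List U → ℝ) :
    listMean B p n (fun l => g l + h l) = listMean B p n g + listMean B p n h := by
  induction n generalizing g h with
  | zero => rfl
  | succ n ih =>
    simp only [listMean]
    rw [← Finset.sum_add_distrib]
    exact Finset.sum_congr rfl fun a _ => by rw [ih, mul_add]

lemma listMean_const_mul (n : ℕ) (c : ℝ) (g : List U → ℝ) :
    listMean B p n (fun l => c * g l) = c * listMean B p n g := by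
  induction n generalizing g with
  | zero => rfl
  | succ n ih =>
    simp only [listMean]
    rw [Finset.mul_sum]
    exact Finset.sum_congr rfl fun a _ => by rw [ih]; ring

lemma listMean_const (hp : ∑ a ∈ B, p a = 1) (n : ℕ) (c : ℝ) :
    listMean B p n (fun _ => c) = c := by
  induction n with
  | zero => rfl
  | succ n ih =>
    simp only [listMean]
    rw [ih, ← Finset.sum_mul, hp, one_mul]

lemma listMean_sum {κ : Type} (n : ℕ) (s : Finset κ) (g : κ → List U → ℝ) :
    listMean B p n (fun l => ∑ i ∈ s, g i l) = ∑ i ∈ s, listMean B p n (g i) := by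
  induction n generalizing g with
  | zero => rfl
  | succ n ih =>
    simp only [listMean]
    rw [Finset.sum_comm]
    exact Finset.sum_congr rfl fun a _ => by rw [ih, Finset.mul_sum]

/-- The head of the list may be sampled after its tail. -/
lemma listMean_succ (n : ℕ) (g : List U → ℝ) :
    listMean B p (n + 1) g = listMean B p n fun l => ∑ a ∈ B, p a * g (a :: l) := by
  rw [listMean_sum]
  exact Finset.sum_congr rfl fun a _ => (listMean_const_mul n _ _).symm

variable [DecidableEq U]

lemma sum_mul_count_cons {a : U} (ha : a ∈ B) (hp : ∑ a ∈ B, p a = 1) (l : List U)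
    (f : ℕ → ℝ) :
    ∑ b ∈ B, p b * f ((b :: l).count a) =
      f (l.count a) + p a * (f (l.count a + 1) - f (l.count a)) := by
  have h1 : ∀ b ∈ B, p b * f ((b :: l).count a) =
      p b * f (l.count a) + if b = a then p b * (f (l.count a + 1) - f (l.count a)) else 0 := by
    intro b _
    rw [List.count_cons]
    by_cases h : b = a
    · simp only [h, beq_self_eq_true, if_true]; ring
    · simp [h]
  rw [Finset.sum_congr rfl h1, Finset.sum_add_distrib, ← Finset.sum_mul, hp, one_mul,
    Finset.sum_ite_eq' B a, if_pos ha]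

lemma listMean_count {a : U} (ha : a ∈ B) (hp : ∑ a ∈ B, p a = 1) (n : ℕ) :
    listMean B p n (fun l => (l.count a : ℝ)) = n * p a := by
  induction n with
  | zero => simp [listMean]
  | succ n ih =>
    rw [listMean_succ]
    simp only [sum_mul_count_cons ha hp _ fun k => (k : ℝ)]
    rw [listMean_add, ih]
    have : ∀ l : List U, p a * (((l.count a + 1 : ℕ) : ℝ) - l.count a) = p a := by
      intro l; push_cast; ring
    simp only [this, listMean_const hp]
    push_cast; ring

/-- The second moment of a binomial variable, by adding one sample at a time. -/
lemma listMean_count_sq {a : U} (ha : a ∈ B) (hp : ∑ a ∈ B, p a = 1) (n : ℕ) :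
    listMean B p n (fun l => (l.count a : ℝ) ^ 2) = n * p a * (1 - p a) + n ^ 2 * p a ^ 2 := by
  induction n with
  | zero => simp [listMean]
  | succ n ih =>
    rw [listMean_succ]
    simp only [sum_mul_count_cons ha hp _ fun k => (k : ℝ) ^ 2]
    rw [listMean_add, ih]
    have : ∀ l : List U, p a * (((l.count a + 1 : ℕ) : ℝ) ^ 2 - (l.count a : ℝ) ^ 2) =
        (2 * p a) * (l.count a : ℝ) + p a := by
      intro l; push_cast; ring
    simp only [this]
    rw [listMean_add, listMean_const_mul, listMean_count ha hp, listMean_const hp]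
    push_cast; ring

/-- The number of repeated pairs, each weighted by the inverse of the weight of its item. -/
def pairSum (B : Finset U) (v : U → ℝ) (l : List U) : ℝ :=
  ∑ a ∈ B, ((l.count a).choose 2 : ℝ) / v a

/-- A new sample of `a` forms one new pair with each earlier occurrence of `a`. -/
lemma pairSum_cons {v : U → ℝ} {a : U} (ha : a ∈ B) (l : List U) :
    pairSum B v (a :: l) = pairSum B v l + (l.count a : ℝ) / v a := by
  unfold pairSum
  have h1 : ∀ b ∈ B, (((a :: l).count b).choose 2 : ℝ) / v b =
      ((l.count b).choose 2 : ℝ) / v b + if b = a then (l.count b : ℝ) / v b else 0 := by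
    intro b _
    rw [List.count_cons]
    by_cases h : b = a
    · subst h
      simp only [beq_self_eq_true, if_true]
      rw [Nat.choose_succ_succ' _ 1, Nat.choose_one_right]
      push_cast; ring
    · have : ¬ a = b := fun h' => h h'.symm
      simp [h, this]
  rw [Finset.sum_congr rfl h1, Finset.sum_add_distrib, Finset.sum_ite_eq' B a, if_pos ha]

/-- The deviation of the weighted number of repeated pairs from its mean. -/
def pairDeviation (B : Finset U) (v : U → ℝ) (l : List U) : ℝ :=
  pairSum B v l - (l.length.choose 2 : ℝ) / ∑ a ∈ B, v a

lemma pairDeviation_cons {v : U → ℝ} {a : U} (ha : a ∈ B) (l : List U) :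
    pairDeviation B v (a :: l) = pairDeviation B v l +
      ((l.count a : ℝ) / v a - (l.length : ℝ) / ∑ a ∈ B, v a) := by
  unfold pairDeviation
  rw [pairSum_cons ha, List.length_cons, Nat.choose_succ_succ' _ 1, Nat.choose_one_right]
  push_cast; ring

lemma sum_count_eq_length {l : List U} (hl : ∀ a ∈ l, a ∈ B) :
    ∑ a ∈ B, (l.count a : ℝ) = l.length := by
  have h := Multiset.sum_count_eq_card (s := B) (m := (l : Multiset U)) fun a ha => hl a ha
  simp only [Multiset.coe_count, Multiset.coe_card] at h
  exact_mod_cast h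

/-- Under proportional sampling, the weighted numbers of repetitions contributed by the different
samples are uncorrelated. -/
lemma listMean_pairDeviation_sq {v : U → ℝ} (hB : B.Nonempty) (hv : ∀ a ∈ B, 0 < v a) (n : ℕ) :
    listMean B (fun a => v a / ∑ x ∈ B, v x) n (fun l => pairDeviation B v l ^ 2) =
      (n.choose 2 : ℝ) * (B.card - 1) / (∑ a ∈ B, v a) ^ 2 := by
  set V := ∑ a ∈ B, v a with hV
  have hV0 : 0 < V := Finset.sum_pos hv hB
  have hp : ∑ a ∈ B, v a / V = 1 := by rw [← Finset.sum_div, ← hV, div_self hV0.ne']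
  induction n with
  | zero => simp [listMean, pairDeviation, pairSum]
  | succ n ih =>
    rw [listMean_succ]
    -- Given the earlier samples, the new term `count a / v a` has mean `n / V`, since the sampling
    -- probability `v a / V` cancels the weight. So the cross term vanishes and only the second
    -- moment of the increment is added.
    have h1 : ∀ l : List U, l.length = n → (∀ a ∈ l, a ∈ B) →
        ∑ a ∈ B, v a / V * pairDeviation B v (a :: l) ^ 2 =
          pairDeviation B v l ^ 2 +
            (∑ a ∈ B, (1 / (V * v a)) * (l.count a : ℝ) ^ 2 + (-(n : ℝ) ^ 2 / V ^ 2)) := by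
      intro l hl hlB
      have e : ∀ a ∈ B, v a / V * pairDeviation B v (a :: l) ^ 2 =
          v a / V * (pairDeviation B v l ^ 2 - 2 * pairDeviation B v l * (n / V) + (n / V) ^ 2) +
          (l.count a : ℝ) * ((2 * pairDeviation B v l - 2 * (n / V)) / V) +
          (1 / (V * v a)) * (l.count a : ℝ) ^ 2 := by
        intro a ha
        have := (hv a ha).ne'
        rw [pairDeviation_cons ha, hl, ← hV]
        field_simp
        ring
      rw [Finset.sum_congr rfl e, Finset.sum_add_distrib, Finset.sum_add_distrib,
        ← Finset.sum_mul, hp, ← Finset.sum_mul, sum_count_eq_length hlB, hl]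
      field_simp
      ring
    rw [listMean_congr h1, listMean_add, ih, listMean_add, listMean_const hp, listMean_sum]
    -- Summed over `B` and with `n ^ 2 / V ^ 2` subtracted, these terms leave `n (|B| - 1) / V ^ 2`,
    -- the variance contributed by one sample.
    have h2 : ∀ a ∈ B, listMean B (fun a => v a / V) n
        (fun l => (1 / (V * v a)) * (l.count a : ℝ) ^ 2) =
        (n : ℝ) / V ^ 2 + (v a / V) * (((n : ℝ) ^ 2 - n) / V ^ 2) := by
      intro a ha
      have := (hv a ha).ne'
      rw [listMean_const_mul, listMean_count_sq ha hp]
      field_simp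
      ring
    rw [Finset.sum_congr rfl h2, Finset.sum_add_distrib, ← Finset.sum_mul, hp, Finset.sum_const,
      nsmul_eq_mul, Nat.choose_succ_succ' n 1, Nat.choose_one_right]
    push_cast
    field_simp
    ring

end ListMean

/-! ### The estimator with advice -/

section PropEstimator

variable {U : Type} [Fintype U] [DecidableEq U]

/-- The relative error bound for an estimate `x` of a weight `v`. -/
def WeightGood (v δ : ℝ) (x : ℝ≥0∞) : Prop :=
  ENNReal.ofReal v ≤ x * ENNReal.ofReal (1 + δ / 2) ∧
    x * ENNReal.ofReal (1 - δ / 2) ≤ ENNReal.ofReal v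

lemma WeightGood.between {v δ : ℝ} {x y z : ℝ≥0∞} (hxy : x ≤ y) (hyz : y ≤ z)
    (hx : WeightGood v δ x) (hz : WeightGood v δ z) : WeightGood v δ y :=
  ⟨hx.1.trans (mul_le_mul_left hxy _), (mul_le_mul_left hyz _).trans hz.2⟩

omit [Fintype U] in
lemma pairEstimate_map {w : U → ℝ≥0} {B : Finset U} (hB : ∀ a ∈ B, 0 < w a) {l : List U}
    (hl : ∀ a ∈ l, a ∈ B) :
    pairEstimate (l.map fun a => (a, (w a : ℝ))) =
      (l.length.choose 2 : ℝ≥0∞) * (ENNReal.ofReal (pairSum B (fun a => (w a : ℝ)) l))⁻¹ := by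
  unfold pairEstimate
  rw [List.length_map]
  congr 2
  have hinj : Function.Injective fun a : U => (a, (w a : ℝ)) := fun a b h => (Prod.ext_iff.1 h).1
  have hsub : (l.map fun a => (a, (w a : ℝ))).toFinset ⊆ B.map ⟨_, hinj⟩ := by
    intro x hx
    rw [List.mem_toFinset, List.mem_map] at hx
    obtain ⟨a, ha, rfl⟩ := hx
    exact Finset.mem_map_of_mem _ (hl a ha)
  have hcount : ∀ b : U, (l.map fun a => (a, (w a : ℝ))).countP (fun x => x.1 = b) =
      l.count b := by
    intro b
    rw [List.countP_map, List.count]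
    refine List.countP_congr fun a _ => ?_
    simp
  rw [Finset.sum_subset hsub, Finset.sum_map]
  · unfold pairSum
    rw [ENNReal.ofReal_sum_of_nonneg fun a _ => by positivity]
    refine Finset.sum_congr rfl fun a ha => ?_
    have : (0 : ℝ) < w a := by exact_mod_cast hB a ha
    rw [ENNReal.ofReal_div_of_pos this, ENNReal.ofReal_natCast]
    simp only [Function.Embedding.coeFn_mk, hcount]
  · rintro x hx hx'
    obtain ⟨a, _, rfl⟩ := Finset.mem_map.1 hx
    simp only [Function.Embedding.coeFn_mk, hcount]
    have : a ∉ l := by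
      intro ha
      exact hx' (List.mem_toFinset.2 (List.mem_map_of_mem ha))
    rw [List.count_eq_zero_of_not_mem this]
    simp

/-- `WeightGood` puts its error factors on the side of the estimate `C / X`, so it amounts to a
relative error of `X` and is not affected by the inversion. The bound `δ < 1` forces `X > 0`, so the
estimate is finite. -/
lemma weightGood_of_deviation {V X C δ : ℝ} (hV : 0 < V) (hC : 0 < C) (hδ : 0 < δ) (hδ1 : δ < 1)
    (h : |(X - C / V) * (V / C)| < δ / 2) :
    WeightGood V δ (ENNReal.ofReal C * (ENNReal.ofReal X)⁻¹) := by
  have e : (X - C / V) * (V / C) = X * V / C - 1 := by field_simp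
  rw [e, abs_lt] at h
  have h1 : 1 - δ / 2 < X * V / C := by linarith [h.1]
  have h2 : X * V / C < 1 + δ / 2 := by linarith [h.2]
  rw [lt_div_iff₀ hC] at h1
  rw [div_lt_iff₀ hC] at h2
  have hXV : 0 < X * V := lt_trans (mul_pos (by linarith) hC) h1
  have hX : 0 < X := pos_of_mul_pos_left hXV hV.le
  rw [← ENNReal.ofReal_inv_of_pos hX, ← ENNReal.ofReal_mul hC.le]
  have hCX : 0 ≤ C * X⁻¹ := by positivity
  constructor
  · rw [← ENNReal.ofReal_mul hCX]
    refine ENNReal.ofReal_le_ofReal ?_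
    rw [mul_right_comm, ← div_eq_mul_inv, le_div_iff₀ hX]
    linarith
  · rw [← ENNReal.ofReal_mul hCX]
    refine ENNReal.ofReal_le_ofReal ?_
    rw [mul_right_comm, ← div_eq_mul_inv, div_le_iff₀ hX]
    linarith

variable [MeasurableSpace U] {w : U → ℝ≥0} {hw : 0 < ∑ a, w a}

variable (w hw) in
/-- A program sampling (at most) proportionally from a finite set of items of positive weight. -/
structure ProportionalOn (B : Finset U) (m : Prog U (U × ℝ)) : Prop where
  proper : Proper w hw m
  nonempty : B.Nonempty
  pos : ∀ a ∈ B, 0 < w a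
  mean_le : ∀ g : U × ℝ → ℝ≥0∞,
    mean w hw m g ≤ ∑ a ∈ B, ((w a / ∑ x ∈ B, w x : ℝ≥0) : ℝ≥0∞) * g (a, (w a : ℝ))

-- Transfers a bound on program runs to an explicit finite sum over lists of items, where moments
-- are computed in real arithmetic.
omit [DecidableEq U] in
lemma mean_replicate_le_listMean {B : Finset U} {m : Prog U (U × ℝ)}
    (hm : ProportionalOn w hw B m) (n : ℕ) {F : List (U × ℝ) → ℝ≥0∞} {f : List U → ℝ}
    (hf : ∀ l, 0 ≤ f l)
    (hF : ∀ l : List U, l.length = n → (∀ a ∈ l, a ∈ B) →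
      F (l.map fun a => (a, (w a : ℝ))) ≤ ENNReal.ofReal (f l)) :
    mean w hw (replicate n m) F ≤
      ENNReal.ofReal (listMean B (fun a => (w a : ℝ) / ∑ x ∈ B, (w x : ℝ)) n f) := by
  induction n generalizing F f with
  | zero => simpa [replicate, mean_pure, listMean] using hF [] rfl (by simp)
  | succ n ih =>
    rw [mean_replicate_succ hm.proper]
    refine (hm.mean_le _).trans ?_
    simp only [listMean]
    rw [ENNReal.ofReal_sum_of_nonneg]
    · refine Finset.sum_le_sum fun a ha => ?_
      rw [ENNReal.ofReal_mul (by positivity)]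
      have : ((w a / ∑ x ∈ B, w x : ℝ≥0) : ℝ≥0∞) =
          ENNReal.ofReal ((w a : ℝ) / ∑ x ∈ B, (w x : ℝ)) := by
        rw [← ENNReal.ofReal_coe_nnreal]; push_cast; rfl
      rw [this]
      gcongr
      refine ih (fun l => hf _) fun l hl hlB => ?_
      refine hF (a :: l) (by simp [hl]) ?_
      rintro x (_ | _)
      · exact ha
      · exact hlB _ ‹_›
    · intro a ha
      exact mul_nonneg (by positivity) (listMean_nonneg (fun a _ => by positivity) fun l => hf _)

-- Chebyshev's inequality. The advice only has to be an upper bound on the size: an overestimate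
-- increases the number of samples and so lowers the relative variance.
open Classical in
lemma mean_propEstimator_le {B : Finset U} {m : Prog U (U × ℝ)} (hm : ProportionalOn w hw B m)
    {n' δ : ℝ} (hn : (B.card : ℝ) ≤ n') (hδ : 0 < δ) (hδ1 : δ < 1) :
    mean w hw (propEstimator m n' δ)
      (fun x => if ¬ WeightGood (∑ a ∈ B, (w a : ℝ)) δ x then 1 else 0) ≤ 1 / 3 := by
  unfold propEstimator
  rw [(proper_replicate hm.proper _).fresh.mean_bind fun l => fresh_pure _]
  simp only [mean_pure]
  set M := ⌈√(24 * n') / δ⌉₊ + 1 with hM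
  set V := ∑ a ∈ B, (w a : ℝ) with hV
  have hv : ∀ a ∈ B, (0 : ℝ) < w a := fun a ha => by exact_mod_cast hm.pos a ha
  have hV0 : 0 < V := Finset.sum_pos hv hm.nonempty
  have hcard : (1 : ℝ) ≤ B.card := by exact_mod_cast hm.nonempty.card_pos
  have hn0 : 0 < n' := by linarith
  -- From `M (M - 1) / 2 ≥ (M - 1) ^ 2 / 2`; the extra sample in `M` makes `M - 1` the full ceiling.
  -- The failure bound `4 (|B| - 1) / ((M choose 2) δ ^ 2)` is then at most 1/3.
  have hC12 : 12 * n' ≤ (M.choose 2 : ℝ) * δ ^ 2 := by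
    have h1 : √(24 * n') ≤ ((M : ℝ) - 1) * δ := by
      have := Nat.le_ceil (√(24 * n') / δ)
      rw [div_le_iff₀ hδ] at this
      rw [hM]; push_cast; linarith
    have h2 : 24 * n' ≤ (((M : ℝ) - 1) * δ) ^ 2 := by
      calc 24 * n' = √(24 * n') ^ 2 := (Real.sq_sqrt (by positivity)).symm
        _ ≤ _ := pow_le_pow_left₀ (Real.sqrt_nonneg _) h1 2
    have h3 : (0 : ℝ) ≤ (M : ℝ) - 1 := by rw [hM]; push_cast; simp
    rw [Nat.cast_choose_two]
    nlinarith [mul_nonneg h3 (sq_nonneg δ)]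
  have hC0 : (0 : ℝ) < M.choose 2 := by
    by_contra h
    have : (M.choose 2 : ℝ) = 0 := le_antisymm (not_lt.1 h) (by positivity)
    rw [this] at hC12
    linarith
  let c : ℝ := (V / M.choose 2) ^ 2 * (4 / δ ^ 2)
  have hc : 0 < c := by positivity
  refine (mean_replicate_le_listMean hm M
    (f := fun l => c * pairDeviation B (fun a => (w a : ℝ)) l ^ 2)
    (fun l => by positivity) fun l hl hlB => ?_).trans ?_
  · rw [pairEstimate_map hm.pos hlB, hl]
    split_ifs with h
    · exact zero_le
    · rw [← ENNReal.ofReal_one]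
      refine ENNReal.ofReal_le_ofReal ?_
      by_contra hlt
      push Not at hlt
      refine h ?_
      have := weightGood_of_deviation (X := pairSum B (fun a => (w a : ℝ)) l) hV0 hC0 hδ hδ1 ?_
      · rwa [ENNReal.ofReal_natCast] at this
      · have e : c * pairDeviation B (fun a => (w a : ℝ)) l ^ 2 =
            ((pairSum B (fun a => (w a : ℝ)) l - (M.choose 2 : ℝ) / V) *
              (V / (M.choose 2 : ℝ))) ^ 2 * (4 / δ ^ 2) := by
          simp only [c, pairDeviation, hl, ← hV]; ring
        rw [e, mul_div_assoc', div_lt_one (by positivity)] at hlt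
        refine abs_lt_of_sq_lt_sq ?_ (by positivity)
        linarith
  · rw [listMean_const_mul, listMean_pairDeviation_sq hm.nonempty hv, ← hV]
    have e : c * ((M.choose 2 : ℝ) * ((B.card : ℝ) - 1) / V ^ 2) =
        4 * ((B.card : ℝ) - 1) / ((M.choose 2 : ℝ) * δ ^ 2) := by
      simp only [c]
      field_simp
    rw [e]
    refine (ENNReal.ofReal_le_ofReal (?_ : _ ≤ (1 / 3 : ℝ))).trans ?_
    · rw [div_le_div_iff₀ (by positivity) (by norm_num)]
      linarith
    · rw [ENNReal.ofReal_div_of_pos (by norm_num)]; simp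

lemma proper_propEstimator {m : Prog U (U × ℝ)} (hm : Proper w hw m) (n' δ : ℝ) :
    Proper w hw (propEstimator m n' δ) :=
  (proper_replicate hm _).bind fun _ => proper_pure _

lemma cost_propEstimator_le {m : Prog U (U × ℝ)} (hm : Proper w hw m) {n' δ : ℝ} (hδ : 0 < δ) :
    cost w hw (propEstimator m n' δ) ≤
      ENNReal.ofReal (5 / δ * √n' + 2) * cost w hw m := by
  refine ((proper_replicate hm _).fresh.cost_bind_le fun l => fresh_pure _).trans ?_
  simp only [cost_pure, (proper_replicate hm _).mean_const, add_zero]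
  refine (cost_replicate_le hm _).trans ?_
  gcongr
  rw [← ENNReal.ofReal_natCast]
  refine ENNReal.ofReal_le_ofReal ?_
  have h1 := Nat.ceil_lt_add_one (by positivity : 0 ≤ √(24 * n') / δ)
  have h2 : √(24 * n') ≤ 5 * √n' := by
    rw [Real.sqrt_mul (by norm_num)]
    refine mul_le_mul_of_nonneg_right ?_ (Real.sqrt_nonneg _)
    exact Real.sqrt_le_iff.2 (by norm_num)
  have h3 : √(24 * n') / δ ≤ 5 / δ * √n' := by
    rw [div_mul_eq_mul_div]
    exact div_le_div_of_nonneg_right h2 hδ.le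
  push_cast
  linarith

end PropEstimator

/-! ### Freshness of the assembled programs -/

section Fresh

variable {U α : Type} [Fintype U] [MeasurableSpace U] {w : U → ℝ≥0} {hw : 0 < ∑ a, w a}

lemma fresh_replicate {m : Prog U α} (hm : Fresh w hw m) (k : ℕ) : Fresh w hw (replicate k m) := by
  induction k with
  | zero => exact fresh_pure _
  | succ k ih => exact hm.bind fun a => ih.bind fun l => fresh_pure _

lemma fresh_amplify [LinearOrder α] [Inhabited α] {m : Prog U α} (hm : Fresh w hw m) :
    Fresh w hw (amplify m) :=
  (fresh_replicate hm 15).bind fun _ => fresh_pure _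

lemma fresh_setSizeEstimator [DecidableEq U] {m : Prog U (U × ℝ)} (hm : Fresh w hw m) :
    Fresh w hw (setSizeEstimator m) :=
  fresh_loop (body := setRound m)
    (fun S => by rw [setRound_eq]; exact hm.bind fun _ => fresh_pure _) _

lemma fresh_propEstimator [DecidableEq U] {m : Prog U (U × ℝ)} (hm : Fresh w hw m) (n' δ : ℝ) :
    Fresh w hw (propEstimator m n' δ) :=
  (fresh_replicate hm _).bind fun _ => fresh_pure _

lemma fresh_bernoulliEstimator {m : Prog U Bool} (hm : Fresh w hw m) (δ : ℝ) :
    Fresh w hw (bernoulliEstimator m δ) :=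
  fresh_loop (body := bernoulliRound m _)
    (fun s => by rw [bernoulliRound_eq]; exact hm.bind fun _ => fresh_pure _) _

variable [MeasurableSingletonClass U]

lemma fresh_propBucketSampler (b : ℤ) : Fresh w hw (propBucketSampler b) :=
  fresh_loop (body := fun _ => propRound b) (fun _ => (proper_propRound b).fresh) ()

lemma fresh_unifBucketSampler (b : ℤ) : Fresh w hw (unifBucketSampler b) :=
  fresh_loop (body := fun _ => unifRound b)
    (fun _ => (fresh_propBucketSampler b).bind fun _ => fresh_coinBranch _ _ _) ()

lemma fresh_bucketTrial (b : ℤ) : Fresh w hw (bucketTrial b) :=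
  fresh_draw.bind fun _ => fresh_pure _

end Fresh

/-! ### The estimator for a given bucket -/

section BucketEstimator

variable {U : Type} [DecidableEq U]

/-- The part of the algorithm that follows the choice of the bucket. -/
def bucketEstimator (ε : ℝ) (b : ℤ) : Prog U ℝ≥0∞ := do
  let nb ← amplify (setSizeEstimator (unifBucketSampler b))
  let Wb ← amplify (propEstimator (propBucketSampler b) nb (ε / 3))
  let Pb ← amplify (bernoulliEstimator (bucketTrial b) (ε / 3))
  pure (Wb / ENNReal.ofReal Pb)

/-- The bucket chosen from two sampled weights. -/
def chosenBucket (x y : ℝ) : ℤ := max ⌊Real.logb 2 x⌋ ⌊Real.logb 2 y⌋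

lemma noAdvicePropEstimator_eq (ε : ℝ) :
    (noAdvicePropEstimator ε : Prog U ℝ≥0∞) =
      draw >>= fun x => draw >>= fun y => bucketEstimator ε (chosenBucket x.2 y.2) := rfl

/-- The output is a `(1 ± ε)`-approximation of `v`. -/
def OutputGood (ε v : ℝ) (x : ℝ≥0∞) : Prop :=
  ENNReal.ofReal ((1 - ε) * v) ≤ x ∧ x ≤ ENNReal.ofReal ((1 + ε) * v)

/-- With `d = ε / 6` the quotient lies between `(1 - d) / (1 + d)` and `(1 + d) / (1 - d)` times
`W`, and these lie within `1 ± 6 d` as `d < 1 / 6`. -/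
lemma OutputGood.of_div {ε v W p r : ℝ} {x : ℝ≥0∞} (h0 : 0 < ε) (h1 : ε < 1) (hv : 0 < v)
    (hW : 0 < W) (hp : p = v / W) (hx : WeightGood v (ε / 3) x) (hr : ProbGood p (ε / 3) r) :
    OutputGood ε W (x / ENNReal.ofReal r) := by
  obtain ⟨hx1, hx2⟩ := hx
  obtain ⟨hr1, hr2⟩ := hr
  set d := ε / 3 / 2 with hd
  have hd0 : 0 < d := by positivity
  have hd1 : d < 1 / 6 := by rw [hd]; linarith
  have hε : ε = 6 * d := by rw [hd]; ring
  have hp0 : 0 < p := by rw [hp]; positivity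
  have hr0 : 0 < r := pos_of_mul_pos_left (hp0.trans_le hr1) (by linarith)
  have hxt : x ≠ ⊤ := by
    rintro rfl
    rw [ENNReal.top_mul (by simp only [ne_eq, ENNReal.ofReal_eq_zero, not_le]; linarith)] at hx2
    exact absurd hx2 (by simp)
  lift x to ℝ≥0 using hxt
  have hv' : v = p * W := by rw [hp]; field_simp
  rw [← ENNReal.ofReal_coe_nnreal, ← ENNReal.ofReal_mul x.coe_nonneg,
    ENNReal.ofReal_le_ofReal_iff (mul_nonneg x.coe_nonneg (by linarith))] at hx1
  rw [← ENNReal.ofReal_coe_nnreal, ← ENNReal.ofReal_mul x.coe_nonneg,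
    ENNReal.ofReal_le_ofReal_iff hv.le] at hx2
  rw [← ENNReal.ofReal_coe_nnreal, ← ENNReal.ofReal_div_of_pos hr0]
  set y : ℝ := (x : ℝ) with hy
  constructor
  · refine ENNReal.ofReal_le_ofReal ?_
    rw [le_div_iff₀ hr0]
    have h3 : (1 - ε) * W * r * ((1 + d) * (1 - d)) ≤ y * ((1 + d) * (1 - d)) := by
      calc (1 - ε) * W * r * ((1 + d) * (1 - d))
          = ((1 - 6 * d) * (1 + d)) * W * (r * (1 - d)) := by rw [hε]; ring
        _ ≤ ((1 - 6 * d) * (1 + d)) * W * p := by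
            refine mul_le_mul_of_nonneg_left hr2 (mul_nonneg (mul_nonneg ?_ ?_) hW.le) <;> linarith
        _ = ((1 - 6 * d) * (1 + d)) * v := by rw [hv']; ring
        _ ≤ (1 - d) * v := by
            refine mul_le_mul_of_nonneg_right ?_ hv.le
            nlinarith
        _ ≤ (1 - d) * (y * (1 + d)) := mul_le_mul_of_nonneg_left hx1 (by linarith)
        _ = _ := by ring
    exact le_of_mul_le_mul_right h3 (mul_pos (by linarith) (by linarith))
  · refine ENNReal.ofReal_le_ofReal ?_
    rw [div_le_iff₀ hr0]
    have h3 : y * ((1 + d) * (1 - d)) ≤ (1 + ε) * W * r * ((1 + d) * (1 - d)) := by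
      calc y * ((1 + d) * (1 - d)) = (1 + d) * (y * (1 - d)) := by ring
        _ ≤ (1 + d) * v := mul_le_mul_of_nonneg_left hx2 (by linarith)
        _ ≤ ((1 + 6 * d) * (1 - d)) * v := by
            refine mul_le_mul_of_nonneg_right ?_ hv.le
            nlinarith
        _ = ((1 + 6 * d) * (1 - d)) * W * p := by rw [hv']; ring
        _ ≤ ((1 + 6 * d) * (1 - d)) * W * (r * (1 + d)) := by
            refine mul_le_mul_of_nonneg_left hr1 (mul_nonneg (mul_nonneg ?_ ?_) hW.le) <;> linarith
        _ = _ := by rw [hε]; ring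
    exact le_of_mul_le_mul_right h3 (mul_pos (by linarith) (by linarith))

variable [Fintype U] [MeasurableSpace U] [MeasurableSingletonClass U]
  {w : U → ℝ≥0} {hw : 0 < ∑ a, w a}

omit [DecidableEq U] in
lemma uniformOn_unifBucketSampler {b : ℤ} (hb : (bucket w b).Nonempty) :
    UniformOn w hw (bucket w b) (unifBucketSampler b) :=
  ⟨proper_unifBucketSampler hb, mean_unifBucketSampler_le hb⟩

omit [DecidableEq U] in
lemma proportionalOn_propBucketSampler {b : ℤ} (hb : (bucket w b).Nonempty) :
    ProportionalOn w hw (bucket w b) (propBucketSampler b) :=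
  ⟨proper_propBucketSampler hb, hb, fun _ h => weight_pos_of_mem h, mean_propBucketSampler_le hb⟩

omit [DecidableEq U] in
lemma proper_bernoulliEstimator {b : ℤ} (hb : (bucket w b).Nonempty) {δ : ℝ} (hδ : 0 < δ) :
    Proper w hw (bernoulliEstimator (bucketTrial b : Prog U Bool) δ) :=
  proper_bernoulliLoop (trialWith_bucketTrial hb) (Nat.ceil_pos.2 (by positivity))

/-- Includes empty buckets, where the program may diverge: the rules for `bind` ask for freshness of
every continuation, even of those reached with probability zero. -/
lemma fresh_bucketEstimator (ε : ℝ) (b : ℤ) : Fresh w hw (bucketEstimator ε b) :=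
  (fresh_amplify (fresh_setSizeEstimator (fresh_unifBucketSampler b))).bind fun _ =>
    (fresh_amplify (fresh_propEstimator (fresh_propBucketSampler b) _ _)).bind fun _ =>
      (fresh_amplify (fresh_bernoulliEstimator (fresh_bucketTrial b) _)).bind fun _ => fresh_pure _

lemma proper_bucketEstimator {ε : ℝ} (hε : 0 < ε) {b : ℤ} (hb : (bucket w b).Nonempty) :
    Proper w hw (bucketEstimator ε b) :=
  (proper_amplify (proper_setSizeEstimator hb (uniformOn_unifBucketSampler hb))).bind fun _ =>
    (proper_amplify (proper_propEstimator (proper_propBucketSampler hb) _ _)).bind fun _ =>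
      (proper_amplify (proper_bernoulliEstimator hb (by positivity))).bind fun _ => proper_pure _

lemma mean_bucketEstimator (ε : ℝ) (b : ℤ) (g : ℝ≥0∞ → ℝ≥0∞) :
    mean w hw (bucketEstimator ε b) g =
      mean w hw (amplify (setSizeEstimator (unifBucketSampler b))) fun nb =>
        mean w hw (amplify (propEstimator (propBucketSampler b) nb (ε / 3))) fun Wb =>
          mean w hw (amplify (bernoulliEstimator (bucketTrial b) (ε / 3))) fun Pb =>
            g (Wb / ENNReal.ofReal Pb) := by
  have h3 := fresh_amplify (fresh_bernoulliEstimator (fresh_bucketTrial (w := w) (hw := hw) b)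
    (ε / 3))
  have h2 : ∀ nb : ℕ, Fresh w hw
      (amplify (propEstimator (propBucketSampler b) (nb : ℝ) (ε / 3))) := fun nb =>
    fresh_amplify (fresh_propEstimator (fresh_propBucketSampler b) _ _)
  unfold bucketEstimator
  rw [(fresh_amplify (fresh_setSizeEstimator (fresh_unifBucketSampler b))).mean_bind fun nb =>
    (h2 nb).bind fun _ => h3.bind fun _ => fresh_pure _]
  congr 1
  funext nb
  rw [(h2 nb).mean_bind fun _ => h3.bind fun _ => fresh_pure _]
  congr 1
  funext Wb
  rw [h3.mean_bind fun _ => fresh_pure _]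
  simp only [mean_pure]

open Classical in
/-- The three medians fail with total probability at most `3 / 10`. -/
lemma mean_bucketEstimator_bad_le {ε : ℝ} (h0 : 0 < ε) (h1 : ε < 1) {b : ℤ}
    (hb : (bucket w b).Nonempty) :
    mean w hw (bucketEstimator ε b)
      (fun x => if ¬ OutputGood ε ((∑ a, w a : ℝ≥0) : ℝ) x then 1 else 0) ≤
      1 / 10 + (1 / 10 + 1 / 10) := by
  have hδ0 : 0 < ε / 3 := by positivity
  have hδ1 : ε / 3 < 1 := by linarith
  have hsize := uniformOn_unifBucketSampler (hw := hw) hb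
  have hprop := proportionalOn_propBucketSampler (hw := hw) hb
  set v : ℝ := ∑ a ∈ bucket w b, (w a : ℝ) with hv
  have hvb : v = bucketWeight w b := by rw [hv, bucketWeight]; push_cast; rfl
  have hv0 : 0 < v := by rw [hvb]; exact_mod_cast bucketWeight_pos hb
  have hp : (bucketProb w b : ℝ) = v / ((∑ a, w a : ℝ≥0) : ℝ) := by
    rw [hvb, bucketProb]; push_cast; rfl
  have hP1 := proper_amplify (proper_setSizeEstimator hb hsize)
  have hP2 := fun nb : ℕ => proper_amplify (proper_propEstimator hprop.proper (nb : ℝ) (ε / 3))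
  have hP3 := proper_amplify (proper_bernoulliEstimator (w := w) (hw := hw) hb hδ0)
  have hbad1 : mean w hw (amplify (setSizeEstimator (unifBucketSampler b)))
      (fun nb => if nb < (bucket w b).card then 1 else 0) ≤ 1 / 10 :=
    mean_amplify_le (proper_setSizeEstimator hb hsize)
      (fun x y z hxy hyz hx _ => not_lt.2 ((not_lt.1 hx).trans hxy))
      (mean_setSizeEstimator_small_le hb hsize)
  have hbad2 : ∀ nb : ℕ, (bucket w b).card ≤ nb →
      mean w hw (amplify (propEstimator (propBucketSampler b) nb (ε / 3)))
        (fun x => if ¬ WeightGood v (ε / 3) x then 1 else 0) ≤ 1 / 10 := fun nb hnb =>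
    mean_amplify_le (proper_propEstimator hprop.proper _ _)
      (fun x y z hxy hyz hx hz => not_not.2
        (WeightGood.between hxy hyz (not_not.1 hx) (not_not.1 hz)))
      (mean_propEstimator_le hprop (by exact_mod_cast hnb) hδ0 hδ1)
  have hbad3 : mean w hw (amplify (bernoulliEstimator (bucketTrial b) (ε / 3)))
      (fun r => if ¬ ProbGood (bucketProb w b) (ε / 3) r then 1 else 0) ≤ 1 / 10 :=
    mean_amplify_le (proper_bernoulliEstimator hb hδ0)
      (fun x y z hxy hyz hx hz => not_not.2
        (ProbGood.between hδ0 hδ1 hxy hyz (not_not.1 hx) (not_not.1 hz)))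
      (mean_bernoulliEstimator_le (trialWith_bucketTrial hb) hδ0)
  rw [mean_bucketEstimator]
  -- The union bound, taken from the last stage backwards: the failure probability of the remaining
  -- stages is at most the indicator that the current value is bad plus 1/10 for each remaining
  -- stage.
  have hstep3 : ∀ Wb : ℝ≥0∞,
      mean w hw (amplify (bernoulliEstimator (bucketTrial b) (ε / 3)))
        (fun r => if ¬ OutputGood ε ((∑ a, w a : ℝ≥0) : ℝ) (Wb / ENNReal.ofReal r)
          then 1 else 0) ≤
        (if ¬ WeightGood v (ε / 3) Wb then 1 else 0) + 1 / 10 := by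
    intro Wb
    by_cases hW : WeightGood v (ε / 3) Wb
    · rw [if_neg (not_not.2 hW), zero_add]
      refine (mean_mono fun r => ?_).trans hbad3
      by_cases hr : ProbGood (bucketProb w b) (ε / 3) r
      · rw [if_neg (not_not.2 (OutputGood.of_div h0 h1 hv0 (by exact_mod_cast hw) hp hW hr))]
        exact zero_le
      · rw [if_pos hr]
        split_ifs <;> simp
    · rw [if_pos hW]
      refine le_add_right ?_
      refine (mean_mono fun r => ?_).trans hP3.mean_one.le
      split_ifs <;> simp
  have hstep2 : ∀ nb : ℕ,
      mean w hw (amplify (propEstimator (propBucketSampler b) nb (ε / 3))) (fun Wb =>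
        mean w hw (amplify (bernoulliEstimator (bucketTrial b) (ε / 3)))
          (fun r => if ¬ OutputGood ε ((∑ a, w a : ℝ≥0) : ℝ) (Wb / ENNReal.ofReal r)
            then 1 else 0)) ≤
        (if nb < (bucket w b).card then 1 else 0) + (1 / 10 + 1 / 10) := by
    intro nb
    by_cases hn : nb < (bucket w b).card
    · rw [if_pos hn]
      refine le_add_right ?_
      refine (mean_mono fun Wb => ?_).trans (hP2 nb).mean_one.le
      refine (mean_mono fun r => ?_).trans hP3.mean_one.le
      split_ifs <;> simp
    · rw [if_neg hn, zero_add]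
      refine (mean_mono hstep3).trans ?_
      rw [(hP2 nb).fresh.mean_add, (hP2 nb).mean_const]
      exact add_le_add_left (hbad2 nb (not_lt.1 hn)) _
  refine (mean_mono hstep2).trans ?_
  rw [hP1.fresh.mean_add, hP1.mean_const]
  exact add_le_add_left hbad1 _

/-! ### The choice of the bucket -/

omit [Fintype U] [DecidableEq U] [MeasurableSpace U] [MeasurableSingletonClass U] in
lemma zpow_floor_logb_le {x : ℝ} (hx : 0 < x) :
    (2 : ℝ) ^ ⌊Real.logb 2 x⌋ ≤ x ∧ x < (2 : ℝ) ^ (⌊Real.logb 2 x⌋ + 1) := by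
  have e : ⌊Real.logb 2 x⌋ = Int.log 2 x := by
    have := Real.floor_logb_natCast (b := 2) hx.le
    simpa using this
  rw [e]
  exact ⟨by simpa using Int.zpow_log_le_self (b := 2) one_lt_two hx,
    by simpa using Int.lt_zpow_succ_log_self (b := 2) one_lt_two x⟩

omit [DecidableEq U] [MeasurableSpace U] [MeasurableSingletonClass U] in
lemma mem_bucket_floor {a : U} (ha : 0 < w a) : a ∈ bucket w ⌊Real.logb 2 (w a : ℝ)⌋ :=
  mem_bucket.2 (zpow_floor_logb_le (by exact_mod_cast ha))

omit [DecidableEq U] [MeasurableSpace U] [MeasurableSingletonClass U] in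
lemma bucket_chosen_nonempty {a a' : U} (ha : 0 < w a) (ha' : 0 < w a') :
    (bucket w (chosenBucket (w a) (w a'))).Nonempty := by
  unfold chosenBucket
  rcases max_choice ⌊Real.logb 2 (w a : ℝ)⌋ ⌊Real.logb 2 (w a' : ℝ)⌋ with h | h <;> rw [h]
  · exact ⟨a, mem_bucket_floor ha⟩
  · exact ⟨a', mem_bucket_floor ha'⟩

omit [DecidableEq U] in
/-- Only items of positive weight are ever drawn. -/
lemma mean_draw_mono {g h : U × ℝ → ℝ≥0∞}
    (hgh : ∀ a, 0 < w a → g (a, (w a : ℝ)) ≤ h (a, (w a : ℝ))) :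
    mean w hw draw g ≤ mean w hw draw h := by
  rw [mean_draw, mean_draw]
  refine Finset.sum_le_sum fun a _ => ?_
  rcases (zero_le : 0 ≤ w a).eq_or_lt with h0 | h0
  · simp [← h0]
  · exact mul_le_mul_right (hgh a h0) _

lemma fresh_noAdvicePropEstimator (ε : ℝ) : Fresh w hw (noAdvicePropEstimator ε) := by
  rw [noAdvicePropEstimator_eq]
  exact fresh_draw.bind fun _ => fresh_draw.bind fun _ => fresh_bucketEstimator _ _

lemma mean_noAdvicePropEstimator (ε : ℝ) (g : ℝ≥0∞ → ℝ≥0∞) :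
    mean w hw (noAdvicePropEstimator ε) g = mean w hw draw fun x => mean w hw draw fun y =>
      mean w hw (bucketEstimator ε (chosenBucket x.2 y.2)) g := by
  rw [noAdvicePropEstimator_eq,
    fresh_draw.mean_bind fun _ => fresh_draw.bind fun _ => fresh_bucketEstimator _ _]
  congr 1
  funext x
  rw [fresh_draw.mean_bind fun _ => fresh_bucketEstimator _ _]

/-- `Proper.bind` does not apply, because pairs of weights pointing to an empty bucket would have to
be treated as well; `mean_draw_mono` discards these null events. -/
lemma proper_noAdvicePropEstimator {ε : ℝ} (h0 : 0 < ε) :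
    Proper w hw (noAdvicePropEstimator ε) := by
  refine ⟨fresh_noAdvicePropEstimator ε, le_antisymm (expect_one_le _) ?_⟩
  rw [mean_noAdvicePropEstimator]
  calc (1 : ℝ≥0∞) = mean w hw draw fun _ => mean w hw draw fun _ => 1 := by
        simp only [proper_draw.mean_const]
    _ ≤ _ := mean_draw_mono fun a ha => mean_draw_mono fun a' ha' =>
        (proper_bucketEstimator h0 (bucket_chosen_nonempty ha ha')).mean_one.ge

open Classical in
lemma mean_noAdvicePropEstimator_bad_le {ε : ℝ} (h0 : 0 < ε) (h1 : ε < 1) :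
    mean w hw (noAdvicePropEstimator ε)
      (fun x => if ¬ OutputGood ε ((∑ a, w a : ℝ≥0) : ℝ) x then 1 else 0) ≤
      1 / 10 + (1 / 10 + 1 / 10) := by
  rw [mean_noAdvicePropEstimator]
  calc _ ≤ mean w hw draw fun _ : U × ℝ => mean w hw draw fun _ : U × ℝ =>
        (1 / 10 + (1 / 10 + 1 / 10) : ℝ≥0∞) :=
        mean_draw_mono fun a ha => mean_draw_mono fun a' ha' =>
          mean_bucketEstimator_bad_le h0 h1 (bucket_chosen_nonempty ha ha')
    _ = _ := by simp only [proper_draw.mean_const]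

open Classical in
theorem noAdvicePropEstimator_approximates {ε : ℝ} (h0 : 0 < ε) (h1 : ε < 1) :
    (2 / 3 : ℝ≥0∞) ≤ randomness w hw
      {ω | Approximates (noAdvicePropEstimator ε) (tapeOf w ω) ε ((∑ a, w a : ℝ≥0) : ℝ)} := by
  set W : ℝ := ((∑ a, w a : ℝ≥0) : ℝ) with hW
  have hP := proper_noAdvicePropEstimator (w := w) (hw := hw) h0
  have hbad := mean_noAdvicePropEstimator_bad_le (w := w) (hw := hw) h0 h1
  rw [← hW] at hbad
  have hsum : mean w hw (noAdvicePropEstimator ε) (fun x => if OutputGood ε W x then 1 else 0) +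
      mean w hw (noAdvicePropEstimator ε) (fun x => if ¬ OutputGood ε W x then 1 else 0) = 1 := by
    rw [← hP.fresh.mean_add, ← hP.mean_one]
    congr 1
    funext x
    by_cases h : OutputGood ε W x <;> simp [h, hP.mean_one]
  have hgood : (2 / 3 : ℝ≥0∞) ≤
      mean w hw (noAdvicePropEstimator ε) (fun x => if OutputGood ε W x then 1 else 0) := by
    have h3 : (1 / 10 + (1 / 10 + 1 / 10) : ℝ≥0∞) ≤ 1 / 3 := by
      have e : ∀ n : ℕ, 0 < n → (1 / n : ℝ≥0∞) = ENNReal.ofReal (1 / n) := by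
        intro n hn
        rw [ENNReal.ofReal_div_of_pos (by exact_mod_cast hn)]; simp
      have e10 := e 10 (by norm_num)
      have e3 := e 3 (by norm_num)
      push_cast at e10 e3
      rw [e10, e3, ← ENNReal.ofReal_add (by norm_num) (by norm_num),
        ← ENNReal.ofReal_add (by norm_num) (by norm_num)]
      exact ENNReal.ofReal_le_ofReal (by norm_num)
    have h4 : (2 / 3 : ℝ≥0∞) + 1 / 3 = 1 := by
      rw [ENNReal.div_add_div_same]
      norm_num
      exact ENNReal.div_self (by norm_num) (by norm_num)
    have h5 : (2 / 3 : ℝ≥0∞) + 1 / 3 ≤ mean w hw (noAdvicePropEstimator ε)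
        (fun x => if OutputGood ε W x then 1 else 0) + 1 / 3 := by
      refine (h4.trans hsum.symm).le.trans ?_
      gcongr
      exact hbad.trans h3
    exact (ENNReal.add_le_add_iff_right (by norm_num)).1 h5
  -- The integral of an indicator is at most the measure of its set without any measurability of
  -- that set.
  refine hgood.trans (le_trans (lintegral_mono fun ω => ?_) (lintegral_indicator_one_le _))
  rcases h : noAdvicePropEstimator ε (tapeOf w ω) with _ | r
  · simp
  · simp only [fold_some]
    split_ifs with hr
    · rw [Set.indicator_of_mem]
      · simp
      · exact ⟨r, h, hr⟩
    · exact zero_le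

-- The two sides differ only on diverging runs, counted as `∞` on the left and as 0 on the right,
-- and these form a null set.
omit [DecidableEq U] [MeasurableSingletonClass U] in
lemma Proper.lintegral_sampleCount {α : Type} {m : Prog U α} (hm : Proper w hw m) :
    ∫⁻ ω, sampleCount m (tapeOf w ω) ∂randomness w hw = cost w hw m := by
  have hmeas := hm.fresh.measurable_expect fun _ _ => 1
  have hA : MeasurableSet {ω | fold (fun _ _ _ => 1) (m (tapeOf w ω)) = 1} :=
    hmeas (measurableSet_singleton 1)
  have hone : randomness w hw {ω | fold (fun _ _ _ => 1) (m (tapeOf w ω)) = 1} = 1 := by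
    refine Eq.trans ?_ hm.mean_one
    rw [mean, expect, ← lintegral_indicator_one hA]
    refine lintegral_congr fun ω => ?_
    rcases h : m (tapeOf w ω) with _ | r
    · rw [Set.indicator_of_notMem]
      · simp
      · simp [h]
    · rw [Set.indicator_of_mem]
      · simp
      · simp [h]
  have hae : ∀ᵐ ω ∂randomness w hw, fold (fun _ _ _ => 1) (m (tapeOf w ω)) = 1 :=
    (prob_compl_eq_zero_iff hA).2 hone
  refine lintegral_congr_ae ?_
  filter_upwards [hae] with ω hω
  unfold sampleCount
  rcases h : m (tapeOf w ω) with _ | r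
  · simp [h] at hω
  · rfl

end BucketEstimator

/-! ### The expected cost for a given bucket -/

section Cost

variable {U : Type} [Fintype U] [DecidableEq U] [MeasurableSpace U] [MeasurableSingletonClass U]
  {w : U → ℝ≥0} {hw : 0 < ∑ a, w a}

/-- A bound on the expected cost of the estimator for the bucket `b`. -/
def bucketCost (w : U → ℝ≥0) (ε : ℝ) (b : ℤ) : ℝ :=
  (21000 * √((bucket w b).card : ℝ) / ε + 1700 / ε ^ 2) / bucketProb w b

omit [DecidableEq U] [MeasurableSpace U] [MeasurableSingletonClass U] in
lemma bucketCost_nonneg {ε : ℝ} (h0 : 0 < ε) (b : ℤ) : 0 ≤ bucketCost w ε b := by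
  unfold bucketCost; positivity

/-- The size estimate enters the cost of the second stage only through an affine function of its
square root, so averaging over it needs only `mean_setSizeEstimator_sqrt_le`. -/
lemma cost_bucketEstimator_le_add {ε : ℝ} (h0 : 0 < ε) {b : ℤ} (hb : (bucket w b).Nonempty) :
    cost w hw (bucketEstimator ε b) ≤
      15 * (2 * ENNReal.ofReal (1 / bucketProb w b) *
        ENNReal.ofReal (3 * √((bucket w b).card : ℝ))) +
      (15 * ENNReal.ofReal (6 * √((bucket w b).card : ℝ)) *
          (15 * ENNReal.ofReal (15 / ε) * ENNReal.ofReal (1 / bucketProb w b)) +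
        (15 * (2 * ENNReal.ofReal (1 / bucketProb w b)) +
          15 * ENNReal.ofReal ((⌈12 / (ε / 3) ^ 2⌉₊ : ℝ) / bucketProb w b))) := by
  have hδ0 : 0 < ε / 3 := by positivity
  have hsize := uniformOn_unifBucketSampler (hw := hw) hb
  have hprop := proportionalOn_propBucketSampler (hw := hw) hb
  have hpS := proper_setSizeEstimator hb hsize
  have hP1 := proper_amplify hpS
  have hP2 := fun nb : ℕ => proper_amplify (proper_propEstimator hprop.proper (nb : ℝ) (ε / 3))
  have hpB := proper_bernoulliEstimator (w := w) (hw := hw) hb hδ0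
  have hP3 := proper_amplify hpB
  have hq : (((bucketProb w b)⁻¹ : ℝ≥0) : ℝ≥0∞) = ENNReal.ofReal (1 / bucketProb w b) := by
    rw [← ENNReal.ofReal_coe_nnreal, one_div]; push_cast; rfl
  set q := ENNReal.ofReal (1 / bucketProb w b) with hqdef
  have hc1 : cost w hw (amplify (setSizeEstimator (unifBucketSampler b))) ≤
      15 * (2 * q * ENNReal.ofReal (3 * √((bucket w b).card : ℝ))) := by
    refine (cost_amplify_le hpS).trans ?_
    gcongr
    refine (cost_setSizeEstimator_le hb hsize).trans ?_
    gcongr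
    exact (cost_unifBucketSampler_le hb).trans_eq (by rw [hq])
  have hc2 : ∀ nb : ℕ,
      cost w hw (amplify (propEstimator (propBucketSampler b) nb (ε / 3))) ≤
        ENNReal.ofReal √(nb : ℝ) * (15 * ENNReal.ofReal (15 / ε) * q) + 15 * (2 * q) := by
    intro nb
    refine (cost_amplify_le (proper_propEstimator hprop.proper _ _)).trans ?_
    calc _ ≤ 15 * (ENNReal.ofReal (5 / (ε / 3) * √(nb : ℝ) + 2) * q) := by
          gcongr
          refine (cost_propEstimator_le hprop.proper hδ0).trans ?_
          gcongr
          exact (cost_propBucketSampler_le hb).trans_eq hq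
      _ = 15 * ((ENNReal.ofReal (15 / ε) * ENNReal.ofReal √(nb : ℝ) + 2) * q) := by
          rw [show 5 / (ε / 3) = 15 / ε by field_simp; norm_num,
            ENNReal.ofReal_add (by positivity) (by norm_num), ENNReal.ofReal_mul (by positivity)]
          simp
      _ = _ := by ring
  have hc3 : cost w hw (amplify (bernoulliEstimator (bucketTrial b) (ε / 3))) ≤
      15 * ENNReal.ofReal ((⌈12 / (ε / 3) ^ 2⌉₊ : ℝ) / bucketProb w b) := by
    refine (cost_amplify_le hpB).trans ?_
    gcongr
    exact cost_bernoulliLoop_le (trialWith_bucketTrial hb) (cost_bucketTrial_le b)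
      (Nat.ceil_pos.2 (by positivity))
  have hfin3 : ∀ Wb : ℝ≥0∞, cost w hw (amplify (bernoulliEstimator (bucketTrial b) (ε / 3)) >>=
      fun Pb => pure (Wb / ENNReal.ofReal Pb)) ≤
      15 * ENNReal.ofReal ((⌈12 / (ε / 3) ^ 2⌉₊ : ℝ) / bucketProb w b) := by
    intro Wb
    refine (hP3.fresh.cost_bind_le fun _ => fresh_pure _).trans ?_
    simp only [cost_pure, hP3.mean_const, add_zero]
    exact hc3
  unfold bucketEstimator
  refine (hP1.fresh.cost_bind_le fun nb => (hP2 nb).fresh.bind fun _ =>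
    hP3.fresh.bind fun _ => fresh_pure _).trans (add_le_add hc1 ?_)
  calc _ ≤ mean w hw (amplify (setSizeEstimator (unifBucketSampler b))) fun nb =>
        ENNReal.ofReal √(nb : ℝ) * (15 * ENNReal.ofReal (15 / ε) * q) + (15 * (2 * q) +
          15 * ENNReal.ofReal ((⌈12 / (ε / 3) ^ 2⌉₊ : ℝ) / bucketProb w b)) := by
        refine mean_mono fun nb => ?_
        refine ((hP2 nb).fresh.cost_bind_le fun _ => hP3.fresh.bind fun _ =>
          fresh_pure _).trans ?_
        rw [← add_assoc]
        refine add_le_add (hc2 nb) ?_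
        exact (mean_mono hfin3).trans ((hP2 nb).fresh.mean_const_le _)
    _ ≤ _ := by
        rw [hP1.fresh.mean_add, hP1.mean_const, hP1.fresh.mean_mul_const]
        gcongr
        refine (mean_amplify_le_sum hpS _).trans ?_
        gcongr
        exact mean_setSizeEstimator_sqrt_le hb hsize

lemma cost_bucketEstimator_le {ε : ℝ} (h0 : 0 < ε) (h1 : ε < 1) {b : ℤ}
    (hb : (bucket w b).Nonempty) :
    cost w hw (bucketEstimator ε b) ≤ ENNReal.ofReal (bucketCost w ε b) := by
  refine (cost_bucketEstimator_le_add h0 hb).trans ?_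
  have hP : (0 : ℝ) < bucketProb w b := by exact_mod_cast bucketProb_pos hb
  set P : ℝ := ((bucketProb w b : ℝ≥0) : ℝ) with hPdef
  set r : ℝ := √((bucket w b).card : ℝ) with hr
  have hr1 : 1 ≤ r := Real.one_le_sqrt.2 (by exact_mod_cast hb.card_pos)
  have e15 : (15 : ℝ≥0∞) = ENNReal.ofReal 15 := by simp
  have e2 : (2 : ℝ≥0∞) = ENNReal.ofReal 2 := by simp
  rw [e15, e2]
  have hk := Nat.ceil_lt_add_one (by positivity : 0 ≤ 12 / (ε / 3) ^ 2)
  set k : ℝ := (⌈12 / (ε / 3) ^ 2⌉₊ : ℝ) with hkdef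
  have hk0 : 0 ≤ k := by positivity
  rw [← ENNReal.ofReal_mul (by positivity), ← ENNReal.ofReal_mul (by positivity),
    ← ENNReal.ofReal_mul (by positivity), ← ENNReal.ofReal_mul (by positivity),
    ← ENNReal.ofReal_mul (by positivity), ← ENNReal.ofReal_mul (by positivity),
    ← ENNReal.ofReal_mul (by positivity), ← ENNReal.ofReal_mul (by positivity),
    ← ENNReal.ofReal_mul (by positivity),
    ← ENNReal.ofReal_add (by positivity) (by positivity),
    ← ENNReal.ofReal_add (by positivity) (by positivity),
    ← ENNReal.ofReal_add (by positivity) (by positivity)]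
  refine ENNReal.ofReal_le_ofReal ?_
  have hε1 : 1 ≤ 1 / ε := by rw [le_div_iff₀ h0]; linarith
  set x : ℝ := 1 / ε with hx
  have hk2 : k ≤ 108 * x ^ 2 + 1 := by
    refine hk.le.trans (le_of_eq ?_)
    rw [hx]; field_simp; norm_num
  have e1 : bucketCost w ε b = (21000 * r * x + 1700 * x ^ 2) / P := by
    rw [bucketCost, ← hPdef, ← hr, hx]; field_simp
  have e2 : 15 * (2 * (1 / P) * (3 * r)) + (15 * (6 * r) * (15 * (15 / ε) * (1 / P)) +
      (15 * (2 * (1 / P)) + 15 * (k / P))) =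
      (90 * r + 20250 * r * x + 30 + 15 * k) / P := by
    rw [hx]; field_simp; ring
  rw [e1, e2]
  refine div_le_div_of_nonneg_right ?_ hP.le
  -- As `x ≥ 1`, the total is at most `20340 r x + 1665 x ^ 2`, which explains the constants of
  -- `bucketCost`.
  nlinarith [mul_nonneg (by linarith : (0 : ℝ) ≤ r) (by linarith : 0 ≤ x - 1)]

/-! ### Summation over the buckets -/

omit [DecidableEq U] [MeasurableSpace U] [MeasurableSingletonClass U] in
/-- The bucket of an item. -/
def level (w : U → ℝ≥0) (a : U) : ℤ := ⌊Real.logb 2 (w a : ℝ)⌋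

/-- The items of positive weight. -/
def support (w : U → ℝ≥0) : Finset U := Finset.univ.filter fun a => 0 < w a

/-- The nonempty buckets. -/
def levels (w : U → ℝ≥0) : Finset ℤ := (support w).image (level w)

/-- The probability of sampling an item from the buckets up to `b`. -/
def lowProb (w : U → ℝ≥0) (b : ℤ) : ℝ :=
  ∑ a ∈ (support w).filter fun a => level w a ≤ b, (w a : ℝ) / ∑ x, (w x : ℝ)

lemma lintegral_sampleCount_le {ε : ℝ} (h0 : 0 < ε) (h1 : ε < 1) :
    ∫⁻ ω, sampleCount (noAdvicePropEstimator ε) (tapeOf w ω) ∂randomness w hw ≤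
      ENNReal.ofReal (2 + ∑ a ∈ support w, ∑ a' ∈ support w,
        (w a : ℝ) / (∑ x, (w x : ℝ)) * ((w a' : ℝ) / (∑ x, (w x : ℝ)) *
          bucketCost w ε (max (level w a) (level w a')))) := by
  rw [(proper_noAdvicePropEstimator h0).lintegral_sampleCount, noAdvicePropEstimator_eq]
  have hin : ∀ x : U × ℝ,
      cost w hw (draw >>= fun y => bucketEstimator ε (chosenBucket x.2 y.2)) ≤
        1 + mean w hw draw fun y => cost w hw (bucketEstimator ε (chosenBucket x.2 y.2)) :=
    fun x => (fresh_draw.cost_bind_le fun _ => fresh_bucketEstimator _ _).trans_eq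
      (by rw [cost_draw])
  refine (fresh_draw.cost_bind_le fun _ => fresh_draw.bind fun _ =>
    fresh_bucketEstimator _ _).trans ?_
  rw [cost_draw]
  have hdraw : ∀ (g : U × ℝ → ℝ≥0∞) (f : U → ℝ), (∀ a, 0 ≤ f a) →
      (∀ a, 0 < w a → g (a, (w a : ℝ)) ≤ ENNReal.ofReal (f a)) → mean w hw draw g ≤
        ENNReal.ofReal (∑ a ∈ support w, (w a : ℝ) / (∑ x, (w x : ℝ)) * f a) := by
    intro g f hf0 hf
    rw [mean_draw, ENNReal.ofReal_sum_of_nonneg fun a _ => mul_nonneg (by positivity) (hf0 a)]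
    rw [← Finset.sum_subset (Finset.subset_univ (support w))]
    · refine Finset.sum_le_sum fun a ha => ?_
      rw [ENNReal.ofReal_mul (by positivity)]
      have : ((w a / ∑ x, w x : ℝ≥0) : ℝ≥0∞) =
          ENNReal.ofReal ((w a : ℝ) / ∑ x, (w x : ℝ)) := by
        rw [← ENNReal.ofReal_coe_nnreal]; push_cast; rfl
      rw [this]
      exact mul_le_mul_right (hf a (Finset.mem_filter.1 ha).2) _
    · intro a _ ha
      have : w a = 0 := by
        by_contra h
        exact ha (Finset.mem_filter.2 ⟨Finset.mem_univ _, pos_iff_ne_zero.2 h⟩)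
      simp [this]
  have hnn : ∀ a a' : U, 0 ≤ bucketCost w ε (max (level w a) (level w a')) :=
    fun a a' => bucketCost_nonneg h0 _
  calc 1 + _ ≤ 1 + (1 + mean w hw draw fun x => mean w hw draw fun y =>
        cost w hw (bucketEstimator ε (chosenBucket x.2 y.2))) := by
        gcongr
        refine (mean_mono hin).trans ?_
        rw [fresh_draw.mean_add, proper_draw.mean_const]
    _ ≤ 1 + (1 + ENNReal.ofReal (∑ a ∈ support w, (w a : ℝ) / (∑ x, (w x : ℝ)) *
        ∑ a' ∈ support w, (w a' : ℝ) / (∑ x, (w x : ℝ)) *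
          bucketCost w ε (max (level w a) (level w a')))) := by
        gcongr
        refine hdraw _ _ (fun a => Finset.sum_nonneg fun a' _ =>
          mul_nonneg (by positivity) (hnn a a')) fun a ha => ?_
        refine hdraw _ _ (fun a' => hnn a a') fun a' ha' => ?_
        exact cost_bucketEstimator_le h0 h1 (bucket_chosen_nonempty ha ha')
    _ = _ := by
        rw [← add_assoc, ENNReal.ofReal_add (by norm_num)]
        · simp only [Finset.mul_sum]
          congr 1
          norm_num
        · exact Finset.sum_nonneg fun a _ => Finset.sum_nonneg fun a' _ =>
            mul_nonneg (by positivity) (mul_nonneg (by positivity) (hnn a a'))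

end Cost

/-! ### Geometric sums over the levels around the mean weight -/

section Levels

variable {U : Type} [Fintype U] {w : U → ℝ≥0}

lemma mem_support {a : U} : a ∈ support w ↔ 0 < w a := by simp [support]

lemma mem_bucket_iff_level {a : U} {b : ℤ} : a ∈ bucket w b ↔ a ∈ support w ∧ level w a = b := by
  rw [mem_support]
  constructor
  · intro h
    have hpos := weight_pos_of_mem h
    refine ⟨hpos, ?_⟩
    have h1 := mem_bucket.1 h
    have h2 := zpow_floor_logb_le (x := (w a : ℝ)) (by exact_mod_cast hpos)
    have h3 := (zpow_lt_zpow_iff_right₀ (one_lt_two (α := ℝ))).1 (h2.1.trans_lt h1.2)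
    have h4 := (zpow_lt_zpow_iff_right₀ (one_lt_two (α := ℝ))).1 (h1.1.trans_lt h2.2)
    unfold level
    omega
  · rintro ⟨hpos, rfl⟩
    exact mem_bucket_floor hpos

lemma filter_level_eq (b : ℤ) : (support w).filter (fun a => level w a = b) = bucket w b := by
  ext a
  rw [Finset.mem_filter, mem_bucket_iff_level]

lemma sum_level (F : ℤ → ℝ) :
    ∑ a ∈ support w, (w a : ℝ) / (∑ x, (w x : ℝ)) * F (level w a) =
      ∑ b ∈ levels w, (bucketProb w b : ℝ) * F b := by
  rw [← Finset.sum_fiberwise_of_maps_to (t := levels w) (g := level w)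
    fun a ha => Finset.mem_image_of_mem _ ha]
  refine Finset.sum_congr rfl fun b _ => ?_
  rw [filter_level_eq, bucketProb_eq_sum]
  push_cast
  rw [Finset.sum_mul]
  exact Finset.sum_congr rfl fun a ha => by rw [(mem_bucket_iff_level.1 ha).2]

/-- The larger of the levels of two samples is, up to a factor of two, the level of the first one
restricted to the event that it dominates. -/
lemma sum_max_level_le {R : ℤ → ℝ} (hR : ∀ b, 0 ≤ R b) :
    ∑ a ∈ support w, ∑ a' ∈ support w, (w a : ℝ) / (∑ x, (w x : ℝ)) *
        ((w a' : ℝ) / (∑ x, (w x : ℝ)) * R (max (level w a) (level w a'))) ≤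
      2 * ∑ b ∈ levels w, (bucketProb w b : ℝ) * (R b * lowProb w b) := by
  set p : U → ℝ := fun a => (w a : ℝ) / ∑ x, (w x : ℝ) with hp
  have hp0 : ∀ a, 0 ≤ p a := fun a => by simp only [hp]; positivity
  let D : U → U → ℝ := fun a a' => p a * (p a' * if level w a' ≤ level w a then R (level w a) else 0)
  have h1 : ∑ a ∈ support w, ∑ a' ∈ support w, D a a' =
      ∑ b ∈ levels w, (bucketProb w b : ℝ) * (R b * lowProb w b) := by
    rw [← sum_level fun b => R b * lowProb w b]
    refine Finset.sum_congr rfl fun a _ => ?_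
    simp only [D]
    rw [← Finset.mul_sum]
    refine congrArg (p a * ·) ?_
    rw [lowProb, Finset.mul_sum, Finset.sum_filter]
    refine Finset.sum_congr rfl fun a' _ => ?_
    split_ifs
    · exact mul_comm _ _
    · exact mul_zero _
  calc _ ≤ ∑ a ∈ support w, ∑ a' ∈ support w, (D a a' + D a' a) := by
        refine Finset.sum_le_sum fun a _ => Finset.sum_le_sum fun a' _ => ?_
        have hnn : ∀ x y, 0 ≤ D x y := fun x y =>
          mul_nonneg (hp0 x) (mul_nonneg (hp0 y) (by split_ifs; exacts [hR _, le_rfl]))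
        rcases le_total (level w a') (level w a) with h | h
        · rw [max_eq_left h]
          refine le_add_of_le_of_nonneg (le_of_eq ?_) (hnn _ _)
          simp only [D, if_pos h, hp]
        · rw [max_eq_right h]
          refine le_add_of_nonneg_of_le (hnn _ _) (le_of_eq ?_)
          simp only [D, if_pos h, hp]
          ring
    _ = _ := by
        simp only [Finset.sum_add_distrib]
        rw [Finset.sum_comm (f := fun a a' => D a' a), h1, two_mul]

/-- The cancellation behind the algorithm: a rare bucket is expensive to sample from, but is chosen
correspondingly rarely. -/
lemma bucketProb_mul_bucketCost {b : ℤ} (hb : b ∈ levels w) (ε L : ℝ) :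
    (bucketProb w b : ℝ) * (bucketCost w ε b * L) =
      21000 / ε * (√((bucket w b).card : ℝ) * L) + 1700 / ε ^ 2 * L := by
  obtain ⟨a, ha, rfl⟩ := Finset.mem_image.1 hb
  have : (bucketProb w (level w a) : ℝ) ≠ 0 := by
    exact_mod_cast (bucketProb_pos ⟨a, mem_bucket_iff_level.2 ⟨ha, rfl⟩⟩).ne'
  unfold bucketCost
  field_simp

lemma lowProb_nonneg (b : ℤ) : 0 ≤ lowProb w b :=
  Finset.sum_nonneg fun a _ => by positivity

lemma lowProb_le_one (hw : 0 < ∑ a, (w a : ℝ)) (b : ℤ) : lowProb w b ≤ 1 := by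
  unfold lowProb
  rw [← Finset.sum_div, div_le_one hw]
  exact Finset.sum_le_univ_sum_of_nonneg fun _ => NNReal.coe_nonneg _

lemma lowProb_le (hw : 0 < ∑ a, (w a : ℝ)) (b : ℤ) :
    lowProb w b ≤ Fintype.card U * (2 : ℝ) ^ (b + 1) / ∑ a, (w a : ℝ) := by
  unfold lowProb
  rw [← Finset.sum_div]
  refine div_le_div_of_nonneg_right ?_ hw.le
  calc ∑ a ∈ (support w).filter fun a => level w a ≤ b, (w a : ℝ)
      ≤ ∑ a ∈ (support w).filter fun a => level w a ≤ b, (2 : ℝ) ^ (b + 1) := by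
        refine Finset.sum_le_sum fun a ha => ?_
        obtain ⟨h1, h2⟩ := Finset.mem_filter.1 ha
        refine (zpow_floor_logb_le (by exact_mod_cast mem_support.1 h1)).2.le.trans ?_
        exact zpow_le_zpow_right₀ one_le_two (by unfold level at h2; omega)
    _ ≤ _ := by
        rw [Finset.sum_const, nsmul_eq_mul]
        gcongr
        exact Finset.card_le_univ _

lemma card_bucket_mul_le (b : ℤ) : ((bucket w b).card : ℝ) * 2 ^ b ≤ ∑ a, (w a : ℝ) := by
  rw [← nsmul_eq_mul, ← Finset.sum_const]
  refine (Finset.sum_le_sum fun a ha => (mem_bucket.1 ha).1).trans ?_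
  exact Finset.sum_le_univ_sum_of_nonneg fun _ => NNReal.coe_nonneg _

lemma zpow_le_of_mem_levels {b : ℤ} (hb : b ∈ levels w) : (2 : ℝ) ^ b ≤ ∑ a, (w a : ℝ) := by
  obtain ⟨a, ha, rfl⟩ := Finset.mem_image.1 hb
  refine (zpow_floor_logb_le (by exact_mod_cast mem_support.1 ha)).1.trans ?_
  exact Finset.single_le_sum (f := fun a => (w a : ℝ)) (fun _ _ => NNReal.coe_nonneg _)
    (Finset.mem_univ a)

lemma sum_pow_le {ι : Type} (T : Finset ι) {e : ι → ℕ} (he : Set.InjOn e T) {r : ℝ} (h0 : 0 ≤ r)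
    (h1 : r < 1) : ∑ b ∈ T, r ^ e b ≤ (1 - r)⁻¹ := by
  classical
  rw [← tsum_geometric_of_lt_one h0 h1, ← Finset.sum_image (f := fun k => r ^ k) he]
  exact (summable_geometric_of_lt_one h0 h1).sum_le_tsum _ fun _ _ => by positivity

variable (w) in
/-- The level of the mean weight. -/
def meanLevel : ℤ := ⌊Real.logb 2 ((∑ a, (w a : ℝ)) / Fintype.card U)⌋

lemma meanLevel_spec (hw : 0 < ∑ a, (w a : ℝ)) (hn : 0 < Fintype.card U) :
    Fintype.card U * (2 : ℝ) ^ meanLevel w ≤ ∑ a, (w a : ℝ) ∧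
      ∑ a, (w a : ℝ) < Fintype.card U * (2 : ℝ) ^ (meanLevel w + 1) := by
  have hn' : (0 : ℝ) < Fintype.card U := by exact_mod_cast hn
  have h := zpow_floor_logb_le (div_pos hw hn')
  rw [le_div_iff₀ hn', div_lt_iff₀ hn'] at h
  unfold meanLevel
  constructor
  · linarith [h.1]
  · linarith [h.2]

/-- The at most `n` items up to level `b` weigh less than `2 ^ (b + 1)` each, while the total weight
is at least `n * 2 ^ meanLevel w`. -/
lemma lowProb_le_of_lt (hw : 0 < ∑ a, (w a : ℝ)) (hn : 0 < Fintype.card U) {b : ℤ}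
    (hb : b < meanLevel w) : lowProb w b ≤ 2 * (1 / 2) ^ (meanLevel w - b).toNat := by
  refine (lowProb_le hw b).trans ?_
  rw [div_le_iff₀ hw]
  obtain ⟨j, hj⟩ := Int.eq_ofNat_of_zero_le (by omega : 0 ≤ meanLevel w - b)
  have hb' : meanLevel w = b + j := by omega
  have h := (meanLevel_spec hw hn).1
  have h2 : (2 : ℝ) ^ (b + 1) = 2 * (1 / 2) ^ j * 2 ^ (meanLevel w) := by
    rw [hb', zpow_add₀ two_ne_zero, zpow_add₀ two_ne_zero, zpow_natCast, zpow_one, one_div, inv_pow]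
    field_simp
  rw [hj, Int.toNat_natCast, h2]
  calc _ = 2 * (1 / 2) ^ j * (Fintype.card U * (2 : ℝ) ^ meanLevel w) := by ring
    _ ≤ _ := mul_le_mul_of_nonneg_left h (by positivity)

lemma sqrt_card_bucket_le (b : ℤ) : √((bucket w b).card : ℝ) ≤ √(Fintype.card U : ℝ) :=
  Real.sqrt_le_sqrt (by exact_mod_cast Finset.card_le_univ _)

lemma sqrt_card_bucket_le_of_ge (hw : 0 < ∑ a, (w a : ℝ)) (hn : 0 < Fintype.card U) {b : ℤ}
    (hb : meanLevel w ≤ b) :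
    √((bucket w b).card : ℝ) ≤
      √(Fintype.card U : ℝ) * (2 * (3 / 4) ^ (b - meanLevel w).toNat) := by
  obtain ⟨j, hj⟩ := Int.eq_ofNat_of_zero_le (by omega : 0 ≤ b - meanLevel w)
  have hb' : b = meanLevel w + j := by omega
  have h1 := (card_bucket_mul_le (w := w) b).trans_lt (meanLevel_spec hw hn).2
  have h2 : (0 : ℝ) < 2 ^ b := by positivity
  have h3 : (2 : ℝ) ^ (meanLevel w + 1) = 2 * (1 / 2) ^ j * 2 ^ b := by
    rw [hb', zpow_add₀ two_ne_zero, zpow_add₀ two_ne_zero, zpow_natCast, zpow_one, one_div, inv_pow]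
    field_simp
  have h4 : ((bucket w b).card : ℝ) ≤ Fintype.card U * (2 * (1 / 2) ^ j) := by
    refine le_of_mul_le_mul_right (h1.le.trans_eq ?_) h2
    rw [h3]; ring
  rw [hj, Int.toNat_natCast]
  refine Real.sqrt_le_iff.2 ⟨by positivity, h4.trans ?_⟩
  rw [mul_pow, Real.sq_sqrt (by positivity), mul_pow, ← pow_mul, mul_comm j 2, pow_mul]
  refine mul_le_mul_of_nonneg_left ?_ (by positivity)
  -- The ratio 3/4 is a rational upper bound for `1 / √2`, the true rate of decay after taking
  -- square roots.
  have h5 : ((1 : ℝ) / 2) ^ j ≤ ((3 / 4 : ℝ) ^ 2) ^ j :=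
    pow_le_pow_left₀ (by norm_num) (by norm_num) j
  have h6 : (0 : ℝ) ≤ (1 / 2) ^ j := by positivity
  linarith

lemma injOn_toNat_sub (c : ℤ) (T : Finset ℤ) (hT : ∀ b ∈ T, c ≤ b) :
    Set.InjOn (fun b => (b - c).toNat) T := by
  intro x hx y hy h
  have := hT x hx
  have := hT y hy
  simp only at h
  omega

lemma injOn_toNat_sub' (c : ℤ) (T : Finset ℤ) (hT : ∀ b ∈ T, b < c) :
    Set.InjOn (fun b => (c - b).toNat) T := by
  intro x hx y hy h
  have := hT x hx
  have := hT y hy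
  simp only at h
  omega

lemma sum_lowProb_lt_le (hw : 0 < ∑ a, (w a : ℝ)) (hn : 0 < Fintype.card U) :
    ∑ b ∈ (levels w).filter (fun b => b < meanLevel w), lowProb w b ≤ 4 := by
  refine (Finset.sum_le_sum fun b hb =>
    lowProb_le_of_lt hw hn (Finset.mem_filter.1 hb).2).trans ?_
  rw [← Finset.mul_sum]
  have := sum_pow_le _ (injOn_toNat_sub' (meanLevel w) ((levels w).filter fun b => b < meanLevel w)
    fun b hb => (Finset.mem_filter.1 hb).2) (r := 1 / 2) (by norm_num) (by norm_num)
  norm_num at this ⊢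
  linarith

/-- Below the mean level `lowProb` gives the geometric decay and the size is bounded by `n`; from
there on the roles are exchanged. -/
lemma sum_sqrt_mul_lowProb_le (hw : 0 < ∑ a, (w a : ℝ)) (hn : 0 < Fintype.card U) :
    ∑ b ∈ levels w, √((bucket w b).card : ℝ) * lowProb w b ≤ 12 * √(Fintype.card U : ℝ) := by
  rw [← Finset.sum_filter_add_sum_filter_not (levels w) fun b => b < meanLevel w]
  have h1 : ∑ b ∈ (levels w).filter (fun b => b < meanLevel w),
      √((bucket w b).card : ℝ) * lowProb w b ≤ √(Fintype.card U : ℝ) * 4 := by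
    refine (Finset.sum_le_sum fun b _ =>
      mul_le_mul_of_nonneg_right (sqrt_card_bucket_le b) (lowProb_nonneg b)).trans ?_
    rw [← Finset.mul_sum]
    exact mul_le_mul_of_nonneg_left (sum_lowProb_lt_le hw hn) (Real.sqrt_nonneg _)
  have h2 : ∑ b ∈ (levels w).filter (fun b => ¬ b < meanLevel w),
      √((bucket w b).card : ℝ) * lowProb w b ≤ √(Fintype.card U : ℝ) * (2 * 4) := by
    have : ∀ b ∈ (levels w).filter (fun b => ¬ b < meanLevel w),
        √((bucket w b).card : ℝ) * lowProb w b ≤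
          √(Fintype.card U : ℝ) * (2 * (3 / 4) ^ (b - meanLevel w).toNat) := fun b hb =>
      (mul_le_of_le_one_right (Real.sqrt_nonneg _) (lowProb_le_one hw b)).trans
        (sqrt_card_bucket_le_of_ge hw hn (not_lt.1 (Finset.mem_filter.1 hb).2))
    refine (Finset.sum_le_sum this).trans ?_
    rw [← Finset.mul_sum, ← Finset.mul_sum]
    have := sum_pow_le _ (injOn_toNat_sub (meanLevel w)
      ((levels w).filter fun b => ¬ b < meanLevel w)
      fun b hb => not_lt.1 (Finset.mem_filter.1 hb).2) (r := 3 / 4) (by norm_num) (by norm_num)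
    norm_num at this
    gcongr
    simpa using this
  linarith

lemma sum_lowProb_le (hw : 0 < ∑ a, (w a : ℝ)) (hn : 2 ≤ Fintype.card U) :
    ∑ b ∈ levels w, lowProb w b ≤ 12 * Real.log (Fintype.card U : ℝ) := by
  have hn0 : 0 < Fintype.card U := by omega
  rw [← Finset.sum_filter_add_sum_filter_not (levels w) fun b => b < meanLevel w]
  have h1 := sum_lowProb_lt_le hw hn0
  set n := Fintype.card U with hndef
  -- A nonempty level satisfies `2 ^ b ≤ W < n * 2 ^ (meanLevel w + 1)`, which leaves at most
  -- `Nat.log 2 n + 2` levels from the mean level on.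
  have hsub : (levels w).filter (fun b => ¬ b < meanLevel w) ⊆
      Finset.Icc (meanLevel w) (meanLevel w + Nat.log 2 n + 1) := by
    intro b hb
    obtain ⟨hb1, hb2⟩ := Finset.mem_filter.1 hb
    refine Finset.mem_Icc.2 ⟨not_lt.1 hb2, ?_⟩
    have h3 := (zpow_le_of_mem_levels hb1).trans_lt (meanLevel_spec hw hn0).2
    have h4 : (n : ℝ) < 2 ^ (Nat.log 2 n + 1) := by
      exact_mod_cast Nat.lt_pow_succ_log_self one_lt_two n
    have h5 : (2 : ℝ) ^ b < 2 ^ (((Nat.log 2 n + 1 : ℕ) : ℤ) + (meanLevel w + 1)) := by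
      rw [zpow_add₀ two_ne_zero, zpow_natCast]
      exact h3.trans (mul_lt_mul_of_pos_right h4 (by positivity))
    have h6 := (zpow_lt_zpow_iff_right₀ (one_lt_two (α := ℝ))).1 h5
    push_cast at h6
    omega
  have h2 : ∑ b ∈ (levels w).filter (fun b => ¬ b < meanLevel w), lowProb w b ≤
      Nat.log 2 n + 2 := by
    refine (Finset.sum_le_sum fun b _ => lowProb_le_one hw b).trans ?_
    rw [Finset.sum_const, nsmul_eq_mul, mul_one]
    have := Finset.card_le_card hsub
    rw [Int.card_Icc] at this
    exact_mod_cast this.trans (by omega)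
  have hlog2 : 0.69 < Real.log 2 := by linarith [Real.log_two_gt_d9]
  have hlogn : Real.log 2 ≤ Real.log n := Real.log_le_log two_pos (by exact_mod_cast hn)
  have h3 : (Nat.log 2 n : ℝ) * Real.log 2 ≤ Real.log n := by
    rw [← Real.log_pow]
    refine Real.log_le_log (by positivity) ?_
    exact_mod_cast Nat.pow_log_le_self 2 (by omega)
  have h4 : (0 : ℝ) ≤ Nat.log 2 n := by positivity
  -- The total `Nat.log 2 n + 6` is absorbed by `12 * log n`; the constant 6 is where `n ≥ 2` is
  -- needed.
  nlinarith

variable [DecidableEq U] [MeasurableSpace U] [MeasurableSingletonClass U]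

theorem lintegral_sampleCount_noAdvicePropEstimator_le {hw : 0 < ∑ a, w a} {ε : ℝ} (h0 : 0 < ε)
    (h1 : ε < 1) (hn : 2 ≤ Fintype.card U) :
    ∫⁻ ω, sampleCount (noAdvicePropEstimator ε) (tapeOf w ω) ∂randomness w hw ≤
      ENNReal.ofReal (600000 * (√(Fintype.card U : ℝ) / ε +
        Real.log (Fintype.card U : ℝ) / ε ^ 2)) := by
  have hw' : 0 < ∑ a, (w a : ℝ) := by exact_mod_cast hw
  refine (lintegral_sampleCount_le h0 h1).trans (ENNReal.ofReal_le_ofReal ?_)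
  have hmax := sum_max_level_le (w := w) fun b => bucketCost_nonneg (w := w) h0 b
  rw [Finset.sum_congr rfl fun b hb => bucketProb_mul_bucketCost hb ε (lowProb w b),
    Finset.sum_add_distrib, ← Finset.mul_sum, ← Finset.mul_sum] at hmax
  have hA := mul_le_mul_of_nonneg_left (sum_sqrt_mul_lowProb_le hw' (by omega))
    (by positivity : 0 ≤ 21000 / ε)
  have hB := mul_le_mul_of_nonneg_left (sum_lowProb_le hw' hn)
    (by positivity : 0 ≤ 1700 / ε ^ 2)
  have hn1 : 1 ≤ √(Fintype.card U : ℝ) :=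
    Real.one_le_sqrt.2 (by exact_mod_cast (by omega : 1 ≤ Fintype.card U))
  have h2 : 1 ≤ √(Fintype.card U : ℝ) / ε := by
    rw [le_div_iff₀ h0]; linarith
  have h3 : 0 ≤ Real.log (Fintype.card U : ℝ) / ε ^ 2 := by
    have := Real.log_natCast_nonneg (Fintype.card U)
    positivity
  have hA' : 21000 / ε * (12 * √(Fintype.card U : ℝ)) =
      252000 * (√(Fintype.card U : ℝ) / ε) := by ring
  have hB' : 1700 / ε ^ 2 * (12 * Real.log (Fintype.card U : ℝ)) =
      20400 * (Real.log (Fintype.card U : ℝ) / ε ^ 2) := by ring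
  rw [hA'] at hA
  rw [hB'] at hB
  -- The main terms are `2 * 252000` and `2 * 20400`; the two initial samples are absorbed because
  -- `√n / ε ≥ 1`.
  linarith

end Levels

end PropSampling

end

theorem mainTheorem2 :
    ∃ C : ℝ, 0 < C ∧
      ∀ (U : Type) [Fintype U] [DecidableEq U] [MeasurableSpace U] [MeasurableSingletonClass U]
        (w : U → ℝ≥0) (hw : 0 < ∑ a, w a) (ε : ℝ), 0 < ε → ε < 1 →
        (2 / 3 : ℝ≥0∞) ≤ PropSampling.randomness w hw
            {ω | PropSampling.Approximates (PropSampling.noAdvicePropEstimator ε)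
              (PropSampling.tapeOf w ω) ε ((∑ a, w a : ℝ≥0) : ℝ)} ∧
        (2 ≤ Fintype.card U →
          ∫⁻ ω, PropSampling.sampleCount (PropSampling.noAdvicePropEstimator ε)
              (PropSampling.tapeOf w ω) ∂(PropSampling.randomness w hw) ≤
            ENNReal.ofReal (C * (√(Fintype.card U : ℝ) / ε +
              Real.log (Fintype.card U : ℝ) / ε ^ 2))) := by
  refine ⟨600000, by norm_num, ?_⟩
  intro U _ _ _ _ w hw ε h0 h1
  exact ⟨PropSampling.noAdvicePropEstimator_approximates h0 h1,
    fun hn => PropSampling.lintegral_sampleCount_noAdvicePropEstimator_le h0 h1 hn⟩
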